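/- **Setting.** Fix $p,q\ge 0$, a nonempty closed set $\Theta\subseteq\mathbb R^p$ and known functions $\mu,\sigma^2:\Theta\times[0,1]\times\mathbb R^q\to\mathbb R$ with $\sigma^2>0$, both locally Lipschitz in $\theta$, $C^1$ in $t$ and $C^2$ in $x$; fix $\varepsilon>0$. Given $n$, put $t_i=i/n$. An *experiment* is a filtered probability space $(\Omega,\mathcal F,(\mathcal F_t)_{t\in[0,1]},\mathbb P)$ with adapted (jointly measurable) processes $\mu_t\in\mathbb R$, $\sigma_t^2\ge0$, $X_t\in\mathbb R^q$, with $\mathcal F_{t_{i+1}}$-measurable $\widehat X_i\in\mathbb R^q$ and $Y_i\in\mathbb R$ for $0\le i<n$, and a random variable $\widehat\theta\in\Theta$. For a constant $C$, *Assumption 1* requires that, almost surely, for $W=\mu$ and $W=X$ and all $0\le t\le t+h\le1$, $$\|W_t\|\le C,\quad \|\mathbb E[W_{t+h}-W_t\mid\mathcal F_t]\|\le Ch,\quad \mathbb E[\|W_{t+h}-W_t\|^2\mid\mathcal F_t]\le Ch,$$ and for all $i$: $\mathbb E[\|\widehat X_i-X_{t_i}\|^{r}\mid\mathcal F_{t_i}]\le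 Cn^{-1}$ for $r=2,4$; $|\mathbb E[Y_i\mid\mathcal F_{t_i}]-\mu_{t_i}|\le Cn^{-1/2}$; $|\mathrm{Var}[Y_i\mid\mathcal F_{t_i}]-\sigma^2_{t_i}|\le Cn^{-1/4}$; $\mathbb E[|Y_i|^{4+\varepsilon}\mid\mathcal F_{t_i}]\le C$. Let $K_0,K_1:(0,\infty)\to\mathbb R$. * Under $H_0$, Assumption 1 holds and for some $\theta_0\in\Theta$, almost surely $\mu_t=\mu(\theta_0,t,X_t)$ and $\sigma_t^2=\sigma^2(\theta_0,t,X_t)$ for all $t$, and $\mathbb P(\|\widehat\theta-\theta_0\|>K_0(\eta)n^{-1/2})\le\eta$ for all $\eta>0$. * Under $H_1$, Assumption 1 holds, $\mu_t$ and $\sigma_t^2$ are otherwise unrestricted, and $\mathbb P(\|\widehat\theta\|>K_1(\eta))\le\eta$ for all $\eta>0$. *Assumption 2* (with constant $C$) requires that $W=\mu$ and each coordinate $W=X_{i}$ is an Itô semimartingale $$W_t=W_0+\int_0^t b_s\,ds+\int_0^t c_s^T\,dB_s+\int_0^t\!\int_{\mathbb R}f_s(x)\,\lambda(dx,ds),$$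 for a Brownian motion $B\in\mathbb R^{q+1}$ and an independent Poisson random measure $\lambda$ with compensator $dx\,ds$ (common to all of these processes, and both with respect to $(\mathcal F_t)$), and predictable $b,c,f$ (depending on the process) with $|b_s|\le C$, $\|c_s\|\le C$, $\int_{\mathbb R}1\wedge|f_s(x)|\,dx\le C$. The signal is $S_t(\theta)=(\mu_t-\mu(\theta,t,X_t))/\sigma(\theta,t,X_t)$. A sequence of critical regions is a sequence of events $C_n=\{(Y,\widehat X,\widehat\theta)\in R_n\}$, where $R_n$ is a Borel set of possible data. **Theorem.** For every such $(p,q,\Theta,\mu,\sigma^2)$ and $\varepsilon$ there is $C_0$ such that the following holds for all $C\ge C_0$ and all $K_0,K_1\ge C_0$. Let $\delta_n>0$ be a sequence with $\delta_n\to0$. (a) No sequence of critical regions $C_n$ satisfies both $\limsup_n\sup_{H_0}\mathbb P[C_n]<1$ and $\sup_{H_1}\mathbb P[E_n\setminus C_n]\to0$, where $E_n=\{\sup_{t\in[0,1]}|S_t(\widehat\theta)|\ge\delta_nn^{-1/4}\}$ and $H_0$, $H_1$ are both restricted to experiments that satisfy Assumption 2. (b) Let $J=J_n\in\mathbb N_0$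 with $2^{J}$ of exact order $n^{1/2}$, and let $0\le j_n\le J_n$ be any sequence. No sequence of critical regions $C_n$ satisfies both $\limsup_n\sup_{H_0}\mathbb P[C_n]<1$ and $\sup_{H_1}\mathbb P[E_n\setminus C_n]\to0$, where $$E_n=\Big\{\max_{0\le k<2^{j_n}}2^{j_n/2}\Big|\int_{2^{-j_n}k}^{2^{-j_n}(k+1)}S_t(\widehat\theta)\,dt\Big|\ge\delta_nn^{-1/2}\Big\}$$ (here Assumption 2 is not imposed). -/

import Mathlib

open MeasureTheory ProbabilityTheory Filter Topology Asymptotics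
open scoped unitInterval ENNReal NNReal

noncomputable section

namespace SemimartingaleDetection

/-! ### Parametric models and statistical experiments -/

/-- Known data of the null hypothesis: a closed parameter set `Θ ⊆ ℝ^p`, and a mean function `mean`
and a positive variance function `var`, evaluated at `(θ, t, x)` with `θ ∈ Θ`, `t ∈ [0,1]`,
`x ∈ ℝ^q`, which are locally Lipschitz in `θ`, `C¹` in `t` and `C²` in `x`. -/
structure ParametricModel (p q : ℕ) where
  Θ : Set (EuclideanSpace ℝ (Fin p))
  nonempty : Θ.Nonempty
  isClosed : IsClosed Θ
  mean : EuclideanSpace ℝ (Fin p) → ℝ → EuclideanSpace ℝ (Fin q) → ℝ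
  var : EuclideanSpace ℝ (Fin p) → ℝ → EuclideanSpace ℝ (Fin q) → ℝ
  var_pos : ∀ θ ∈ Θ, ∀ t ∈ Set.Icc (0 : ℝ) 1, ∀ x, 0 < var θ t x
  mean_lip : ∀ t ∈ Set.Icc (0 : ℝ) 1, ∀ x, LocallyLipschitzOn Θ (fun θ => mean θ t x)
  var_lip : ∀ t ∈ Set.Icc (0 : ℝ) 1, ∀ x, LocallyLipschitzOn Θ (fun θ => var θ t x)
  mean_time : ∀ θ ∈ Θ, ∀ x, ContDiffOn ℝ 1 (fun t => mean θ t x) (Set.Icc (0 : ℝ) 1)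
  var_time : ∀ θ ∈ Θ, ∀ x, ContDiffOn ℝ 1 (fun t => var θ t x) (Set.Icc (0 : ℝ) 1)
  mean_space : ∀ θ ∈ Θ, ∀ t ∈ Set.Icc (0 : ℝ) 1, ContDiff ℝ 2 (fun x => mean θ t x)
  var_space : ∀ θ ∈ Θ, ∀ t ∈ Set.Icc (0 : ℝ) 1, ContDiff ℝ 2 (fun x => var θ t x)

/-- The observation time `t_i = i / n` (for `i ≤ n`), as a point of `[0,1]`. -/
def gridTime (n i : ℕ) : I := Set.projIcc (0 : ℝ) 1 zero_le_one ((i : ℝ) / n)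

/-- A filtered probability space with time set `[0,1]`, carrying the unobserved adapted mean,
variance and covariate processes `μ`, `σ²`, `X`, the estimates `X̂_i` of `X_{t_i}` and the
observations `Y_i`, both `ℱ_{t_{i+1}}`-measurable, `i = 0, …, n-1`, and the parameter
estimate `θ̂`. -/
structure Experiment (p q n : ℕ) where
  Ω : Type
  mΩ : MeasurableSpace Ω
  P : Measure Ω
  isProb : IsProbabilityMeasure P
  ℱ : Filtration I mΩ
  μ : I → Ω → ℝ
  σsq : I → Ω → ℝ
  X : I → Ω → EuclideanSpace ℝ (Fin q)
  Xhat : Fin n → Ω → EuclideanSpace ℝ (Fin q)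
  Y : Fin n → Ω → ℝ
  θhat : Ω → EuclideanSpace ℝ (Fin p)
  μ_adapted : StronglyAdapted ℱ μ
  σsq_adapted : StronglyAdapted ℱ σsq
  X_adapted : StronglyAdapted ℱ X
  μ_measurable : Measurable (Function.uncurry μ)
  σsq_measurable : Measurable (Function.uncurry σsq)
  X_measurable : Measurable (Function.uncurry X)
  σsq_nonneg : ∀ t ω, 0 ≤ σsq t ω
  Xhat_measurable : ∀ i : Fin n, Measurable[ℱ (gridTime n (i + 1))] (Xhat i)
  Y_measurable : ∀ i : Fin n, Measurable[ℱ (gridTime n (i + 1))] (Y i)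
  θhat_measurable : Measurable θhat

attribute [instance] Experiment.mΩ Experiment.isProb

/-- The space of the data `(Y, X̂, θ̂)` available to a test. -/
abbrev Data (p q n : ℕ) : Type :=
  (Fin n → ℝ) × (Fin n → EuclideanSpace ℝ (Fin q)) × EuclideanSpace ℝ (Fin p)

variable {p q n : ℕ}

/-- The observed data of an experiment. -/
def Experiment.data (E : Experiment p q n) (ω : E.Ω) : Data p q n :=
  (fun i => E.Y i ω, fun i => E.Xhat i ω, E.θhat ω)

/-- The signal `S_t(θ) = (μ_t - μ(θ, t, X_t)) / σ(θ, t, X_t)`. -/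
def Experiment.signal (E : Experiment p q n) (M : ParametricModel p q)
    (θ : EuclideanSpace ℝ (Fin p)) (t : I) (ω : E.Ω) : ℝ :=
  (E.μ t ω - M.mean θ t (E.X t ω)) / √(M.var θ t (E.X t ω))

/-! ### The basic assumption -/

/-- Boundedness of a process and of its conditional increments: `W_t = O(1)`,
`E[W_{t+h} - W_t | ℱ_t] = O(h)` and `E[‖W_{t+h} - W_t‖² | ℱ_t] = O(h)`, with constant `C`. -/
structure HasBoundedIncrements {Ω : Type} {mΩ : MeasurableSpace Ω} {F : Type}
    [NormedAddCommGroup F] [NormedSpace ℝ F] [CompleteSpace F]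
    (C : ℝ) (P : Measure Ω) (ℱ : Filtration I mΩ) (W : I → Ω → F) : Prop where
  bound : ∀ t, ∀ᵐ ω ∂P, ‖W t ω‖ ≤ C
  increment_mean : ∀ s t : I, s ≤ t →
    ∀ᵐ ω ∂P, ‖(P[fun ω' => W t ω' - W s ω' | ℱ s]) ω‖ ≤ C * ((t : ℝ) - s)
  increment_sq : ∀ s t : I, s ≤ t →
    ∀ᵐ ω ∂P, (P[fun ω' => ‖W t ω' - W s ω'‖ ^ 2 | ℱ s]) ω ≤ C * ((t : ℝ) - s)

/-- The conditions common to both hypotheses, with all `O(·)` constants equal to `C` and moment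
exponent `4 + ε`. -/
structure Experiment.IsRegular (E : Experiment p q n) (M : ParametricModel p q) (ε C : ℝ) :
    Prop where
  μ_incr : HasBoundedIncrements C E.P E.ℱ E.μ
  X_incr : HasBoundedIncrements C E.P E.ℱ E.X
  Xhat_integrable : ∀ i : Fin n,
    Integrable (fun ω => ‖E.Xhat i ω - E.X (gridTime n i) ω‖ ^ 4) E.P
  Xhat_sq : ∀ i : Fin n, ∀ᵐ ω ∂E.P,
    (E.P[fun ω' => ‖E.Xhat i ω' - E.X (gridTime n i) ω'‖ ^ 2 | E.ℱ (gridTime n i)]) ω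
      ≤ C * (n : ℝ)⁻¹
  Xhat_fourth : ∀ i : Fin n, ∀ᵐ ω ∂E.P,
    (E.P[fun ω' => ‖E.Xhat i ω' - E.X (gridTime n i) ω'‖ ^ 4 | E.ℱ (gridTime n i)]) ω
      ≤ C * (n : ℝ)⁻¹
  Y_integrable : ∀ i : Fin n, Integrable (fun ω => |E.Y i ω| ^ (4 + ε)) E.P
  Y_mean : ∀ i : Fin n, ∀ᵐ ω ∂E.P,
    |(E.P[E.Y i | E.ℱ (gridTime n i)]) ω - E.μ (gridTime n i) ω| ≤ C * (n : ℝ) ^ (-(1 / 2) : ℝ)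
  Y_var : ∀ i : Fin n, ∀ᵐ ω ∂E.P,
    |(condVar (E.ℱ (gridTime n i)) (E.Y i) E.P) ω - E.σsq (gridTime n i) ω|
      ≤ C * (n : ℝ) ^ (-(1 / 4) : ℝ)
  Y_moment : ∀ i : Fin n, ∀ᵐ ω ∂E.P,
    (E.P[fun ω' => |E.Y i ω'| ^ (4 + ε) | E.ℱ (gridTime n i)]) ω ≤ C
  θhat_mem : ∀ ω, E.θhat ω ∈ M.Θ

/-- The null hypothesis: for some `θ₀ ∈ Θ`, `μ_t = μ(θ₀, t, X_t)` and `σ_t² = σ²(θ₀, t, X_t)`, and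
`θ̂ - θ₀ = O_p(n^{-1/2})` with constants `K`. -/
def Experiment.IsNull (E : Experiment p q n) (M : ParametricModel p q) (ε C : ℝ) (K : ℝ → ℝ) :
    Prop :=
  E.IsRegular M ε C ∧
  ∃ θ₀ ∈ M.Θ,
    (∀ᵐ ω ∂E.P, ∀ t : I, E.μ t ω = M.mean θ₀ t (E.X t ω) ∧ E.σsq t ω = M.var θ₀ t (E.X t ω)) ∧
    ∀ η : ℝ, 0 < η →
      E.P {ω | K η * (n : ℝ) ^ (-(1 / 2) : ℝ) < ‖E.θhat ω - θ₀‖} ≤ ENNReal.ofReal η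

/-- The alternative hypothesis: `μ_t` and `σ_t²` are unrestricted, and `θ̂ = O_p(1)` with
constants `K`. -/
def Experiment.IsAlternative (E : Experiment p q n) (M : ParametricModel p q) (ε C : ℝ)
    (K : ℝ → ℝ) : Prop :=
  E.IsRegular M ε C ∧
  ∀ η : ℝ, 0 < η → E.P {ω | K η < ‖E.θhat ω‖} ≤ ENNReal.ofReal η

/-! ### Itô semimartingales -/

section Ito

variable {Ω : Type} {mΩ : MeasurableSpace Ω} {d : ℕ}

/-- `B` is a `d`-dimensional standard Brownian motion with respect to the filtration `ℱ`. -/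
structure IsBrownianMotion (P : Measure Ω) (ℱ : Filtration I mΩ)
    (B : I → Ω → EuclideanSpace ℝ (Fin d)) : Prop where
  adapted : StronglyAdapted ℱ B
  start : ∀ᵐ ω ∂P, B 0 ω = 0
  continuous_paths : ∀ᵐ ω ∂P, Continuous (fun t => B t ω)
  increment_law : ∀ s t : I, s ≤ t →
    P.map (fun ω (i : Fin d) => B t ω i - B s ω i)
      = Measure.pi (fun _ : Fin d => gaussianReal 0 (Real.toNNReal ((t : ℝ) - s)))
  increment_indep : ∀ s t : I, s ≤ t →
    Indep (MeasurableSpace.comap (fun ω => B t ω - B s ω) inferInstance) (ℱ s) P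

/-- `ν` is a Poisson random measure on `ℝ × [0,1]` with respect to the filtration `ℱ`, with
compensator (intensity) Lebesgue measure `dx ds`. -/
structure IsPoissonRandomMeasure (P : Measure Ω) (ℱ : Filtration I mΩ)
    (ν : Ω → Measure (ℝ × I)) : Prop where
  adapted : ∀ t : I, Measurable[ℱ t] (fun ω => (ν ω).restrict (Set.univ ×ˢ Set.Iic t))
  law : ∀ A : Set (ℝ × I), MeasurableSet A → volume A ≠ ∞ →
    P.map (fun ω => ν ω A)
      = (poissonMeasure (volume A).toNNReal).map (Nat.cast : ℕ → ℝ≥0∞)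
  indep : ∀ (m : ℕ) (A : Fin m → Set (ℝ × I)), (∀ i, MeasurableSet (A i)) →
    Pairwise (fun i j => Disjoint (A i) (A j)) → iIndepFun (fun i ω => ν ω (A i)) P
  future_indep : ∀ t : I,
    Indep (MeasurableSpace.comap (fun ω => (ν ω).restrict (Set.univ ×ˢ Set.Ioi t)) inferInstance)
      (ℱ t) P

/-- A simple predictable process `∑_i ξ_i 1_{(s_i, u_i]}` with `ξ_i` bounded and
`ℱ_{s_i}`-measurable. -/
structure SimpleProcess (ℱ : Filtration I mΩ) (d : ℕ) where
  N : ℕ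
  s : Fin N → I
  u : Fin N → I
  s_le_u : ∀ i, s i ≤ u i
  ξ : Fin N → Ω → EuclideanSpace ℝ (Fin d)
  ξ_measurable : ∀ i, Measurable[ℱ (s i)] (ξ i)
  ξ_bounded : ∀ i, ∃ K : ℝ, ∀ ω, ‖ξ i ω‖ ≤ K

/-- The value of a simple process. -/
def SimpleProcess.eval {ℱ : Filtration I mΩ} (H : SimpleProcess ℱ d) (t : I) (ω : Ω) :
    EuclideanSpace ℝ (Fin d) :=
  ∑ i, (Set.Ioc (H.s i) (H.u i)).indicator (fun _ => H.ξ i ω) t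

/-- The elementary stochastic integral `∫_0^t H_sᵀ dB_s` of a simple process. -/
def SimpleProcess.integral {ℱ : Filtration I mΩ} (H : SimpleProcess ℱ d)
    (B : I → Ω → EuclideanSpace ℝ (Fin d)) (t : I) (ω : Ω) : ℝ :=
  ∑ i, inner ℝ (H.ξ i ω) (B (min (H.u i) t) ω - B (min (H.s i) t) ω)

/-- `Z_t = ∫_0^t c_sᵀ dB_s`: the process `Z` has a.s. continuous paths and is the `L²`-limit of the
integrals of simple processes converging to `c` in `L²(dP ⊗ dt)`. -/
def IsItoIntegral (P : Measure Ω) (ℱ : Filtration I mΩ) (B : I → Ω → EuclideanSpace ℝ (Fin d))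
    (c : I → Ω → EuclideanSpace ℝ (Fin d)) (Z : I → Ω → ℝ) : Prop :=
  (∀ᵐ ω ∂P, Continuous (fun t => Z t ω)) ∧
  (∀ t, AEStronglyMeasurable (Z t) P) ∧
  ∃ H : ℕ → SimpleProcess ℱ d,
    Tendsto (fun k => ∫⁻ ω, ∫⁻ t : I, ‖(H k).eval t ω - c t ω‖ₑ ^ 2 ∂volume ∂P) atTop (𝓝 0) ∧
    ∀ t, Tendsto (fun k => eLpNorm (fun ω => (H k).integral B t ω - Z t ω) 2 P) atTop (𝓝 0)

/-- `W` is a real Itô semimartingale driven by `B` and `ν`,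
`W_t = W_0 + ∫_0^t b_s ds + ∫_0^t c_sᵀ dB_s + ∫_0^t ∫_ℝ f_s(x) ν(dx, ds)`,
with predictable `b`, `c`, `f` such that `|b_s|`, `‖c_s‖` and `∫_ℝ 1 ∧ |f_s(x)| dx` are bounded
by `C`. -/
def IsItoSemimartingale (C : ℝ) (P : Measure Ω) (ℱ : Filtration I mΩ)
    (B : I → Ω → EuclideanSpace ℝ (Fin d)) (ν : Ω → Measure (ℝ × I)) (W : I → Ω → ℝ) : Prop :=
  ∃ (b : I → Ω → ℝ) (c : I → Ω → EuclideanSpace ℝ (Fin d)) (f : I → Ω → ℝ → ℝ) (Z : I → Ω → ℝ),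
    IsStronglyPredictable ℱ b ∧ IsStronglyPredictable ℱ c ∧
    Measurable[ℱ.predictable.prod inferInstance] (fun z : (I × Ω) × ℝ => f z.1.1 z.1.2 z.2) ∧
    (∀ᵐ ω ∂P, ∀ t, |b t ω| ≤ C ∧ ‖c t ω‖ ≤ C ∧
      ∫⁻ x : ℝ, min 1 ‖f t ω x‖ₑ ≤ ENNReal.ofReal C) ∧
    IsItoIntegral P ℱ B c Z ∧
    ∀ᵐ ω ∂P, ∀ t : I, W t ω = W 0 ω + (∫ s in Set.Iic t, b s ω) + Z t ω
      + ∫ z in Set.univ ×ˢ Set.Iic t, f z.2 ω z.1 ∂(ν ω)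

end Ito

/-- The processes `μ` and `X` are Itô semimartingales with characteristics bounded by `C` and
finite-variation jumps, driven by a common `(q+1)`-dimensional Brownian motion and an independent
Poisson random measure. -/
def Experiment.IsIto (E : Experiment p q n) (C : ℝ) : Prop :=
  ∃ (B : I → E.Ω → EuclideanSpace ℝ (Fin (q + 1))) (ν : E.Ω → Measure (ℝ × I)),
    IsBrownianMotion E.P E.ℱ B ∧ IsPoissonRandomMeasure E.P E.ℱ ν ∧
    IndepFun (fun ω t => B t ω) ν E.P ∧
    IsItoSemimartingale C E.P E.ℱ B ν E.μ ∧
    ∀ i : Fin q, IsItoSemimartingale C E.P E.ℱ B ν (fun t ω => E.X t ω i)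

/-! ### Events and uniform error probabilities -/

/-- The event `‖S(θ̂)‖_∞ ≥ r`. -/
def Experiment.supEvent (E : Experiment p q n) (M : ParametricModel p q) (r : ℝ) : Set E.Ω :=
  {ω | ENNReal.ofReal r ≤ ⨆ t : I, ‖E.signal M (E.θhat ω) t ω‖ₑ}

/-- The event `max_{0 ≤ k < 2^j} 2^{j/2} |∫_{2^{-j} k}^{2^{-j} (k+1)} S_t(θ̂) dt| ≥ r`. -/
def Experiment.dyadicEvent (E : Experiment p q n) (M : ParametricModel p q) (j : ℕ) (r : ℝ) :
    Set E.Ω :=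
  {ω | r ≤ ⨆ k : Fin (2 ^ j), (2 : ℝ) ^ ((j : ℝ) / 2) *
    |∫ t in {t : I | (t : ℝ) ∈ Set.Ioc ((k : ℝ) / 2 ^ j) (((k : ℝ) + 1) / 2 ^ j)},
      E.signal M (E.θhat ω) t ω|}

/-- The sequence of tests rejecting when the data lie in `R n` detects the events `D n`, uniformly
over the hypotheses `H₀` and `H₁`: one has `limsup_n sup_{H₀} P[C_n] < 1` and
`sup_{H₁} P[D_n \ C_n] → 0`, where `C_n` is the event that the data lie in `R n`. -/
def Detects (H₀ H₁ : ∀ n : ℕ, Experiment p q n → Prop)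
    (D : ∀ (n : ℕ) (E : Experiment p q n), Set E.Ω) (R : ∀ n : ℕ, Set (Data p q n)) : Prop :=
  limsup (fun n : ℕ => ⨆ (E : Experiment p q n) (_ : H₀ n E), E.P (E.data ⁻¹' R n)) atTop < 1 ∧
  Tendsto (fun n : ℕ => ⨆ (E : Experiment p q n) (_ : H₁ n E), E.P (D n E \ E.data ⁻¹' R n))
    atTop (𝓝 0)

end SemimartingaleDetection

end

/-! The lower bound compares, for each `n`, one null and one alternative experiment whose data are
almost indistinguishable, although every outcome of the alternative lies in `E_n`. Fix `θ ∈ Θ`, take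
`X = X̂ = 0`, `θ̂ = θ`, give `σ²` its null value, and let `Y_i = μ_{t_i} + σ_{t_i} g_i` with
independent standard Gaussian `g_i`. The null has `μ_t = μ(θ, t, 0)`. The alternative adds a path
`D` that equals `a` up to time `r`, then follows the increments of a Brownian motion, and is stopped
on leaving `(0, b)` with `b = N a` (`stoppedExperiment`).

The signal has to be random. A bump of height `a` must disappear within a time of order `a²` to stay
invisible, and a deterministic descent that steep has slope of order `1/a`, against the bounded
conditional drift. A stopped Brownian motion has no drift, and its conditional variance grows at
rate at most one, so all constants in the assumptions stay independent of `a`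
(`setIntegral_stopPath_sub`, `IsRealBrownian.hasBoundedIncrements`). They depend only on bounds for
the model along the compact path `X = 0`.

The signal is nearly invisible (`measure_sum_sq_stopPath_le`). Since `D ≥ 0` has mean `a`, Markov's
inequality gives probability at most `1/N` of being at `N a` at a given time. If at time `r + N⁴a²`
the path is neither there nor absorbed at `0`, a Gaussian increment of standard deviation `N²a` lies
in `[-N a, N a]`, which again has probability at most `1/N`. Otherwise `D` lies in `[0, N a]` and
vanishes from that time on (up to the irrelevant endpoint `1`), so `∑ (D_{t_i}/σ_{t_i})² ≤ (n (r +
N⁴a²) + 1) (N a/c)²`. Given `D`, the data are a fixed function of shifted Gaussian noise, and a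
shift `x` changes probabilities by at most `√(exp(∑ x_i²) - 1)` (`noiseMeasure_preimage_add_le`).
Hence no test works as soon as `n r a² → 0` and `n a⁴ → 0` (`not_detects_of_stoppedExperiment`).

For (a), take `r = 0` and `a` of order `δ n^{-1/4}`, so that the signal is already large at time
`0`. For (b), take `r = 2^{-j}` and `a` of order `δ n^{-1/2} 2^{j/2}`, so that the signal is
constant in height on the first dyadic interval; then `n r a²` is of order `δ²`, and `n a⁴` is of
order `δ⁴ 2^{2j}/n`, which is `O(δ⁴)` because `2^j = O(n^{1/2})`.

The remaining work shows that such experiments exist. Brownian motion comes from its Schauder series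
(`isBrownianMotion_brownianVec`). Assumption 2 also asks for a Poisson random measure, even though
the jump coefficient used is zero (`isPoissonRandomMeasure_poissonRM`). Optional stopping and the
Itô representation of `D` are derived from telescoping sums on fine grids (`stoppedSum`). -/

noncomputable section

namespace SemimartingaleDetection

section

/-! ### The Schauder expansion of the Brownian covariance -/

/-- The tent function on `[0,1]`. -/
def tent (x : ℝ) : ℝ := max 0 (min x (1 - x))

lemma tent_nonneg (x : ℝ) : 0 ≤ tent x := le_max_left _ _

lemma tent_le (x : ℝ) : tent x ≤ 1 / 2 := by
  unfold tent
  refine max_le (by norm_num) ?_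
  rcases le_total x (1 / 2) with h | h
  · exact (min_le_left _ _).trans h
  · exact (min_le_right _ _).trans (by linarith)

@[fun_prop]
lemma continuous_tent : Continuous tent := by unfold tent; fun_prop

/-- The integer translates of the tent have supports that overlap only at endpoints, so every sum
over translates collapses to a single term. -/
lemma tent_sub_natCast (x : ℝ) (k : ℕ) :
    tent (x - k) = if ⌊x⌋ = k then tent (Int.fract x) else 0 := by
  split_ifs with h
  · rw [Int.fract, h]; simp
  · unfold tent
    apply max_eq_left
    rcases lt_or_gt_of_ne h with h | h
    · have : x < k := by
        have := Int.floor_lt.1 h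
        exact_mod_cast this
      exact (min_le_left _ _).trans (by linarith)
    · have h' : (k : ℤ) + 1 ≤ ⌊x⌋ := h
      have := Int.le_floor.1 h'
      push_cast at this
      exact (min_le_right _ _).trans (by linarith)

/-- The covariance of independent Brownian bridges on the intervals `[k, k+1]`. -/
def bridgeCov (x y : ℝ) : ℝ :=
  if ⌊x⌋ = ⌊y⌋ then min (Int.fract x) (Int.fract y) - Int.fract x * Int.fract y else 0

lemma abs_bridgeCov_le (x y : ℝ) : |bridgeCov x y| ≤ 1 := by
  unfold bridgeCov
  have hx := Int.fract_nonneg x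
  have hy := Int.fract_nonneg y
  have hx1 := (Int.fract_lt_one x).le
  have hy1 := (Int.fract_lt_one y).le
  split_ifs
  · rw [abs_le]
    constructor
    · have := le_min hx hy
      nlinarith
    · have := (min_le_left (Int.fract x) (Int.fract y))
      nlinarith [mul_nonneg hx hy]
  · simp

lemma floor_fract_two_mul (x : ℝ) :
    (Int.fract x < 1 / 2 ∧ ⌊2 * x⌋ = 2 * ⌊x⌋ ∧ Int.fract (2 * x) = 2 * Int.fract x) ∨
    (1 / 2 ≤ Int.fract x ∧ ⌊2 * x⌋ = 2 * ⌊x⌋ + 1 ∧ Int.fract (2 * x) = 2 * Int.fract x - 1) := by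
  have hx := Int.fract_nonneg x
  have hx1 := Int.fract_lt_one x
  have e := Int.floor_add_fract x
  rcases lt_or_ge (Int.fract x) (1 / 2) with h | h
  · left
    have hf : ⌊2 * x⌋ = 2 * ⌊x⌋ := by
      rw [Int.floor_eq_iff]; push_cast; constructor <;> linarith
    refine ⟨h, hf, ?_⟩
    rw [Int.fract, hf, Int.fract]; push_cast; ring
  · right
    have hf : ⌊2 * x⌋ = 2 * ⌊x⌋ + 1 := by
      rw [Int.floor_eq_iff]; push_cast; constructor <;> linarith
    refine ⟨h, hf, ?_⟩
    rw [Int.fract, hf, Int.fract]; push_cast; ring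

/-- Midpoint displacement: a Brownian bridge on a unit interval is a tent times an independent
Gaussian, plus independent bridges on the two halves. By Brownian scaling the half-length bridges
have covariance `1/2 * bridgeCov (2 * x) (2 * y)`. The four cases record in which half `x` and `y`
lie. -/
lemma bridgeCov_eq (x y : ℝ) :
    bridgeCov x y = (if ⌊x⌋ = ⌊y⌋ then tent (Int.fract x) * tent (Int.fract y) else 0)
      + 1 / 2 * bridgeCov (2 * x) (2 * y) := by
  have hx := Int.fract_nonneg x
  have hx1 := Int.fract_lt_one x
  have hy := Int.fract_nonneg y
  have hy1 := Int.fract_lt_one y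
  unfold bridgeCov tent
  rcases floor_fract_two_mul x with ⟨h1, h2, h3⟩ | ⟨h1, h2, h3⟩ <;>
  rcases floor_fract_two_mul y with ⟨g1, g2, g3⟩ | ⟨g1, g2, g3⟩ <;>
  rw [h2, h3, g2, g3] <;> by_cases hxy : ⌊x⌋ = ⌊y⌋
  all_goals try rw [if_neg hxy, if_neg hxy, if_neg (by omega)]; norm_num
  all_goals rw [if_pos hxy, if_pos hxy]
  · rw [if_pos (by omega), max_eq_right (le_min hx (by linarith)),
      max_eq_right (le_min hy (by linarith)), min_eq_left (by linarith : Int.fract x ≤ 1 - _),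
      min_eq_left (by linarith : Int.fract y ≤ 1 - _), ← mul_min_of_nonneg _ _ (by norm_num : (0:ℝ) ≤ 2)]
    ring
  · rw [if_neg (by omega), max_eq_right (le_min hx (by linarith)),
      max_eq_right (le_min hy (by linarith)), min_eq_left (by linarith : Int.fract x ≤ 1 - _),
      min_eq_right (by linarith : 1 - _ ≤ Int.fract y), min_eq_left (by linarith)]
    ring
  · rw [if_neg (by omega), max_eq_right (le_min hx (by linarith)),
      max_eq_right (le_min hy (by linarith)), min_eq_right (by linarith : 1 - _ ≤ Int.fract x),
      min_eq_left (by linarith : Int.fract y ≤ 1 - _), min_eq_right (by linarith)]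
    ring
  · rw [if_pos (by omega), max_eq_right (le_min hx (by linarith)),
      max_eq_right (le_min hy (by linarith)), min_eq_right (by linarith : 1 - _ ≤ Int.fract x),
      min_eq_right (by linarith : 1 - _ ≤ Int.fract y), min_sub_sub_right,
      ← mul_min_of_nonneg _ _ (by norm_num : (0:ℝ) ≤ 2)]
    ring

lemma sum_tent_mul_tent {x y : ℝ} {m : ℕ} (hx : 0 ≤ x) (hxm : x < m) :
    ∑ k ∈ Finset.range m, tent (x - k) * tent (y - k) =
      if ⌊x⌋ = ⌊y⌋ then tent (Int.fract x) * tent (Int.fract y) else 0 := by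
  simp_rw [tent_sub_natCast]
  obtain ⟨l, hl⟩ := Int.eq_ofNat_of_zero_le (Int.floor_nonneg.2 hx)
  have hlm : l < m := by
    have : ⌊x⌋ < m := Int.floor_lt.2 (by exact_mod_cast hxm)
    omega
  rw [Finset.sum_eq_single l]
  · rw [hl, if_pos rfl]
    by_cases h : ⌊y⌋ = l
    · rw [if_pos h, if_pos h.symm]
    · rw [if_neg h, if_neg (Ne.symm h), mul_zero]
  · intro k _ hk
    rw [if_neg, zero_mul]
    rw [hl]; exact_mod_cast hk.symm
  · intro h; exact absurd (Finset.mem_range.2 hlm) h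

/-- Iterated midpoint displacement. The remainder is at most `2^{-N}` because `bridgeCov` is bounded
by one. -/
lemma bridgeCov_eq_sum (u v : ℝ) (N : ℕ) :
    bridgeCov u v = (∑ j ∈ Finset.range N, (1 / 2 : ℝ) ^ j *
      (if ⌊2 ^ j * u⌋ = ⌊2 ^ j * v⌋ then
        tent (Int.fract (2 ^ j * u)) * tent (Int.fract (2 ^ j * v)) else 0))
      + (1 / 2) ^ N * bridgeCov (2 ^ N * u) (2 ^ N * v) := by
  induction N with
  | zero => simp
  | succ N ih =>
    rw [ih, Finset.sum_range_succ, bridgeCov_eq (2 ^ N * u)]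
    rw [pow_succ, pow_succ, show (2:ℝ) * (2 ^ N * u) = 2 ^ N * 2 * u by ring,
      show (2:ℝ) * (2 ^ N * v) = 2 ^ N * 2 * v by ring]
    ring

/-- The time change turning a Brownian bridge into a Brownian motion. -/
def bridgeTime (t : I) : ℝ := t / (1 + t)

lemma one_add_pos (t : I) : (0 : ℝ) < 1 + t := by linarith [t.2.1]

lemma bridgeTime_nonneg (t : I) : 0 ≤ bridgeTime t := div_nonneg t.2.1 (one_add_pos t).le

lemma bridgeTime_lt_one (t : I) : bridgeTime t < 1 := by
  rw [bridgeTime, div_lt_one (one_add_pos t)]; linarith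

@[fun_prop]
lemma continuous_bridgeTime : Continuous bridgeTime := by
  unfold bridgeTime
  exact continuous_subtype_val.div (by fun_prop) fun t => (one_add_pos t).ne'

/-- The Schauder functions of Brownian motion on `[0,1]`. -/
def schauder (j k : ℕ) (t : I) : ℝ :=
  (1 + t) * √(1 / 2) ^ j * tent (2 ^ j * bridgeTime t - k)

@[fun_prop]
lemma continuous_schauder (j k : ℕ) : Continuous (schauder j k) := by
  unfold schauder; fun_prop

lemma schauder_nonneg (j k : ℕ) (t : I) : 0 ≤ schauder j k t :=
  mul_nonneg (mul_nonneg (one_add_pos t).le (by positivity)) (tent_nonneg _)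

/-- For given `t` at most one `k` contributes; the factor `1 + t ≤ 2` cancels against the height
`1/2` of the tent. -/
lemma sum_schauder_le (j : ℕ) (t : I) :
    ∑ k ∈ Finset.range (2 ^ j), schauder j k t ≤ √(1 / 2) ^ j := by
  unfold schauder
  rw [← Finset.mul_sum]
  have : ∑ k ∈ Finset.range (2 ^ j), tent (2 ^ j * bridgeTime t - k) ≤ 1 / 2 := by
    simp_rw [tent_sub_natCast]
    obtain ⟨l, hl⟩ := Int.eq_ofNat_of_zero_le
      (Int.floor_nonneg.2 (mul_nonneg (by positivity : (0:ℝ) ≤ 2 ^ j) (bridgeTime_nonneg t)))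
    rw [hl]
    simp only [Nat.cast_inj, Finset.sum_ite_eq]
    split_ifs
    · exact tent_le _
    · norm_num
  have h2 : (1 : ℝ) + t ≤ 2 := by linarith [t.2.2]
  have h3 : (0 : ℝ) ≤ √(1 / 2) ^ j := by positivity
  calc _ ≤ (1 + (t : ℝ)) * √(1 / 2) ^ j * (1 / 2) :=
        mul_le_mul_of_nonneg_left this (mul_nonneg (one_add_pos t).le h3)
    _ ≤ 2 * √(1 / 2) ^ j * (1 / 2) := by gcongr
    _ = _ := by ring

/-- If `β` is a Brownian bridge on `[0,1]`, then `(1 + t) β(t/(1 + t))` is a Brownian motion: with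
`u = s/(1 + s)` and `v = t/(1 + t)`, one has `(1 + s)(1 + t)(min u v - u v) = min s t`. The whole
process is thus a tent series, with no separate linear term. All times `t/(1 + t)` stay below `1`,
so only the bridge on the first unit interval enters. -/
lemma tendsto_sum_schauder (s t : I) :
    Tendsto (fun N => ∑ j ∈ Finset.range N, ∑ k ∈ Finset.range (2 ^ j),
      schauder j k s * schauder j k t) atTop (𝓝 (min s t : ℝ)) := by
  have key : ∀ N, ∑ j ∈ Finset.range N, ∑ k ∈ Finset.range (2 ^ j),
      schauder j k s * schauder j k t = (1 + s) * (1 + t) * (bridgeCov (bridgeTime s) (bridgeTime t)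
        - (1 / 2) ^ N * bridgeCov (2 ^ N * bridgeTime s) (2 ^ N * bridgeTime t)) := by
    intro N
    rw [bridgeCov_eq_sum _ _ N, add_sub_cancel_right, Finset.mul_sum]
    refine Finset.sum_congr rfl fun j _ => ?_
    rw [← sum_tent_mul_tent (m := 2 ^ j) (by have := bridgeTime_nonneg s; positivity)]
    · have : (1 / 2 : ℝ) ^ j = √(1 / 2) ^ j * √(1 / 2) ^ j := by
        rw [← mul_pow, Real.mul_self_sqrt (by norm_num)]
      rw [this, Finset.mul_sum, Finset.mul_sum]
      refine Finset.sum_congr rfl fun k _ => ?_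
      unfold schauder; ring
    · push_cast
      have := bridgeTime_lt_one s
      have h2 : (0:ℝ) < 2 ^ j := by positivity
      nlinarith
  simp_rw [key]
  have hz : Tendsto (fun N : ℕ => (1 / 2 : ℝ) ^ N *
      bridgeCov (2 ^ N * bridgeTime s) (2 ^ N * bridgeTime t)) atTop (𝓝 0) := by
    refine squeeze_zero_norm (a := fun N : ℕ => (1 / 2 : ℝ) ^ N) (fun N => ?_)
      (tendsto_pow_atTop_nhds_zero_of_lt_one (by norm_num) (by norm_num))
    rw [norm_mul, Real.norm_eq_abs, Real.norm_eq_abs, abs_of_nonneg (by positivity)]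
    exact mul_le_of_le_one_right (by positivity) (abs_bridgeCov_le _ _)
  have := (tendsto_const_nhds (x := bridgeCov (bridgeTime s) (bridgeTime t))).sub hz
  have := this.const_mul ((1 + (s : ℝ)) * (1 + t))
  convert this using 2
  have hs := bridgeTime_nonneg s
  have ht := bridgeTime_nonneg t
  have hs1 := bridgeTime_lt_one s
  have ht1 := bridgeTime_lt_one t
  have e1 : ⌊bridgeTime s⌋ = 0 := Int.floor_eq_zero_iff.2 ⟨hs, hs1⟩
  have e2 : ⌊bridgeTime t⌋ = 0 := Int.floor_eq_zero_iff.2 ⟨ht, ht1⟩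
  rw [bridgeCov, e1, e2, if_pos rfl, Int.fract_eq_self.2 ⟨hs, hs1⟩, Int.fract_eq_self.2 ⟨ht, ht1⟩]
  have ps := one_add_pos s
  have pt := one_add_pos t
  have mono : ∀ a b : I, a ≤ b → bridgeTime a ≤ bridgeTime b := by
    intro a b hab
    have hab' : (a : ℝ) ≤ b := hab
    unfold bridgeTime
    rw [div_le_div_iff₀ (one_add_pos a) (one_add_pos b)]
    nlinarith
  rcases le_total s t with h | h
  · rw [min_eq_left (show (s:ℝ) ≤ t from h), min_eq_left (mono _ _ h)]
    unfold bridgeTime; field_simp; ring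
  · rw [min_eq_right (show (t:ℝ) ≤ s from h), min_eq_right (mono _ _ h)]
    unfold bridgeTime; field_simp; ring

end

section

/-! ### Limits of Gaussian vectors -/

/-- Completeness of `L^p`: a series with summable norms converges in `L^p`, and its sum there agrees
almost everywhere with the pointwise sum. -/
lemma ae_summable_and_memLp_tsum {Ω : Type*} {mΩ : MeasurableSpace Ω} {P : Measure Ω}
    {p : ℝ≥0∞} [hp : Fact (1 ≤ p)] {f : ℕ → Ω → ℝ} (hf : ∀ n, MemLp (f n) p P)
    (h : ∑' n, eLpNorm (f n) p P ≠ ∞) :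
    (∀ᵐ ω ∂P, Summable fun n => f n ω) ∧ MemLp (fun ω => ∑' n, f n ω) p P := by
  constructor
  · filter_upwards [summable_norm_of_tsum_eLpNorm_ne_top hp.out (fun n => (hf n).1) h] with ω hω
    exact hω.of_norm
  · have h' : ∑' n, ‖(hf n).toLp (f n)‖ₑ ≠ ∞ := by
      simpa [Lp.enorm_toLp] using h
    have h1 := Lp.coeFn_tsum h'
    have h2 : ∀ᵐ ω ∂P, ∀ n, (hf n).toLp (f n) ω = f n ω :=
      ae_all_iff.2 fun n => (hf n).coeFn_toLp
    refine (memLp_congr_ae ?_).1 (Lp.memLp (∑' n, (hf n).toLp (f n)))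
    filter_upwards [h1, h2] with ω h1 h2
    rw [h1]
    simp_rw [h2]

lemma tendsto_integral_sq_of_dominated {Ω : Type*} {mΩ : MeasurableSpace Ω} {P : Measure Ω}
    {X : ℕ → Ω → ℝ} {Y : Ω → ℝ} {S : Ω → ℝ} (hX : ∀ n, AEStronglyMeasurable (X n) P)
    (hS : MemLp S 2 P) (hb : ∀ n, ∀ᵐ ω ∂P, |X n ω| ≤ S ω)
    (hl : ∀ᵐ ω ∂P, Tendsto (fun n => X n ω) atTop (𝓝 (Y ω))) :
    Tendsto (fun n => ∫ ω, X n ω ^ 2 ∂P) atTop (𝓝 (∫ ω, Y ω ^ 2 ∂P)) := by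
  refine tendsto_integral_of_dominated_convergence (fun ω => S ω ^ 2)
    (fun n => (hX n).pow 2) hS.integrable_sq (fun n => ?_) ?_
  · filter_upwards [hb n] with ω h
    rw [Real.norm_eq_abs, abs_pow]
    exact pow_le_pow_left₀ (abs_nonneg _) h 2
  · filter_upwards [hl] with ω h using h.pow 2

/-- Along each continuous linear functional, dominated convergence with the square-integrable bound
`S` gives convergence of means, variances and characteristic functions. The Gaussian formula
therefore passes to the limit. -/
lemma hasGaussianLaw_of_tendsto {Ω : Type*} {mΩ : MeasurableSpace Ω} {P : Measure Ω}
    [IsProbabilityMeasure P] {E : Type*} [NormedAddCommGroup E] [NormedSpace ℝ E]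
    [MeasurableSpace E] [BorelSpace E] [SecondCountableTopology E] [CompleteSpace E]
    {X : ℕ → Ω → E} {Y : Ω → E} {S : Ω → ℝ} (hX : ∀ n, HasGaussianLaw (X n) P)
    (hY : AEMeasurable Y P) (hS : MemLp S 2 P) (hb : ∀ n, ∀ᵐ ω ∂P, ‖X n ω‖ ≤ S ω)
    (hl : ∀ᵐ ω ∂P, Tendsto (fun n => X n ω) atTop (𝓝 (Y ω))) :
    HasGaussianLaw Y P := by
  rw [hasGaussianLaw_iff_charFunDual_map_eq hY]
  intro L
  have hLm : ∀ n, AEStronglyMeasurable (fun ω => L (X n ω)) P := fun n =>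
    (L.continuous.measurable.comp_aemeasurable (hX n).aemeasurable).aestronglyMeasurable
  have hLY : AEMeasurable (fun ω => L (Y ω)) P :=
    L.continuous.measurable.comp_aemeasurable hY
  have hLl : ∀ᵐ ω ∂P, Tendsto (fun n => L (X n ω)) atTop (𝓝 (L (Y ω))) := by
    filter_upwards [hl] with ω h using (L.continuous.tendsto _).comp h
  have hSL : MemLp (fun ω => ‖L‖ * S ω) 2 P := hS.const_mul _
  have hLb : ∀ n, ∀ᵐ ω ∂P, |L (X n ω)| ≤ ‖L‖ * S ω := fun n => by
    filter_upwards [hb n] with ω h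
    exact (L.le_opNorm _).trans (mul_le_mul_of_nonneg_left h (norm_nonneg _))
  have hYb : ∀ᵐ ω ∂P, |L (Y ω)| ≤ ‖L‖ * S ω := by
    filter_upwards [ae_all_iff.2 hLb, hLl] with ω h1 h2
    exact le_of_tendsto h2.abs (Eventually.of_forall h1)
  have hmX : ∀ n, MemLp (fun ω => L (X n ω)) 2 P := fun n => ((hX n).map_fun L).memLp_two
  have hmY : MemLp (fun ω => L (Y ω)) 2 P :=
    hSL.mono hLY.aestronglyMeasurable (by
      filter_upwards [hYb] with ω h; exact h.trans (le_abs_self _))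
  have hmean : Tendsto (fun n => ∫ ω, L (X n ω) ∂P) atTop (𝓝 (∫ ω, L (Y ω) ∂P)) :=
    tendsto_integral_of_dominated_convergence _ hLm (hSL.integrable (by norm_num)) hLb hLl
  have hsq := tendsto_integral_sq_of_dominated hLm hSL hLb hLl
  have hvar : Tendsto (fun n => Var[fun ω => L (X n ω); P]) atTop
      (𝓝 (Var[fun ω => L (Y ω); P])) := by
    have e : ∀ n, Var[fun ω => L (X n ω); P] =
        (∫ ω, L (X n ω) ^ 2 ∂P) - (∫ ω, L (X n ω) ∂P) ^ 2 := fun n => by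
      rw [variance_eq_sub (hmX n)]; rfl
    have e' : Var[fun ω => L (Y ω); P] = (∫ ω, L (Y ω) ^ 2 ∂P) - (∫ ω, L (Y ω) ∂P) ^ 2 := by
      rw [variance_eq_sub hmY]; rfl
    rw [e']
    simp_rw [e]
    exact hsq.sub (hmean.pow 2)
  have hchar : Tendsto (fun n => charFunDual (P.map (X n)) L) atTop
      (𝓝 (charFunDual (P.map Y) L)) := by
    simp_rw [charFunDual_apply]
    rw [integral_map hY (by fun_prop)]
    have : ∀ n, ∫ v, Complex.exp (L v * Complex.I) ∂(P.map (X n)) =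
        ∫ ω, Complex.exp (L (X n ω) * Complex.I) ∂P := fun n =>
      integral_map (hX n).aemeasurable (by fun_prop)
    simp_rw [this]
    refine tendsto_integral_of_dominated_convergence (fun _ => 1) (fun n => ?_)
      (integrable_const _) (fun n => ?_) ?_
    · have := (hLm n).aemeasurable
      exact (by fun_prop : AEMeasurable (fun ω => Complex.exp (L (X n ω) * Complex.I)) P).aestronglyMeasurable
    · exact Eventually.of_forall fun ω => by
        rw [Complex.norm_exp_ofReal_mul_I]
    · filter_upwards [hLl] with ω h
      exact ((Complex.continuous_exp.comp (by fun_prop :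
        Continuous fun x : ℝ => (x : ℂ) * Complex.I)).tendsto _).comp h
  have e2 : ∀ n, charFunDual (P.map (X n)) L = Complex.exp ((∫ ω, L (X n ω) ∂P) * Complex.I
      - Var[fun ω => L (X n ω); P] / 2) := fun n => (hX n).charFunDual_map_eq_fun L
  simp_rw [e2] at hchar
  refine tendsto_nhds_unique hchar ?_
  have := (((Complex.continuous_ofReal.tendsto _).comp hmean).mul_const Complex.I).sub
    (((Complex.continuous_ofReal.tendsto _).comp hvar).div_const 2)
  exact (Complex.continuous_exp.tendsto _).comp this

/-! ### The Lévy–Ciesielski construction of Brownian motion -/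

/-- The space of Gaussian coefficients of a `d`-dimensional Brownian motion. -/
abbrev GaussianSeq (d : ℕ) : Type := Fin d × ℕ × ℕ → ℝ

/-- The law of a family of independent standard Gaussian coefficients. -/
def gaussianSeqMeasure (d : ℕ) : Measure (GaussianSeq d) :=
  Measure.infinitePi fun _ => gaussianReal 0 1

instance (d : ℕ) : IsProbabilityMeasure (gaussianSeqMeasure d) := by
  unfold gaussianSeqMeasure; infer_instance

variable {d : ℕ}

lemma hasLaw_gaussianSeq (κ : Fin d × ℕ × ℕ) :
    HasLaw (fun ω : GaussianSeq d => ω κ) (gaussianReal 0 1) (gaussianSeqMeasure d) :=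
  ⟨(measurable_pi_apply κ).aemeasurable, Measure.infinitePi_map_eval _ κ⟩

lemma iIndepFun_gaussianSeq :
    iIndepFun (fun κ (ω : GaussianSeq d) => ω κ) (gaussianSeqMeasure d) :=
  iIndepFun_infinitePi (P := fun _ : Fin d × ℕ × ℕ => gaussianReal 0 1)
    (X := fun _ x => x) (fun _ => measurable_id)

lemma isGaussianProcess_gaussianSeq :
    IsGaussianProcess (fun κ (ω : GaussianSeq d) => ω κ) (gaussianSeqMeasure d) where
  hasGaussianLaw J := (iIndepFun_gaussianSeq.restrict J).hasGaussianLaw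
    fun i => (hasLaw_gaussianSeq (i : Fin d × ℕ × ℕ)).hasGaussianLaw

lemma memLp_gaussianSeq (κ : Fin d × ℕ × ℕ) (p : ℝ≥0∞) (hp : p ≠ ∞) :
    MemLp (fun ω : GaussianSeq d => ω κ) p (gaussianSeqMeasure d) :=
  (hasLaw_gaussianSeq κ).hasGaussianLaw.memLp hp

lemma integral_gaussianSeq_mul (κ l : Fin d × ℕ × ℕ) :
    ∫ ω, ω κ * ω l ∂(gaussianSeqMeasure d) = if κ = l then 1 else 0 := by
  have hm : ∀ κ : Fin d × ℕ × ℕ, ∫ ω, ω κ ∂(gaussianSeqMeasure d) = 0 := fun κ => by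
    have := (hasLaw_gaussianSeq κ).integral_eq
    rw [this, integral_id_gaussianReal]
  split_ifs with h
  · subst h
    have h1 := (hasLaw_gaussianSeq κ).variance_eq
    rw [variance_id_gaussianReal, variance_eq_sub (memLp_gaussianSeq κ 2 (by norm_num)), hm] at h1
    simpa [sq] using h1
  · have := (iIndepFun_gaussianSeq.indepFun h).integral_mul_eq_mul_integral
      (memLp_gaussianSeq κ 1 (by norm_num)).1 (memLp_gaussianSeq l 1 (by norm_num)).1
    simp only [Pi.mul_apply] at this
    rw [this, hm, zero_mul]

/-- One level of the Schauder series. -/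
def brownianLevel (j : ℕ) (i : Fin d) (t : I) (ω : GaussianSeq d) : ℝ :=
  ∑ k ∈ Finset.range (2 ^ j), schauder j k t * ω (i, j, k)

/-- A partial sum of the Schauder series. -/
def brownianPartial (N : ℕ) (i : Fin d) (t : I) (ω : GaussianSeq d) : ℝ :=
  ∑ j ∈ Finset.range N, brownianLevel j i t ω

/-- A bound for one level of the Schauder series. -/
def brownianLevelBound (j : ℕ) (ω : GaussianSeq d) : ℝ :=
  √(1 / 2) ^ j * (∑ i : Fin d, ∑ k ∈ Finset.range (2 ^ j), |ω (i, j, k)| ^ 4) ^ (1 / 4 : ℝ)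

lemma brownianLevelBound_nonneg (j : ℕ) (ω : GaussianSeq d) : 0 ≤ brownianLevelBound j ω := by
  unfold brownianLevelBound; positivity

/-- The largest coefficient is bounded by the `ℓ⁴` norm of the level, uniformly in `t`. The exponent
matters: the `ℓ⁴` norm of `2^j` Gaussians grows like `2^{j/4}`, which the factor `2^{-j/2}` beats,
whereas the `ℓ²` norm would exactly cancel it. -/
lemma abs_brownianLevel_le (j : ℕ) (i : Fin d) (t : I) (ω : GaussianSeq d) :
    |brownianLevel j i t ω| ≤ brownianLevelBound j ω := by
  unfold brownianLevel brownianLevelBound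
  set G := (∑ i : Fin d, ∑ k ∈ Finset.range (2 ^ j), |ω (i, j, k)| ^ 4) ^ (1 / 4 : ℝ) with hG
  have hk : ∀ k ∈ Finset.range (2 ^ j), |ω (i, j, k)| ≤ G := by
    intro k hk
    have h1 : |ω (i, j, k)| ^ 4 ≤ ∑ i : Fin d, ∑ k ∈ Finset.range (2 ^ j), |ω (i, j, k)| ^ 4 :=
      (Finset.single_le_sum (f := fun k => |ω (i, j, k)| ^ 4) (fun _ _ => by positivity) hk).trans
        (Finset.single_le_sum (f := fun i => ∑ k ∈ Finset.range (2 ^ j), |ω (i, j, k)| ^ 4)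
          (fun _ _ => by positivity) (Finset.mem_univ i))
    have h2 := Real.rpow_le_rpow (by positivity) h1 (by norm_num : (0:ℝ) ≤ 1 / 4)
    rwa [← Real.rpow_natCast, ← Real.rpow_mul (abs_nonneg _), show ((4:ℕ):ℝ) * (1 / 4) = 1 by norm_num,
      Real.rpow_one] at h2
  calc _ ≤ ∑ k ∈ Finset.range (2 ^ j), |schauder j k t * ω (i, j, k)| :=
        Finset.abs_sum_le_sum_abs _ _
    _ ≤ ∑ k ∈ Finset.range (2 ^ j), schauder j k t * G := by
        refine Finset.sum_le_sum fun k h => ?_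
        rw [abs_mul, abs_of_nonneg (schauder_nonneg _ _ _)]
        exact mul_le_mul_of_nonneg_left (hk k h) (schauder_nonneg _ _ _)
    _ ≤ _ := by
        rw [← Finset.sum_mul]
        exact mul_le_mul_of_nonneg_right (sum_schauder_le j t) (by rw [hG]; positivity)

@[fun_prop]
lemma measurable_brownianLevel (j : ℕ) (i : Fin d) (t : I) : Measurable (brownianLevel j i t) := by
  unfold brownianLevel; fun_prop

@[fun_prop]
lemma measurable_brownianPartial (j : ℕ) (i : Fin d) (t : I) :
    Measurable (brownianPartial j i t) := by
  unfold brownianPartial; fun_prop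

@[fun_prop]
lemma measurable_brownianLevelBound (j : ℕ) :
    Measurable (brownianLevelBound j : GaussianSeq d → ℝ) := by
  unfold brownianLevelBound; fun_prop

lemma eLpNorm_brownianLevelBound (j : ℕ) :
    eLpNorm (brownianLevelBound j : GaussianSeq d → ℝ) 4 (gaussianSeqMeasure d) =
      (((1 / 2 : ℝ≥0∞) ^ (1 / 4 : ℝ)) ^ j) *
        (d * ∫⁻ x, ‖x‖ₑ ^ 4 ∂(gaussianReal 0 1)) ^ (1 / 4 : ℝ) := by
  rw [eLpNorm_eq_lintegral_rpow_enorm_toReal (by norm_num) (by norm_num)]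
  have h4 : ((4 : ℝ≥0∞).toReal) = ((4 : ℕ) : ℝ) := by norm_num
  rw [h4]
  simp_rw [ENNReal.rpow_natCast]
  have key : ∀ ω : GaussianSeq d, ‖brownianLevelBound j ω‖ₑ ^ 4 =
      (1 / 4 : ℝ≥0∞) ^ j * ∑ i : Fin d, ∑ k ∈ Finset.range (2 ^ j), ‖ω (i, j, k)‖ₑ ^ 4 := by
    intro ω
    have e1 : brownianLevelBound j ω ^ 4 =
        (1 / 4 : ℝ) ^ j * ∑ i : Fin d, ∑ k ∈ Finset.range (2 ^ j), |ω (i, j, k)| ^ 4 := by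
      unfold brownianLevelBound
      rw [mul_pow, ← Real.rpow_natCast (_ ^ (1 / 4 : ℝ)), ← Real.rpow_mul (by positivity),
        show (1 / 4 : ℝ) * (4 : ℕ) = 1 by norm_num, Real.rpow_one, ← pow_mul, mul_comm j 4, pow_mul,
        show √(1 / 2 : ℝ) ^ 4 = 1 / 4 by
          rw [show 4 = 2 * 2 by rfl, pow_mul, Real.sq_sqrt (by norm_num)]; norm_num]
    rw [← enorm_pow, e1, enorm_mul, enorm_pow, Real.enorm_of_nonneg (by norm_num : (0:ℝ) ≤ 1 / 4),
      Real.enorm_of_nonneg (by positivity)]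
    congr 1
    · congr 1
      rw [ENNReal.ofReal_div_of_pos (by norm_num)]; norm_num
    · rw [ENNReal.ofReal_sum_of_nonneg (fun _ _ => by positivity)]
      refine Finset.sum_congr rfl fun i _ => ?_
      rw [ENNReal.ofReal_sum_of_nonneg (fun _ _ => by positivity)]
      refine Finset.sum_congr rfl fun k _ => ?_
      rw [ENNReal.ofReal_pow (abs_nonneg _), ← Real.enorm_eq_ofReal_abs]
  simp_rw [key]
  rw [lintegral_const_mul _ (by fun_prop), lintegral_finsetSum _ (by fun_prop)]
  have e2 : ∀ κ : Fin d × ℕ × ℕ, ∫⁻ ω : GaussianSeq d, ‖ω κ‖ₑ ^ 4 ∂(gaussianSeqMeasure d) =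
      ∫⁻ x, ‖x‖ₑ ^ 4 ∂(gaussianReal 0 1) := fun κ =>
    (hasLaw_gaussianSeq κ).lintegral_comp (f := fun x => ‖x‖ₑ ^ 4) (by fun_prop)
  have e3 : ∀ i : Fin d, ∫⁻ ω : GaussianSeq d, ∑ k ∈ Finset.range (2 ^ j), ‖ω (i, j, k)‖ₑ ^ 4
      ∂(gaussianSeqMeasure d) = 2 ^ j * ∫⁻ x, ‖x‖ₑ ^ 4 ∂(gaussianReal 0 1) := fun i => by
    rw [lintegral_finsetSum _ (by fun_prop)]
    simp_rw [e2]
    simp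
  simp_rw [e3]
  rw [Finset.sum_const, Finset.card_univ, Fintype.card_fin, nsmul_eq_mul]
  rw [show (1 / 4 : ℝ≥0∞) ^ j * (d * (2 ^ j * ∫⁻ x, ‖x‖ₑ ^ 4 ∂(gaussianReal 0 1))) =
    ((1 / 4) ^ j * 2 ^ j) * (d * ∫⁻ x, ‖x‖ₑ ^ 4 ∂(gaussianReal 0 1)) by ring, ← mul_pow,
    ENNReal.mul_rpow_of_nonneg _ _ (by norm_num)]
  -- The fourth moment of a level decays like `4^{-j} 2^j = 2^{-j}`, so the `L⁴` norms form a
  -- geometric series of ratio `2^{-1/4}`.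
  have e4 : (1 / 4 : ℝ≥0∞) * 2 = 1 / 2 := by
    rw [← ENNReal.toReal_eq_toReal_iff' (by finiteness) (by finiteness)]
    simp [ENNReal.toReal_mul]; norm_num
  rw [e4]
  congr 1
  · rw [← ENNReal.rpow_natCast, ← ENNReal.rpow_natCast, ← ENNReal.rpow_mul, ← ENNReal.rpow_mul]
    push_cast
    ring_nf

lemma lintegral_enorm_pow_four_gaussianReal_ne_top :
    ∫⁻ x, ‖x‖ₑ ^ 4 ∂(gaussianReal 0 1) ≠ ∞ := by
  have := (memLp_id_gaussianReal' (μ := 0) (v := 1) 4 (by norm_num)).eLpNorm_ne_top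
  rw [eLpNorm_eq_lintegral_rpow_enorm_toReal (by norm_num) (by norm_num),
    show ((4 : ℝ≥0∞).toReal) = ((4 : ℕ) : ℝ) by norm_num] at this
  simp_rw [ENNReal.rpow_natCast] at this
  intro h
  simp only [id_eq, h] at this
  norm_num at this

lemma brownianLevelBound_summable_memLp :
    (∀ᵐ ω ∂(gaussianSeqMeasure d), Summable fun j => brownianLevelBound j ω) ∧
      MemLp (fun ω => ∑' j, brownianLevelBound j ω) 4 (gaussianSeqMeasure d) := by
  have : Fact ((1 : ℝ≥0∞) ≤ 4) := ⟨by norm_num⟩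
  have hfin : (d * ∫⁻ x, ‖x‖ₑ ^ 4 ∂(gaussianReal 0 1)) ^ (1 / 4 : ℝ) ≠ ∞ :=
    ENNReal.rpow_ne_top_of_nonneg (by norm_num)
      (ENNReal.mul_ne_top (by simp) lintegral_enorm_pow_four_gaussianReal_ne_top)
  have hlt : (1 / 2 : ℝ≥0∞) ^ (1 / 4 : ℝ) < 1 :=
    ENNReal.rpow_lt_one (by rw [one_div]; exact ENNReal.inv_lt_one.2 (by norm_num)) (by norm_num)
  refine ae_summable_and_memLp_tsum (fun n => ⟨(by fun_prop : Measurable _).aestronglyMeasurable, ?_⟩) ?_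
  · rw [eLpNorm_brownianLevelBound]
    exact (ENNReal.mul_lt_top (ENNReal.pow_lt_top (hlt.trans_le le_top)) hfin.lt_top)
  · simp_rw [eLpNorm_brownianLevelBound]
    rw [ENNReal.tsum_mul_right, ENNReal.tsum_geometric]
    refine ENNReal.mul_ne_top ?_ hfin
    rw [ENNReal.inv_ne_top]
    exact (tsub_pos_of_lt hlt).ne'

open Classical in
/-- Brownian motion on `[0,1]`, as the sum of its Schauder series. -/
def brownian (i : Fin d) (t : I) (ω : GaussianSeq d) : ℝ :=
  if Summable (fun j => brownianLevelBound j ω) then ∑' j, brownianLevel j i t ω else 0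

/-- A bound for the paths of Brownian motion. -/
def brownianBound (ω : GaussianSeq d) : ℝ := ∑' j, brownianLevelBound j ω

lemma memLp_brownianBound : MemLp (brownianBound : GaussianSeq d → ℝ) 2 (gaussianSeqMeasure d) :=
  brownianLevelBound_summable_memLp.2.mono_exponent (by norm_num)

lemma summable_brownianLevel {ω : GaussianSeq d} (h : Summable fun j => brownianLevelBound j ω)
    (i : Fin d) (t : I) : Summable fun j => brownianLevel j i t ω :=
  Summable.of_norm_bounded h fun j => abs_brownianLevel_le j i t ω

lemma abs_brownian_le (i : Fin d) (t : I) (ω : GaussianSeq d) :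
    |brownian i t ω| ≤ brownianBound ω := by
  unfold brownian brownianBound
  split_ifs with h
  · exact tsum_of_norm_bounded (f := fun j => brownianLevel j i t ω) h.hasSum
      fun j => abs_brownianLevel_le j i t ω
  · simp only [abs_zero]
    exact tsum_nonneg fun j => brownianLevelBound_nonneg j ω

/-- The Weierstrass test applies where the level bounds are summable. Elsewhere the path is set to
zero, so continuity holds for every outcome and the later pathwise stopping arguments need no
exceptional set. -/
lemma continuous_brownian (i : Fin d) (ω : GaussianSeq d) : Continuous fun t => brownian i t ω := by
  unfold brownian
  split_ifs with h
  · refine continuous_tsum (fun j => ?_) h fun j t => abs_brownianLevel_le j i t ω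
    unfold brownianLevel
    fun_prop
  · exact continuous_const

lemma measurableSet_summable_brownianLevelBound :
    MeasurableSet {ω : GaussianSeq d | Summable fun j => brownianLevelBound j ω} := by
  have : {ω : GaussianSeq d | Summable fun j => brownianLevelBound j ω} =
      {ω | ∑' j, ENNReal.ofReal (brownianLevelBound j ω) < ∞} := by
    ext ω
    rw [Set.mem_ofPred_eq, Set.mem_ofPred_eq, lt_top_iff_ne_top]
    refine ⟨fun h => h.tsum_ofReal_ne_top, fun h => ?_⟩
    have := ENNReal.summable_toReal h
    simpa [ENNReal.toReal_ofReal (brownianLevelBound_nonneg _ ω)] using this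
  rw [this]
  exact measurableSet_lt (Measurable.tsum fun j => by fun_prop) measurable_const

@[fun_prop]
lemma measurable_brownian (i : Fin d) (t : I) : Measurable (brownian i t) := by
  unfold brownian
  refine Measurable.ite measurableSet_summable_brownianLevelBound ?_ measurable_const
  exact Measurable.tsum fun j => by fun_prop

lemma tendsto_brownianPartial (i : Fin d) (t : I) :
    ∀ᵐ ω ∂(gaussianSeqMeasure d),
      Tendsto (fun N => brownianPartial N i t ω) atTop (𝓝 (brownian i t ω)) := by
  filter_upwards [brownianLevelBound_summable_memLp.1] with ω h
  unfold brownian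
  rw [if_pos h]
  exact (summable_brownianLevel h i t).hasSum.tendsto_sum_nat

lemma abs_brownianPartial_le (N : ℕ) (i : Fin d) (t : I) :
    ∀ᵐ ω ∂(gaussianSeqMeasure d), |brownianPartial N i t ω| ≤ brownianBound ω := by
  filter_upwards [brownianLevelBound_summable_memLp.1] with ω h
  calc _ ≤ ∑ j ∈ Finset.range N, |brownianLevel j i t ω| := Finset.abs_sum_le_sum_abs _ _
    _ ≤ ∑ j ∈ Finset.range N, brownianLevelBound j ω :=
      Finset.sum_le_sum fun j _ => abs_brownianLevel_le j i t ω
    _ ≤ _ := h.sum_le_tsum _ fun j _ => brownianLevelBound_nonneg j ω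

lemma isGaussianProcess_brownianPartial (N : ℕ) :
    IsGaussianProcess (fun (p : Fin d × I) => brownianPartial N p.1 p.2) (gaussianSeqMeasure d) := by
  classical
  refine isGaussianProcess_gaussianSeq.of_isGaussianProcess fun p => ?_
  -- Level `j < N` uses the coefficients `k < 2^j`, all contained in this rectangle; a partial sum
  -- is therefore linear in finitely many Gaussian coordinates.
  let J : Finset (Fin d × ℕ × ℕ) :=
    Finset.univ ×ˢ Finset.range N ×ˢ Finset.range (2 ^ N)
  refine ⟨J, ∑ j ∈ Finset.range N, ∑ k ∈ Finset.range (2 ^ j), schauder j k p.2 •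
    (if h : (p.1, j, k) ∈ J then ContinuousLinearMap.proj ⟨(p.1, j, k), h⟩ else 0), fun ω => ?_⟩
  simp only [sum_apply, smul_apply, brownianPartial,
    brownianLevel, smul_eq_mul]
  refine Finset.sum_congr rfl fun j hj => Finset.sum_congr rfl fun k hk => ?_
  have hmem : (p.1, j, k) ∈ J := by
    simp only [J, Finset.mem_product, Finset.mem_univ, true_and]
    refine ⟨hj, Finset.mem_range.2 ((Finset.mem_range.1 hk).trans_le ?_)⟩
    exact Nat.pow_le_pow_right (by norm_num) (Finset.mem_range.1 hj).le
  rw [dif_pos hmem]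
  rfl

lemma isGaussianProcess_brownian :
    IsGaussianProcess (fun (p : Fin d × I) => brownian p.1 p.2) (gaussianSeqMeasure d) where
  hasGaussianLaw J := by
    refine hasGaussianLaw_of_tendsto (fun N => (isGaussianProcess_brownianPartial N).hasGaussianLaw J)
      ?_ memLp_brownianBound (fun N => ?_) ?_
    · exact (measurable_pi_lambda _ fun p => by
        simp only [Finset.restrict]; fun_prop).aemeasurable
    · have := ae_all_iff.2 fun p : J => abs_brownianPartial_le N p.1.1 p.1.2
      filter_upwards [this] with ω h
      refine (pi_norm_le_iff_of_nonneg ?_).2 h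
      exact tsum_nonneg fun j => brownianLevelBound_nonneg j ω
    · have := ae_all_iff.2 fun p : J => tendsto_brownianPartial p.1.1 p.1.2
      filter_upwards [this] with ω h
      exact tendsto_pi_nhds.2 h

/-- The coefficients are orthonormal in `L²`, so only the diagonal of the double series survives. -/
lemma integral_brownianPartial_mul (N : ℕ) (i i' : Fin d) (s t : I) :
    ∫ ω, brownianPartial N i s ω * brownianPartial N i' t ω ∂(gaussianSeqMeasure d) =
      if i = i' then ∑ j ∈ Finset.range N, ∑ k ∈ Finset.range (2 ^ j),
        schauder j k s * schauder j k t else 0 := by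
  have hint : ∀ κ l : Fin d × ℕ × ℕ, Integrable (fun ω : GaussianSeq d => ω κ * ω l)
      (gaussianSeqMeasure d) := fun κ l =>
    (memLp_gaussianSeq κ 2 (by norm_num)).integrable_mul (memLp_gaussianSeq l 2 (by norm_num))
  have e : ∀ ω : GaussianSeq d, brownianPartial N i s ω * brownianPartial N i' t ω =
      ∑ j ∈ Finset.range N, ∑ k ∈ Finset.range (2 ^ j), ∑ j' ∈ Finset.range N,
        ∑ k' ∈ Finset.range (2 ^ j'), schauder j k s * schauder j' k' t *
          (ω (i, j, k) * ω (i', j', k')) := by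
    intro ω
    unfold brownianPartial brownianLevel
    simp_rw [Finset.sum_mul, Finset.mul_sum]
    refine Finset.sum_congr rfl fun j _ => Finset.sum_congr rfl fun k _ =>
      Finset.sum_congr rfl fun j' _ => Finset.sum_congr rfl fun k' _ => by ring
  simp_rw [e]
  have i1 : ∀ j k j' k', Integrable (fun ω : GaussianSeq d =>
      schauder j k s * schauder j' k' t * (ω (i, j, k) * ω (i', j', k'))) (gaussianSeqMeasure d) :=
    fun j k j' k' => (hint _ _).const_mul _
  rw [integral_finsetSum _ fun j _ => integrable_finsetSum _ fun k _ =>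
    integrable_finsetSum _ fun j' _ => integrable_finsetSum _ fun k' _ => i1 j k j' k']
  have : ∀ j ∈ Finset.range N, ∫ ω, ∑ k ∈ Finset.range (2 ^ j), ∑ j' ∈ Finset.range N,
        ∑ k' ∈ Finset.range (2 ^ j'), schauder j k s * schauder j' k' t *
          (ω (i, j, k) * ω (i', j', k')) ∂(gaussianSeqMeasure d) =
      ∑ k ∈ Finset.range (2 ^ j), if i = i' then schauder j k s * schauder j k t else 0 := by
    intro j hj
    rw [integral_finsetSum _ fun k _ =>
      integrable_finsetSum _ fun j' _ => integrable_finsetSum _ fun k' _ => i1 j k j' k']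
    refine Finset.sum_congr rfl fun k hk => ?_
    rw [integral_finsetSum _ fun j' _ => integrable_finsetSum _ fun k' _ => i1 j k j' k']
    rw [Finset.sum_eq_single j]
    · rw [integral_finsetSum _ fun k' _ => i1 j k j k', Finset.sum_eq_single k]
      · rw [integral_const_mul, integral_gaussianSeq_mul]
        by_cases h : i = i' <;> simp [h]
      · intro k' _ hk'
        rw [integral_const_mul, integral_gaussianSeq_mul, if_neg, mul_zero]
        simp only [Prod.mk.injEq, not_and]; intro _ _; exact hk'.symm
      · intro h; exact absurd hk h
    · intro j' _ hj'
      rw [integral_finsetSum _ fun k' _ => i1 j k j' k']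
      refine Finset.sum_eq_zero fun k' _ => ?_
      rw [integral_const_mul, integral_gaussianSeq_mul, if_neg, mul_zero]
      simp only [Prod.mk.injEq, not_and]; intro _ h; exact absurd h.symm hj'
    · intro h; exact absurd hj h
  rw [Finset.sum_congr rfl this]
  by_cases h : i = i' <;> simp [h]

lemma integral_brownian_mul (i i' : Fin d) (s t : I) :
    ∫ ω, brownian i s ω * brownian i' t ω ∂(gaussianSeqMeasure d) =
      if i = i' then (min s t : ℝ) else 0 := by
  have h1 : Tendsto (fun N => ∫ ω, brownianPartial N i s ω * brownianPartial N i' t ω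
      ∂(gaussianSeqMeasure d)) atTop
      (𝓝 (∫ ω, brownian i s ω * brownian i' t ω ∂(gaussianSeqMeasure d))) := by
    refine tendsto_integral_of_dominated_convergence (fun ω => brownianBound ω ^ 2)
      (fun N => (by fun_prop : Measurable _).aestronglyMeasurable) memLp_brownianBound.integrable_sq
      (fun N => ?_) ?_
    · filter_upwards [abs_brownianPartial_le N i s, abs_brownianPartial_le N i' t] with ω h1 h2
      rw [Real.norm_eq_abs, abs_mul, sq]
      exact mul_le_mul h1 h2 (abs_nonneg _) ((abs_nonneg _).trans h1)
    · filter_upwards [tendsto_brownianPartial i s, tendsto_brownianPartial i' t] with ω h1 h2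
      exact h1.mul h2
  refine tendsto_nhds_unique h1 ?_
  simp_rw [integral_brownianPartial_mul]
  split_ifs
  · exact tendsto_sum_schauder s t
  · exact tendsto_const_nhds

lemma integral_brownian (i : Fin d) (t : I) :
    ∫ ω, brownian i t ω ∂(gaussianSeqMeasure d) = 0 := by
  have h1 : Tendsto (fun N => ∫ ω, brownianPartial N i t ω
      ∂(gaussianSeqMeasure d)) atTop (𝓝 (∫ ω, brownian i t ω ∂(gaussianSeqMeasure d))) :=
    tendsto_integral_of_dominated_convergence brownianBound
      (fun N => (by fun_prop : Measurable _).aestronglyMeasurable)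
      (memLp_brownianBound.integrable (by norm_num)) (fun N => abs_brownianPartial_le N i t)
      (tendsto_brownianPartial i t)
  refine tendsto_nhds_unique h1 ?_
  have : ∀ N, ∫ ω, brownianPartial N i t ω ∂(gaussianSeqMeasure d) = 0 := by
    intro N
    have hi : ∀ κ : Fin d × ℕ × ℕ, Integrable (fun ω : GaussianSeq d => ω κ)
      (gaussianSeqMeasure d) := fun κ => (memLp_gaussianSeq κ 1 (by norm_num)).integrable le_rfl
    unfold brownianPartial brownianLevel
    rw [integral_finsetSum _ fun j _ => integrable_finsetSum _ fun k _ => (hi _).const_mul _]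
    refine Finset.sum_eq_zero fun j _ => ?_
    rw [integral_finsetSum _ fun k _ => (hi _).const_mul _]
    refine Finset.sum_eq_zero fun k _ => ?_
    rw [integral_const_mul, (hasLaw_gaussianSeq _).integral_eq, integral_id_gaussianReal, mul_zero]
  simp_rw [this]
  exact tendsto_const_nhds

lemma memLp_brownian (i : Fin d) (t : I) : MemLp (brownian i t) 2 (gaussianSeqMeasure d) :=
  memLp_brownianBound.mono (by fun_prop : Measurable _).aestronglyMeasurable
    (Eventually.of_forall fun ω => (abs_brownian_le i t ω).trans (le_abs_self _))

lemma covariance_brownian (i i' : Fin d) (s t : I) :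
    cov[brownian i s, brownian i' t; gaussianSeqMeasure d] =
      if i = i' then (min s t : ℝ) else 0 := by
  rw [covariance_eq_sub (memLp_brownian i s) (memLp_brownian i' t), integral_brownian, zero_mul,
    sub_zero, ← integral_brownian_mul]
  rfl

end

section

/-! ### Standard Brownian motion with its natural filtration -/

variable {d : ℕ}

/-- The `ℝ^d`-valued Brownian motion. -/
def brownianVec (t : I) (ω : GaussianSeq d) : EuclideanSpace ℝ (Fin d) :=
  WithLp.toLp 2 fun i => brownian i t ω

/-- The filtration generated by Brownian motion. -/
def brownianFiltration (d : ℕ) :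
    Filtration I (inferInstance : MeasurableSpace (GaussianSeq d)) where
  seq t := MeasurableSpace.comap
    (fun ω (p : Fin d × Set.Iic t) => brownian p.1 (p.2 : I) ω) inferInstance
  mono' s t hst := by
    have : (fun (ω : GaussianSeq d) (p : Fin d × Set.Iic s) => brownian p.1 (p.2 : I) ω) =
        (fun (x : Fin d × Set.Iic t → ℝ) (p : Fin d × Set.Iic s) =>
          x (p.1, ⟨p.2, (Set.mem_Iic.1 p.2.2).trans hst⟩)) ∘
        (fun (ω : GaussianSeq d) (p : Fin d × Set.Iic t) => brownian p.1 (p.2 : I) ω) := rfl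
    simp only
    rw [this, ← MeasurableSpace.comap_comp]
    exact MeasurableSpace.comap_mono
      (measurable_pi_lambda _ fun p => measurable_pi_apply _).comap_le
  le' t := (measurable_pi_lambda _ fun p => measurable_brownian _ _).comap_le

lemma measurable_brownian_filtration (i : Fin d) (t : I) :
    Measurable[brownianFiltration d t] (brownian i t) := by
  have hg : Measurable (fun x : Fin d × Set.Iic t → ℝ => x (i, ⟨t, Set.mem_Iic.2 le_rfl⟩)) :=
    measurable_pi_apply _
  have h : @Measurable _ _ (brownianFiltration d t) _
      (fun (ω : GaussianSeq d) (p : Fin d × Set.Iic t) => brownian p.1 (p.2 : I) ω) :=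
    Measurable.of_comap_le le_rfl
  exact @Measurable.comp _ _ _ (brownianFiltration d t) _ _ _ _ hg h

lemma covariance_brownian_sub (i i' : Fin d) {s t : I} (hst : s ≤ t) :
    cov[brownian i t - brownian i s, brownian i' t - brownian i' s; gaussianSeqMeasure d] =
      if i = i' then (t : ℝ) - s else 0 := by
  have hst' : (s : ℝ) ≤ t := hst
  rw [covariance_sub_left (memLp_brownian _ _) (memLp_brownian _ _)
    ((memLp_brownian _ _).sub (memLp_brownian _ _)),
    covariance_sub_right (memLp_brownian _ _) (memLp_brownian _ _) (memLp_brownian _ _),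
    covariance_sub_right (memLp_brownian _ _) (memLp_brownian _ _) (memLp_brownian _ _)]
  simp_rw [covariance_brownian]
  split_ifs
  · rw [min_self, min_self, min_eq_right hst', min_eq_left hst']; ring
  · ring

/-- Joint Gaussianity of the increment and the past turns vanishing covariances into independence,
both between the coordinates of the increment and between the increment and the past. -/
lemma isGaussianProcess_brownian_increment (s t : I) :
    IsGaussianProcess (Sum.elim (fun i : Fin d => brownian i t - brownian i s)
      (fun p : Fin d × Set.Iic s => brownian p.1 (p.2 : I))) (gaussianSeqMeasure d) := by
  classical
  refine isGaussianProcess_brownian.of_isGaussianProcess ?_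
  rintro (i | ⟨i, r, hr⟩)
  · exact ⟨{(i, t), (i, s)},
      { toFun x := x ⟨(i, t), by simp⟩ - x ⟨(i, s), by simp⟩
        map_add' x y := by simp; abel
        map_smul' c x := by simp; ring }, by simp⟩
  · exact ⟨{(i, r)},
      { toFun x := x ⟨(i, r), by simp⟩
        map_add' x y := by simp
        map_smul' c x := by simp }, by simp⟩

lemma map_brownian_sub {s t : I} (hst : s ≤ t) :
    (gaussianSeqMeasure d).map (fun ω (i : Fin d) => brownian i t ω - brownian i s ω) =
      Measure.pi fun _ : Fin d => gaussianReal 0 (Real.toNNReal ((t : ℝ) - s)) := by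
  classical
  have hg : HasGaussianLaw (fun ω (i : Fin d) => (brownian i t - brownian i s) ω)
      (gaussianSeqMeasure d) := by
    have h := (isGaussianProcess_brownian_increment (d := d) s t).comp_right Sum.inl
    have h2 := h.hasGaussianLaw Finset.univ
    exact h2.map_fun (ContinuousLinearMap.pi fun i : Fin d =>
      ContinuousLinearMap.proj (R := ℝ) (φ := fun _ : (Finset.univ : Finset (Fin d)) => ℝ)
        (⟨i, Finset.mem_univ i⟩ : (Finset.univ : Finset (Fin d))))
  have hi : iIndepFun (fun (i : Fin d) => brownian i t - brownian i s) (gaussianSeqMeasure d) := by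
    refine hg.iIndepFun_of_covariance_eq_zero fun i j hij => ?_
    rw [covariance_brownian_sub _ _ hst, if_neg hij]
  have hm := (iIndepFun_iff_map_fun_eq_pi_map
    (fun i => ((measurable_brownian i t).sub (measurable_brownian i s)).aemeasurable)).1 hi
  have hmarg : ∀ i : Fin d, (gaussianSeqMeasure d).map (brownian i t - brownian i s) =
      gaussianReal 0 (Real.toNNReal ((t : ℝ) - s)) := by
    intro i
    have h1 : HasGaussianLaw (brownian i t - brownian i s) (gaussianSeqMeasure d) :=
      (isGaussianProcess_brownian_increment s t).hasGaussianLaw_eval (Sum.inl i)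
    rw [h1.map_eq_gaussianReal, ← covariance_self h1.aemeasurable, covariance_brownian_sub _ _ hst,
      if_pos rfl]
    congr 1
    simp only [Pi.sub_apply]
    rw [integral_sub ((memLp_brownian i t).integrable (by norm_num))
      ((memLp_brownian i s).integrable (by norm_num)), integral_brownian, integral_brownian, sub_zero]
  simp_rw [hmarg] at hm
  exact hm

/-- For `r ≤ s ≤ t` the covariance of the increment with the value at time `r` is `min r t - min r s
= 0`. -/
lemma indepFun_brownian_sub {s t : I} (hst : s ≤ t) :
    IndepFun (fun ω (i : Fin d) => (brownian i t - brownian i s) ω)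
      (fun ω (p : Fin d × Set.Iic s) => brownian p.1 (p.2 : I) ω) (gaussianSeqMeasure d) := by
  refine (isGaussianProcess_brownian_increment s t).indepFun_of_covariance_eq_zero
    (fun i => ((measurable_brownian i t).sub (measurable_brownian i s)).aemeasurable)
    (fun p => (measurable_brownian _ _).aemeasurable) ?_
  rintro i ⟨j, r, hr⟩
  have hr' : (r : ℝ) ≤ s := hr
  have hst' : (s : ℝ) ≤ t := hst
  rw [covariance_sub_left (memLp_brownian _ _) (memLp_brownian _ _) (memLp_brownian _ _)]
  simp_rw [covariance_brownian]
  rw [min_eq_right hr', min_eq_right (hr'.trans hst'), sub_self]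

theorem isBrownianMotion_brownianVec :
    IsBrownianMotion (gaussianSeqMeasure d) (brownianFiltration d) brownianVec where
  adapted t := by
    have h : Measurable[brownianFiltration d t] (brownianVec (d := d) t) :=
      (WithLp.measurable_toLp 2 _).comp
        (@measurable_pi_lambda _ _ _ (brownianFiltration d t) _ _
          fun i => measurable_brownian_filtration i t)
    exact h.stronglyMeasurable
  start := by
    have h : ∀ i : Fin d, ∀ᵐ ω ∂(gaussianSeqMeasure d), brownian i 0 ω = 0 := fun i => by
      -- The second moment at time `0` is zero, which forces the value to vanish almost surely.
      have h0 := integral_brownian_mul i i 0 0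
      rw [if_pos rfl] at h0
      simp only [Set.Icc.coe_zero, min_self] at h0
      rw [integral_eq_zero_iff_of_nonneg (fun ω => mul_self_nonneg _)
        ((memLp_brownian i 0).integrable_mul (memLp_brownian i 0))] at h0
      filter_upwards [h0] with ω hω
      simpa using hω
    filter_upwards [ae_all_iff.2 h] with ω hω
    ext i
    exact hω i
  continuous_paths := Eventually.of_forall fun ω =>
    (PiLp.continuous_toLp 2 _).comp (continuous_pi fun i => continuous_brownian i ω)
  increment_law s t hst := map_brownian_sub hst
  increment_indep s t hst := by
    have h := indepFun_brownian_sub (d := d) hst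
    rw [IndepFun_iff_Indep] at h
    refine indep_of_indep_of_le_left h ?_
    have : (fun ω => brownianVec t ω - brownianVec s ω) =
        (WithLp.toLp 2) ∘ (fun ω (i : Fin d) => (brownian i t - brownian i s) ω) := rfl
    rw [this, ← MeasurableSpace.comap_comp]
    exact MeasurableSpace.comap_mono (WithLp.measurable_toLp 2 _).comap_le

end

section

/-! ### Poisson point configurations of unit mass -/

section PointConfiguration

variable {S : Type*} [MeasurableSpace S]

/-- The sum of a function over the points of a finite configuration. -/
def pointSum {V : Type*} [AddCommMonoid V] (g : S → V) (x : ℕ × (ℕ → S)) : V :=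
  ∑ p ∈ Finset.range x.1, g (x.2 p)

/-- The counting measure of a finite configuration. -/
def pointMeasure (x : ℕ × (ℕ → S)) : Measure S :=
  ∑ p ∈ Finset.range x.1, Measure.dirac (x.2 p)

/-- The law of a Poisson configuration with intensity a probability measure. -/
def pointLaw (m : Measure S) : Measure (ℕ × (ℕ → S)) :=
  (poissonMeasure 1).prod (Measure.infinitePi fun _ => m)

instance (m : Measure S) [IsProbabilityMeasure m] : IsProbabilityMeasure (pointLaw m) := by
  unfold pointLaw; infer_instance

lemma measurable_pointSum {V : Type*} [AddCommMonoid V] [MeasurableSpace V] [MeasurableAdd₂ V]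
    {g : S → V} (hg : Measurable g) : Measurable (pointSum g) := by
  refine measurable_from_prod_countable_right fun n => ?_
  simp only [pointSum]
  exact Finset.measurable_fun_sum _ fun p _ => hg.comp (measurable_pi_apply p)

lemma pointMeasure_apply (x : ℕ × (ℕ → S)) {A : Set S} (hA : MeasurableSet A) :
    pointMeasure x A = ENNReal.ofReal (pointSum (A.indicator 1) x) := by
  unfold pointMeasure pointSum
  rw [Measure.finsetSum_apply, ENNReal.ofReal_sum_of_nonneg
    (fun p _ => Set.indicator_nonneg (f := (1 : S → ℝ)) (fun _ _ => zero_le_one) (x.2 p))]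
  refine Finset.sum_congr rfl fun p _ => ?_
  rw [Measure.dirac_apply' _ hA]
  by_cases h : x.2 p ∈ A <;> simp [h]

lemma measurable_pointMeasure : Measurable (pointMeasure : ℕ × (ℕ → S) → Measure S) := by
  refine Measure.measurable_of_measurable_coe _ fun A hA => ?_
  simp_rw [pointMeasure_apply _ hA]
  exact (measurable_pointSum (measurable_one.indicator hA)).ennreal_ofReal

/-- Given the number of points, these are independent with law `m`, so the conditional mean is a
power of `z = ∫ g dm`; the generating function of a Poisson variable of mean one is `exp (z - 1)`.
-/
lemma integral_prod_pointLaw (m : Measure S) [IsProbabilityMeasure m] {g : S → ℂ}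
    (hg : Measurable g) (hb : ∀ u, ‖g u‖ ≤ 1) :
    ∫ x, ∏ p ∈ Finset.range x.1, g (x.2 p) ∂(pointLaw m) = Complex.exp (∫ u, g u ∂m - 1) := by
  have hmeas : Measurable fun x : ℕ × (ℕ → S) => ∏ p ∈ Finset.range x.1, g (x.2 p) := by
    refine measurable_from_prod_countable_right fun n => ?_
    simp only
    exact Finset.measurable_fun_prod _ fun p _ => hg.comp (measurable_pi_apply p)
  have hint : Integrable (fun x : ℕ × (ℕ → S) => ∏ p ∈ Finset.range x.1, g (x.2 p))
      ((poissonMeasure 1).prod (Measure.infinitePi fun _ => m)) := by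
    refine Integrable.of_bound hmeas.aestronglyMeasurable 1 (Eventually.of_forall fun x => ?_)
    rw [norm_prod]
    exact Finset.prod_le_one (fun _ _ => norm_nonneg _) fun _ _ => hb _
  rw [pointLaw, integral_prod _ hint]
  have hin : ∀ n : ℕ, ∫ y : ℕ → S, ∏ p ∈ Finset.range n, g (y p)
      ∂(Measure.infinitePi fun _ => m) = (∫ u, g u ∂m) ^ n := by
    intro n
    have h1 := integral_restrict_infinitePi (μ := fun _ : ℕ => m) (s := Finset.range n)
      (f := fun y : (Finset.range n) → S => ∏ p, g (y p))
      (Finset.measurable_fun_prod _ fun p _ => hg.comp (measurable_pi_apply p)).aestronglyMeasurable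
    have h2 : ∀ y : ℕ → S, ∏ p : (Finset.range n), g ((Finset.range n).restrict y p) =
        ∏ p ∈ Finset.range n, g (y p) := fun y =>
      Finset.prod_coe_sort (Finset.range n) fun p => g (y p)
    simp_rw [h2] at h1
    rw [h1, integral_fintype_prod_eq_pow]
    simp
  simp_rw [hin]
  rw [integral_poissonMeasure]
  have : ∀ n : ℕ, (Real.exp (-((1 : ℝ≥0) : ℝ)) * ((1 : ℝ≥0) : ℝ) ^ n / (n.factorial : ℝ)) •
      (∫ u, g u ∂m) ^ n = Complex.exp (-1) * ((∫ u, g u ∂m) ^ n / n.factorial) := by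
    intro n
    rw [Complex.real_smul]
    push_cast
    ring
  simp_rw [this]
  rw [tsum_mul_left, (NormedSpace.expSeries_div_hasSum_exp (∫ u, g u ∂m)).tsum_eq,
    ← Complex.exp_eq_exp_ℂ, ← Complex.exp_add]
  congr 1; ring

lemma charFunDual_pointSum (m : Measure S) [IsProbabilityMeasure m] {V : Type*}
    [NormedAddCommGroup V] [NormedSpace ℝ V] [MeasurableSpace V] [BorelSpace V]
    [SecondCountableTopology V] {h : S → V} (hh : Measurable h) (L : StrongDual ℝ V) :
    charFunDual ((pointLaw m).map (pointSum h)) L =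
      Complex.exp (∫ u, (Complex.exp (L (h u) * Complex.I) - 1) ∂m) := by
  have hLm : Measurable fun u => L (h u) := L.continuous.measurable.comp hh
  have hm : Measurable fun u => Complex.exp (L (h u) * Complex.I) := by fun_prop
  rw [charFunDual_apply, integral_map (measurable_pointSum hh).aemeasurable (by fun_prop)]
  have : ∀ x : ℕ × (ℕ → S), Complex.exp (L (pointSum h x) * Complex.I) =
      ∏ p ∈ Finset.range x.1, Complex.exp (L (h (x.2 p)) * Complex.I) := by
    intro x
    rw [← Complex.exp_sum, pointSum, map_sum, ← Finset.sum_mul]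
    push_cast; rfl
  simp_rw [this]
  rw [integral_prod_pointLaw m hm fun u => by rw [Complex.norm_exp_ofReal_mul_I]]
  rw [integral_sub (Integrable.of_bound hm.aestronglyMeasurable 1
    (Eventually.of_forall fun u => by rw [Complex.norm_exp_ofReal_mul_I])) (integrable_const _)]
  simp

/-- In Campbell's formula the exponent is an integral over `S`. At each point at most one of the
disjoint sets `A i` is active, so the integrand is the sum of the integrands for the single `i`, and
the joint characteristic function factorises. The auxiliary sets `B i j` supply the
finite-dimensional marginals of the configuration restricted to `A i`. -/
lemma iIndepFun_pointSum_indicator (m : Measure S) [IsProbabilityMeasure m] {ι : Type*} [Fintype ι]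
    {J : ι → Type*} [∀ i, Fintype (J i)] {A : ι → Set S} (hA : ∀ i, MeasurableSet (A i))
    (hd : Pairwise fun i j => Disjoint (A i) (A j)) {B : ∀ i, J i → Set S}
    (hB : ∀ i j, MeasurableSet (B i j)) :
    iIndepFun (fun i x (j : J i) => pointSum ((A i ∩ B i j).indicator (1 : S → ℝ)) x)
      (pointLaw m) := by
  classical
  let h : ∀ i, S → J i → ℝ := fun i u j => (A i ∩ B i j).indicator (1 : S → ℝ) u
  have hh : ∀ i, Measurable (h i) := fun i =>
    measurable_pi_lambda _ fun j => measurable_one.indicator ((hA i).inter (hB i j))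
  have e1 : ∀ i, (fun x (j : J i) => pointSum ((A i ∩ B i j).indicator (1 : S → ℝ)) x) =
      pointSum (h i) := by
    intro i; ext x j
    simp [pointSum, h, Finset.sum_apply]
  have e2 : (fun x i => pointSum (h i) x) = pointSum (fun u i => h i u) := by
    ext x i j
    simp [pointSum, Finset.sum_apply]
  have e3 : (fun i x (j : J i) => pointSum ((A i ∩ B i j).indicator (1 : S → ℝ)) x) =
      fun i => pointSum (h i) := funext e1
  rw [e3, iIndepFun_iff_charFunDual_pi fun i => (measurable_pointSum (hh i)).aemeasurable]
  intro L
  have hhh : Measurable fun u i => h i u := measurable_pi_lambda _ hh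
  rw [e2, charFunDual_pointSum m hhh]
  simp_rw [charFunDual_pointSum m (hh _)]
  rw [← Complex.exp_sum]
  congr 1
  have hint : ∀ i, Integrable (fun u =>
      Complex.exp ((L.comp (.single ℝ (fun i => J i → ℝ) i)) (h i u) * Complex.I) - 1) m := by
    intro i
    refine Integrable.sub (Integrable.of_bound ?_ 1 (Eventually.of_forall fun u => by
      rw [Complex.norm_exp_ofReal_mul_I])) (integrable_const _)
    have : Measurable fun u => (L.comp (.single ℝ (fun i => J i → ℝ) i)) (h i u) :=
      (ContinuousLinearMap.continuous _).measurable.comp (hh i)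
    exact (by fun_prop : Measurable fun u =>
      Complex.exp ((L.comp (.single ℝ (fun i => J i → ℝ) i)) (h i u) * Complex.I)).aestronglyMeasurable
  rw [← integral_finsetSum _ fun i _ => hint i]
  refine integral_congr_ae (Eventually.of_forall fun u => ?_)
  beta_reduce
  have hz : ∀ i, u ∉ A i → h i u = 0 := by
    intro i hi; ext j; simp [h, hi]
  by_cases hu : ∃ i, u ∈ A i
  · obtain ⟨i, hi⟩ := hu
    have ho : ∀ k, k ≠ i → h k u = 0 := fun k hk =>
      hz k fun hku => Set.disjoint_left.1 (hd hk) hku hi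
    rw [Finset.sum_eq_single i]
    · congr 4
      simp only [ContinuousLinearMap.comp_apply, ContinuousLinearMap.single_apply]
      congr 1
      ext k j
      by_cases hk : k = i
      · subst hk; simp
      · rw [Pi.single_eq_of_ne hk, ho k hk]
    · intro k _ hk
      rw [ho k hk]; simp
    · intro hni; exact absurd (Finset.mem_univ i) hni
  · push Not at hu
    have : (fun i => h i u) = 0 := by ext i j; rw [hz i (hu i)]; rfl
    rw [this, map_zero]
    simp [hz _ (hu _)]

/-- A random measure is measurable with respect to its counts on measurable sets, and independence
of these families of counts is decided by finite subfamilies. -/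
lemma iIndepFun_restrict_pointMeasure (m : Measure S) [IsProbabilityMeasure m] {ι : Type*}
    [Fintype ι] {A : ι → Set S} (hA : ∀ i, MeasurableSet (A i))
    (hd : Pairwise fun i j => Disjoint (A i) (A j)) :
    iIndepFun (fun i x => (pointMeasure x).restrict (A i)) (pointLaw m) := by
  have h : iIndepFun (fun i x (B : {B : Set S // MeasurableSet B}) =>
      pointSum ((A i ∩ B.1).indicator (1 : S → ℝ)) x) (pointLaw m) := by
    refine iIndepFun.iIndepFun_process (fun i B => measurable_pointSum
      (measurable_one.indicator ((hA i).inter B.2))) fun F J => ?_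
    exact iIndepFun_pointSum_indicator m (A := fun i : F => A i) (fun i => hA i)
      (fun i j hij => hd (Subtype.coe_injective.ne hij))
      (B := fun i (j : J i) => j.1.1) fun i j => j.1.2
  rw [iIndepFun_iff_iIndep] at h ⊢
  refine iIndep_of_iIndep_of_le h fun i => ?_
  rw [← measurable_iff_comap_le]
  refine Measure.measurable_of_measurable_coe _ fun B hB => ?_
  simp_rw [Measure.restrict_apply hB, pointMeasure_apply _ (hB.inter (hA i))]
  refine Measurable.ennreal_ofReal ?_
  rw [Set.inter_comm]
  exact (measurable_pi_apply (⟨B, hB⟩ : {B : Set S // MeasurableSet B})).comp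
    (comap_measurable (fun x (B : {B : Set S // MeasurableSet B}) =>
      pointSum ((A i ∩ B.1).indicator (1 : S → ℝ)) x))

lemma charFun_pointSum_indicator (m : Measure S) [IsProbabilityMeasure m] {A : Set S}
    (hA : MeasurableSet A) (t : ℝ) :
    charFun ((pointLaw m).map (pointSum (A.indicator (1 : S → ℝ)))) t =
      Complex.exp (m.real A * (Complex.exp (t * Complex.I) - 1)) := by
  rw [charFun_eq_charFunDual_toDualMap, charFunDual_pointSum m (measurable_one.indicator hA)]
  congr 1
  have : ∀ u, Complex.exp ((InnerProductSpace.toDualMap ℝ ℝ t) (A.indicator (1 : S → ℝ) u) *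
      Complex.I) - 1 = A.indicator (fun _ => Complex.exp (t * Complex.I) - 1) u := by
    intro u
    by_cases h : u ∈ A <;> simp [h]
  simp_rw [this]
  rw [integral_indicator_const _ hA, Complex.real_smul]

lemma map_pointSum_indicator (m : Measure S) [IsProbabilityMeasure m] {A : Set S}
    (hA : MeasurableSet A) :
    (pointLaw m).map (pointSum (A.indicator (1 : S → ℝ))) =
      (poissonMeasure (m A).toNNReal).map (Nat.cast : ℕ → ℝ) := by
  have := Measure.isProbabilityMeasure_map (μ := pointLaw m)
    (measurable_pointSum (measurable_one.indicator hA : Measurable (A.indicator (1 : S → ℝ)))).aemeasurable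
  have := Measure.isProbabilityMeasure_map (μ := poissonMeasure (m A).toNNReal)
    (f := (Nat.cast : ℕ → ℝ)) (by fun_prop)
  apply Measure.ext_of_charFun
  ext t
  rw [charFun_pointSum_indicator m hA, charFun_map_cast_poissonMeasure]
  rfl

/-- The count is Poisson of mean `m A`, and `1 - exp (-x) ≤ x`. This is the input to Borel–Cantelli
when the strips are summed. -/
lemma pointLaw_pointSum_ne_zero_le (m : Measure S) [IsProbabilityMeasure m] {A : Set S}
    (hA : MeasurableSet A) :
    pointLaw m {x | pointSum (A.indicator (1 : S → ℝ)) x ≠ 0} ≤ m A := by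
  have hmeas := measurable_pointSum
    (measurable_one.indicator hA : Measurable (A.indicator (1 : S → ℝ)))
  have h1 : pointLaw m {x | pointSum (A.indicator (1 : S → ℝ)) x = 0} =
      ENNReal.ofReal (Real.exp (-(m A).toReal)) := by
    have : {x | pointSum (A.indicator (1 : S → ℝ)) x = 0} =
      pointSum (A.indicator (1 : S → ℝ)) ⁻¹' {0} := rfl
    rw [this, ← Measure.map_apply hmeas (measurableSet_singleton 0), map_pointSum_indicator m hA,
      Measure.map_apply (by fun_prop) (measurableSet_singleton 0)]
    have : (Nat.cast : ℕ → ℝ) ⁻¹' {0} = {0} := by ext n; simp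
    rw [this, poissonMeasure_singleton]
    simp [ENNReal.coe_toNNReal_eq_toReal]
  have h2 : {x | pointSum (A.indicator (1 : S → ℝ)) x ≠ 0} =
      {x | pointSum (A.indicator (1 : S → ℝ)) x = 0}ᶜ := rfl
  have h3 : MeasurableSet {x | pointSum (A.indicator (1 : S → ℝ)) x = 0} :=
    hmeas (measurableSet_singleton 0)
  rw [h2, prob_compl_eq_one_sub h3, h1, tsub_le_iff_right,
    ← ENNReal.ofReal_toReal (measure_ne_top m A), ← ENNReal.ofReal_add (by positivity) (by positivity),
    ENNReal.one_le_ofReal, ENNReal.toReal_ofReal (by positivity)]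
  linarith [Real.add_one_le_exp (-(m A).toReal)]

end PointConfiguration

end

section

/-! ### The Poisson random measure on `ℝ × [0,1]` -/

/-- Independence across `k`, together with independence within each `k`, makes the doubly indexed
family independent, and this may then be regrouped along `i`. In the application `k` numbers the
strips and `i` the disjoint regions. -/
lemma iIndepFun_swap {Ω 𝓧 ι κ : Type*} {mΩ : MeasurableSpace Ω} [MeasurableSpace 𝓧]
    {P : Measure Ω} {X : κ → ι → Ω → 𝓧} (hX : ∀ k i, Measurable (X k i))
    (h1 : iIndepFun (fun k ω i => X k i ω) P) (h2 : ∀ k, iIndepFun (X k) P) :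
    iIndepFun (fun i ω k => X k i ω) P := by
  have := h1.isProbabilityMeasure
  have h := iIndepFun_uncurry' hX h1 h2
  have h' : iIndepFun (fun (p : ι × κ) ω => X p.2 p.1 ω) P :=
    h.precomp (g := (Prod.swap : ι × κ → κ × ι)) Prod.swap_injective
  have hp : ∀ i k, IsProbabilityMeasure (P.map (X k i)) := fun i k =>
    Measure.isProbabilityMeasure_map (hX k i).aemeasurable
  have e1 := h'.map_fun_eq_infinitePi_map fun (p : ι × κ) => hX p.2 p.1
  have e2 := Measure.infinitePi_map_curry (μ := fun (i : ι) (k : κ) => P.map (X k i))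
  rw [← e1, Measure.map_map (by fun_prop) (by fun_prop)] at e2
  rw [iIndepFun_iff_map_fun_eq_infinitePi_map fun i => measurable_pi_lambda _ fun k => hX k i]
  have e3 : ∀ i, P.map (fun ω k => X k i ω) = Measure.infinitePi fun k => P.map (X k i) := fun i =>
    (h'.precomp (g := fun k => (i, k)) fun _ _ hk => (Prod.mk.inj hk).2).map_fun_eq_infinitePi_map
      fun k => hX k i
  simp_rw [e3]
  exact e2

/-- Strips of unit area partitioning `ℝ × [0,1]`. -/
def strip (k : ℕ) : Set (ℝ × I) :=
  Set.Ioc ((Equiv.intEquivNat.symm k : ℤ) : ℝ) ((Equiv.intEquivNat.symm k : ℤ) + 1) ×ˢ Set.univ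

lemma measurableSet_strip (k : ℕ) : MeasurableSet (strip k) :=
  measurableSet_Ioc.prod MeasurableSet.univ

/-- Lebesgue measure on a strip. -/
def stripMeasure (k : ℕ) : Measure (ℝ × I) := volume.restrict (strip k)

instance (k : ℕ) : IsProbabilityMeasure (stripMeasure k) := by
  constructor
  rw [stripMeasure, Measure.restrict_apply_univ, strip, Measure.volume_eq_prod, Measure.prod_prod]
  simp

lemma tsum_stripMeasure {A : Set (ℝ × I)} (hA : MeasurableSet A) :
    ∑' k, stripMeasure k A = volume A := by
  have hd : Pairwise (Function.onFun Disjoint strip) := by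
    intro i j hij
    refine Set.disjoint_prod.2 (Or.inl ?_)
    exact Set.pairwise_disjoint_Ioc_intCast ℝ (Equiv.intEquivNat.symm.injective.ne hij)
  have hu : ⋃ k, strip k = Set.univ := by
    unfold strip
    rw [← Set.iUnion_prod_const, Equiv.intEquivNat.symm.surjective.iUnion_comp
      (fun z : ℤ => Set.Ioc (z : ℝ) (z + 1)), iUnion_Ioc_intCast, Set.univ_prod_univ]
  have := Measure.restrict_iUnion_apply (μ := (volume : Measure (ℝ × I))) hd
    (fun k => measurableSet_strip k) hA
  rw [hu, Measure.restrict_univ] at this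
  exact this.symm

/-- The sample space of a Poisson random measure. -/
abbrev PoissonSpace : Type := ℕ → ℕ × (ℕ → ℝ × I)

/-- The law of independent Poisson configurations on the strips. -/
def poissonSpaceMeasure : Measure PoissonSpace := Measure.infinitePi fun k => pointLaw (stripMeasure k)

instance : IsProbabilityMeasure poissonSpaceMeasure := by
  unfold poissonSpaceMeasure; infer_instance

/-- The Poisson random measure on `ℝ × [0,1]`. -/
def poissonRM (ω : PoissonSpace) : Measure (ℝ × I) := Measure.sum fun k => pointMeasure (ω k)

lemma measurable_measure_sum {S : Type*} [MeasurableSpace S] :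
    Measurable (fun f : ℕ → Measure S => Measure.sum f) := by
  refine Measure.measurable_of_measurable_coe _ fun A hA => ?_
  simp_rw [Measure.sum_apply _ hA]
  exact Measurable.tsum fun k => (Measure.measurable_coe hA).comp (measurable_pi_apply k)

@[fun_prop]
lemma measurable_poissonRM : Measurable poissonRM :=
  measurable_measure_sum.comp (measurable_pi_lambda _ fun k =>
    measurable_pointMeasure.comp (measurable_pi_apply k))

lemma measurable_measure_restrict {S : Type*} [MeasurableSpace S] {A : Set S}
    (hA : MeasurableSet A) : Measurable (fun m : Measure S => m.restrict A) := by
  refine Measure.measurable_of_measurable_coe _ fun B hB => ?_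
  simp_rw [Measure.restrict_apply hB]
  exact Measure.measurable_coe (hB.inter hA)

lemma poissonRM_restrict (ω : PoissonSpace) {A : Set (ℝ × I)} (hA : MeasurableSet A) :
    (poissonRM ω).restrict A = Measure.sum fun k => (pointMeasure (ω k)).restrict A :=
  Measure.restrict_sum _ hA

lemma iIndepFun_restrict_poissonRM {ι : Type*} [Fintype ι] {A : ι → Set (ℝ × I)}
    (hA : ∀ i, MeasurableSet (A i)) (hd : Pairwise fun i j => Disjoint (A i) (A j)) :
    iIndepFun (fun i ω => (poissonRM ω).restrict (A i)) poissonSpaceMeasure := by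
  have hm : ∀ (k : ℕ) (i : ι), Measurable fun ω : PoissonSpace =>
      (pointMeasure (ω k)).restrict (A i) := fun k i =>
    (measurable_measure_restrict (hA i)).comp (measurable_pointMeasure.comp (measurable_pi_apply k))
  have h1 : iIndepFun (fun k (ω : PoissonSpace) i => (pointMeasure (ω k)).restrict (A i))
      poissonSpaceMeasure :=
    iIndepFun_infinitePi (P := fun k => pointLaw (stripMeasure k))
      (X := fun _ x i => (pointMeasure x).restrict (A i)) fun k =>
        measurable_pi_lambda _ fun i =>
          (measurable_measure_restrict (hA i)).comp measurable_pointMeasure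
  have h2 : ∀ k, iIndepFun (fun i (ω : PoissonSpace) => (pointMeasure (ω k)).restrict (A i))
      poissonSpaceMeasure := by
    intro k
    have h := iIndepFun_restrict_pointMeasure (stripMeasure k) hA hd
    have hk : Measure.map (fun ω : PoissonSpace => ω k) poissonSpaceMeasure =
        pointLaw (stripMeasure k) :=
      Measure.infinitePi_map_eval (fun k => pointLaw (stripMeasure k)) k
    have hmx : ∀ i, Measurable fun x : ℕ × (ℕ → ℝ × I) => (pointMeasure x).restrict (A i) :=
      fun i => (measurable_measure_restrict (hA i)).comp measurable_pointMeasure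
    rw [iIndepFun_iff_map_fun_eq_pi_map fun i => (hm k i).aemeasurable]
    rw [iIndepFun_iff_map_fun_eq_pi_map fun i => (hmx i).aemeasurable, ← hk,
      Measure.map_map (measurable_pi_lambda _ hmx) (measurable_pi_apply k)] at h
    have e : ∀ i, Measure.map (fun x => (pointMeasure x).restrict (A i))
        (Measure.map (fun ω : PoissonSpace => ω k) poissonSpaceMeasure) =
        Measure.map (fun ω => (pointMeasure (ω k)).restrict (A i)) poissonSpaceMeasure := fun i =>
      Measure.map_map (hmx i) (measurable_pi_apply k)
    simp_rw [e] at h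
    exact h
  have h3 := (iIndepFun_swap hm h1 h2).comp (fun _ f => Measure.sum f)
    fun _ => measurable_measure_sum
  convert h3 using 2 with i
  ext1 ω
  exact poissonRM_restrict ω (hA i)

/-- The counts on the strips are independent Poisson variables whose means add up to the volume of
`A`. The partial sums converge almost surely, and their characteristic functions converge to that of
the Poisson law with the total mean. -/
lemma hasLaw_poissonRM {A : Set (ℝ × I)} (hA : MeasurableSet A) (hv : volume A ≠ ∞) :
    poissonSpaceMeasure.map (fun ω => poissonRM ω A) =
      (poissonMeasure (volume A).toNNReal).map (Nat.cast : ℕ → ℝ≥0∞) := by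
  let c : ℕ → PoissonSpace → ℝ := fun k ω => pointSum (A.indicator (1 : ℝ × I → ℝ)) (ω k)
  have hps : Measurable (pointSum (A.indicator (1 : ℝ × I → ℝ))) :=
    measurable_pointSum (measurable_one.indicator hA)
  have hc : ∀ k, Measurable (c k) := fun k => hps.comp (measurable_pi_apply k)
  have hc0 : ∀ k ω, 0 ≤ c k ω := fun k ω => Finset.sum_nonneg fun p _ =>
    Set.indicator_nonneg (f := (1 : ℝ × I → ℝ)) (fun _ _ => zero_le_one) _
  have heval : ∀ k, MeasurePreserving (fun ω : PoissonSpace => ω k) poissonSpaceMeasure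
      (pointLaw (stripMeasure k)) := fun k =>
    measurePreserving_eval_infinitePi (fun k => pointLaw (stripMeasure k)) k
  -- Borel–Cantelli: as `A` has finite volume, almost surely only finitely many strips contain a
  -- point in `A`. The sum of counts is then finite and can be treated as a real number.
  have hfin : ∀ᵐ ω ∂poissonSpaceMeasure, ∀ᶠ k in atTop, c k ω = 0 := by
    have hs : ∑' k, poissonSpaceMeasure {ω | c k ω ≠ 0} ≠ ∞ := by
      refine ne_top_of_le_ne_top hv ?_
      rw [← tsum_stripMeasure hA]
      refine ENNReal.tsum_le_tsum fun k => ?_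
      refine le_trans (le_of_eq ?_) (pointLaw_pointSum_ne_zero_le (stripMeasure k) hA)
      rw [← (heval k).measure_preimage]
      · rfl
      · exact (hps (measurableSet_singleton 0)).compl.nullMeasurableSet
    filter_upwards [ae_eventually_notMem hs] with ω hω
    filter_upwards [hω] with k hk
    exact not_not.1 hk
  let Q : ℕ → PoissonSpace → ℝ := fun N ω => ∑ k ∈ Finset.range N, c k ω
  let T : PoissonSpace → ℝ := fun ω => (poissonRM ω A).toReal
  have hQ : ∀ N, Measurable (Q N) := fun N => Finset.measurable_fun_sum _ fun k _ => hc k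
  have hpm : Measurable fun ω => poissonRM ω A := (Measure.measurable_coe hA).comp measurable_poissonRM
  have hT : Measurable T := hpm.ennreal_toReal
  have hgood : ∀ᵐ ω ∂poissonSpaceMeasure, poissonRM ω A = ENNReal.ofReal (T ω) ∧
      Tendsto (fun N => Q N ω) atTop (𝓝 (T ω)) := by
    filter_upwards [hfin] with ω hω
    obtain ⟨N, hN⟩ := eventually_atTop.1 hω
    have hs : HasSum (fun k => c k ω) (Q N ω) :=
      hasSum_sum_of_ne_finset_zero fun k hk => hN k (not_lt.1 fun h => hk (Finset.mem_range.2 h))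
    have e : poissonRM ω A = ENNReal.ofReal (Q N ω) := by
      rw [poissonRM, Measure.sum_apply _ hA]
      simp_rw [pointMeasure_apply _ hA]
      rw [← hs.tsum_eq, ENNReal.ofReal_tsum_of_nonneg (fun k => hc0 k ω) hs.summable]
    have e' : T ω = Q N ω := by
      simp only [T]
      rw [e, ENNReal.toReal_ofReal (Finset.sum_nonneg fun k _ => hc0 k ω)]
    rw [e']
    exact ⟨e, hs.tendsto_sum_nat⟩
  have hind : iIndepFun c poissonSpaceMeasure :=
    iIndepFun_infinitePi (P := fun k => pointLaw (stripMeasure k))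
      (X := fun _ => pointSum (A.indicator (1 : ℝ × I → ℝ))) fun _ => hps
  have hcl : ∀ k t, charFun (poissonSpaceMeasure.map (c k)) t =
      Complex.exp ((stripMeasure k).real A * (Complex.exp (t * Complex.I) - 1)) := by
    intro k t
    rw [← charFun_pointSum_indicator _ hA, ← (heval k).map_eq,
      Measure.map_map hps (measurable_pi_apply k)]
    rfl
  have hQl : ∀ N t, charFun (poissonSpaceMeasure.map (Q N)) t =
      Complex.exp (((∑ k ∈ Finset.range N, (stripMeasure k).real A : ℝ) : ℂ) *
        (Complex.exp (t * Complex.I) - 1)) := by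
    intro N t
    rw [iIndepFun.charFun_map_fun_finsetSum_eq_prod (fun k _ => (hc k).aemeasurable)
      (hind.restrict _), Finset.prod_apply]
    simp_rw [hcl]
    rw [← Complex.exp_sum, ← Finset.sum_mul]
    push_cast; rfl
  have hTl : poissonSpaceMeasure.map T =
      (poissonMeasure (volume A).toNNReal).map (Nat.cast : ℕ → ℝ) := by
    have := Measure.isProbabilityMeasure_map (μ := poissonSpaceMeasure) hT.aemeasurable
    have := Measure.isProbabilityMeasure_map (μ := poissonMeasure (volume A).toNNReal)
      (f := (Nat.cast : ℕ → ℝ)) (by fun_prop)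
    apply Measure.ext_of_charFun
    ext t
    have l1 : Tendsto (fun N => charFun (poissonSpaceMeasure.map (Q N)) t) atTop
        (𝓝 (charFun (poissonSpaceMeasure.map T) t)) := by
      simp_rw [charFun_apply_real]
      rw [integral_map hT.aemeasurable (by fun_prop)]
      have : ∀ N, ∫ x, Complex.exp (t * x * Complex.I) ∂(poissonSpaceMeasure.map (Q N)) =
          ∫ ω, Complex.exp (t * Q N ω * Complex.I) ∂poissonSpaceMeasure := fun N =>
        integral_map (hQ N).aemeasurable (by fun_prop)
      simp_rw [this]
      refine tendsto_integral_of_dominated_convergence (fun _ => 1) (fun N => ?_)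
        (integrable_const _) (fun N => Eventually.of_forall fun ω => ?_) ?_
      · have := hQ N
        exact (by fun_prop : Measurable fun ω =>
          Complex.exp (t * Q N ω * Complex.I)).aestronglyMeasurable
      · rw [← Complex.ofReal_mul, Complex.norm_exp_ofReal_mul_I]
      · filter_upwards [hgood] with ω hω
        exact ((by fun_prop : Continuous fun x : ℝ =>
          Complex.exp (t * x * Complex.I)).tendsto _).comp hω.2
    refine tendsto_nhds_unique l1 ?_
    simp_rw [hQl]
    rw [charFun_map_cast_poissonMeasure]
    have hsum : HasSum (fun k => (stripMeasure k).real A) (volume A).toReal := by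
      have h1 : ∑' k, stripMeasure k A ≠ ∞ := by rwa [tsum_stripMeasure hA]
      have := ENNReal.hasSum_toReal h1
      rwa [← ENNReal.tsum_toReal_eq (fun k => measure_ne_top _ _), tsum_stripMeasure hA] at this
    exact ((by fun_prop : Continuous fun x : ℝ => Complex.exp ((x : ℂ) *
      (Complex.exp (t * Complex.I) - 1))).tendsto _).comp hsum.tendsto_sum_nat
  have hm1 : poissonSpaceMeasure.map (fun ω => poissonRM ω A) =
      poissonSpaceMeasure.map (ENNReal.ofReal ∘ T) :=
    Measure.map_congr (hgood.mono fun ω h => h.1)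
  rw [hm1, ← Measure.map_map ENNReal.measurable_ofReal hT, hTl,
    Measure.map_map ENNReal.measurable_ofReal (by fun_prop)]
  congr 1
  ext n
  simp

/-- The filtration generated by the Poisson random measure. -/
def poissonFiltration : Filtration I (inferInstance : MeasurableSpace PoissonSpace) where
  seq t := MeasurableSpace.comap (fun ω => (poissonRM ω).restrict (Set.univ ×ˢ Set.Iic t)) inferInstance
  mono' s t hst := by
    have hs : MeasurableSet ((Set.univ : Set ℝ) ×ˢ Set.Iic s) := MeasurableSet.univ.prod measurableSet_Iic
    have : (fun ω => (poissonRM ω).restrict (Set.univ ×ˢ Set.Iic s)) =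
        (fun m : Measure (ℝ × I) => m.restrict (Set.univ ×ˢ Set.Iic s)) ∘
        (fun ω => (poissonRM ω).restrict (Set.univ ×ˢ Set.Iic t)) := by
      ext1 ω
      simp only [Function.comp_apply]
      rw [Measure.restrict_restrict hs, Set.inter_eq_left.2
        (Set.prod_mono le_rfl (Set.Iic_subset_Iic.2 hst))]
    simp only
    rw [this, ← MeasurableSpace.comap_comp]
    exact MeasurableSpace.comap_mono (measurable_measure_restrict hs).comap_le
  le' t := ((measurable_measure_restrict
    (MeasurableSet.univ.prod measurableSet_Iic)).comp measurable_poissonRM).comap_le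

theorem isPoissonRandomMeasure_poissonRM :
    IsPoissonRandomMeasure poissonSpaceMeasure poissonFiltration poissonRM where
  adapted t := Measurable.of_comap_le le_rfl
  law A hA hv := hasLaw_poissonRM hA hv
  indep m A hA hd := by
    have h := (iIndepFun_restrict_poissonRM hA hd).comp (fun _ ν => ν Set.univ)
      fun _ => Measure.measurable_coe MeasurableSet.univ
    convert h using 2 with i
    ext ω
    simp
  future_indep t := by
    -- Future and past are the restrictions to two disjoint slabs.
    let A : Fin 2 → Set (ℝ × I) := ![Set.univ ×ˢ Set.Ioi t, Set.univ ×ˢ Set.Iic t]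
    have hA : ∀ i, MeasurableSet (A i) := by
      intro i
      fin_cases i
      · exact MeasurableSet.univ.prod measurableSet_Ioi
      · exact MeasurableSet.univ.prod measurableSet_Iic
    have h01 : Disjoint (A 0) (A 1) :=
      Set.disjoint_prod.2 (Or.inr (Set.Iic_disjoint_Ioi le_rfl).symm)
    have hd : Pairwise fun i j => Disjoint (A i) (A j) := by
      intro i j hij
      fin_cases i <;> fin_cases j
      · exact absurd rfl hij
      · exact h01
      · exact h01.symm
      · exact absurd rfl hij
    exact (iIndepFun_restrict_poissonRM hA hd).indepFun (i := 0) (j := 1) (by decide)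

end

section

/-! ### Extensions of filtered probability spaces -/

/-- Measurable rectangles form a generating π-system on which the product measure factorises. -/
lemma Indep.prod_prod {α β : Type*} {m₁ m₂ mα : MeasurableSpace α}
    {m₁' m₂' mβ : MeasurableSpace β}
    {P : Measure α} {Q : Measure β} [IsProbabilityMeasure P] [IsProbabilityMeasure Q]
    (h₁ : m₁ ≤ mα) (h₂ : m₂ ≤ mα) (h₁' : m₁' ≤ mβ) (h₂' : m₂' ≤ mβ)
    (h : Indep m₁ m₂ P) (h' : Indep m₁' m₂' Q) :
    Indep (m₁.prod m₁') (m₂.prod m₂') (P.prod Q) := by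
  have key : ∀ (m : MeasurableSpace α) (m' : MeasurableSpace β), m ≤ mα → m' ≤ mβ →
      m.prod m' ≤ mα.prod mβ := fun m m' hm hm' =>
    sup_le_sup (MeasurableSpace.comap_mono hm) (MeasurableSpace.comap_mono hm')
  refine IndepSets.indep (key _ _ h₁ h₁') (key _ _ h₂ h₂')
    (@isPiSystem_prod α β m₁ m₁') (@isPiSystem_prod α β m₂ m₂')
    (@generateFrom_prod α β m₁ m₁').symm (@generateFrom_prod α β m₂ m₂').symm ?_
  rw [IndepSets_iff]
  rintro _ _ ⟨s, hs, s', hs', rfl⟩ ⟨t, ht, t', ht', rfl⟩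
  have hs : MeasurableSet[m₁] s := hs
  have ht : MeasurableSet[m₂] t := ht
  have hs' : MeasurableSet[m₁'] s' := hs'
  have ht' : MeasurableSet[m₂'] t' := ht'
  rw [Set.prod_inter_prod, Measure.prod_prod, Measure.prod_prod, Measure.prod_prod,
    (Indep_iff _ _ _).1 h s t hs ht, (Indep_iff _ _ _).1 h' s' t' hs' ht']
  ring

variable {Ω Ω' : Type} {mΩ : MeasurableSpace Ω} {mΩ' : MeasurableSpace Ω'}

/-- The map `φ` exhibits `(Ω', ℱ', P')` as an extension of `(Ω, ℱ, P)`. -/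
structure IsExtension (φ : Ω' → Ω) (P' : Measure Ω') (P : Measure Ω) (ℱ' : Filtration I mΩ')
    (ℱ : Filtration I mΩ) : Prop where
  measurePreserving : MeasurePreserving φ P' P
  measurable : ∀ t, Measurable[ℱ' t, ℱ t] φ
  indep : ∀ (t : I) (m : MeasurableSpace Ω), m ≤ mΩ → Indep m (ℱ t) P →
    Indep (m.comap φ) (ℱ' t) P'

/-- The product filtration. -/
def prodFiltration (ℱ : Filtration I mΩ) (ℱ' : Filtration I mΩ') :
    Filtration I (mΩ.prod mΩ') where
  seq t := (ℱ t).prod (ℱ' t)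
  mono' _ _ hst := sup_le_sup (MeasurableSpace.comap_mono (ℱ.mono hst))
    (MeasurableSpace.comap_mono (ℱ'.mono hst))
  le' t := sup_le_sup (MeasurableSpace.comap_mono (ℱ.le t))
    (MeasurableSpace.comap_mono (ℱ'.le t))

variable {P : Measure Ω} {P' : Measure Ω'} {ℱ : Filtration I mΩ} {ℱ' : Filtration I mΩ'}

/-- A σ-algebra lifted from the first factor is its product with the trivial σ-algebra on the
second, and the trivial σ-algebra is independent of everything. -/
lemma isExtension_fst [IsProbabilityMeasure P] [IsProbabilityMeasure P'] :
    IsExtension Prod.fst (P.prod P') P (prodFiltration ℱ ℱ') ℱ where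
  measurePreserving := measurePreserving_fst
  measurable t := Measurable.of_comap_le le_sup_left
  indep t m hm h := by
    have := Indep.prod_prod hm (ℱ.le t) bot_le (ℱ'.le t) h (indep_bot_left (μ := P') (ℱ' t))
    refine indep_of_indep_of_le_left this ?_
    exact le_sup_left

lemma isExtension_snd [IsProbabilityMeasure P] [IsProbabilityMeasure P'] :
    IsExtension Prod.snd (P.prod P') P' (prodFiltration ℱ ℱ') ℱ' where
  measurePreserving := measurePreserving_snd
  measurable t := Measurable.of_comap_le le_sup_right
  indep t m hm h := by
    have := Indep.prod_prod bot_le (ℱ.le t) hm (ℱ'.le t) (indep_bot_left (μ := P) (ℱ t)) h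
    refine indep_of_indep_of_le_left this ?_
    exact le_sup_right

lemma IsBrownianMotion.extend {d : ℕ} {B : I → Ω → EuclideanSpace ℝ (Fin d)} {φ : Ω' → Ω}
    (hB : IsBrownianMotion P ℱ B) (hφ : IsExtension φ P' P ℱ' ℱ) :
    IsBrownianMotion P' ℱ' (fun t ω => B t (φ ω)) where
  adapted t := (hB.adapted t).comp_measurable (hφ.measurable t)
  start := hφ.measurePreserving.quasiMeasurePreserving.ae hB.start
  continuous_paths := hφ.measurePreserving.quasiMeasurePreserving.ae hB.continuous_paths
  increment_law s t hst := by
    have hm : ∀ t, Measurable (B t) := fun t => ((hB.adapted t).mono (ℱ.le t)).measurable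
    rw [← hB.increment_law s t hst, ← hφ.measurePreserving.map_eq,
      Measure.map_map (by fun_prop) hφ.measurePreserving.measurable]
    rfl
  increment_indep s t hst := by
    have hm : ∀ t, Measurable (B t) := fun t => ((hB.adapted t).mono (ℱ.le t)).measurable
    have := hφ.indep s _ ((hm t).sub (hm s)).comap_le (hB.increment_indep s t hst)
    rwa [MeasurableSpace.comap_comp] at this

lemma iIndepFun.comp_measurePreserving {ι β : Type*} [MeasurableSpace β] {φ : Ω' → Ω}
    {f : ι → Ω → β} (hf : ∀ i, Measurable (f i)) (h : iIndepFun f P)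
    (hφ : MeasurePreserving φ P' P) : iIndepFun (fun i ω => f i (φ ω)) P' := by
  rw [iIndepFun_iff_measure_inter_preimage_eq_mul] at h ⊢
  intro S sets hS
  have h1 : ∀ i ∈ S, MeasurableSet (f i ⁻¹' sets i) := fun i hi => hf i (hS i hi)
  have := h S hS
  rw [← hφ.measure_preimage (Finset.measurableSet_biInter S h1).nullMeasurableSet] at this
  rw [← Finset.prod_congr rfl fun i hi => (hφ.measure_preimage (h1 i hi).nullMeasurableSet)] at this
  rw [Set.preimage_iInter₂] at this
  exact this

lemma IsPoissonRandomMeasure.extend {ν : Ω → Measure (ℝ × I)} {φ : Ω' → Ω}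
    (hm : Measurable ν)
    (hν : IsPoissonRandomMeasure P ℱ ν) (hφ : IsExtension φ P' P ℱ' ℱ) :
    IsPoissonRandomMeasure P' ℱ' (fun ω => ν (φ ω)) where
  adapted t := (hν.adapted t).comp (hφ.measurable t)
  law A hA hv := by
    rw [← hν.law A hA hv, ← hφ.measurePreserving.map_eq,
      Measure.map_map (g := fun ω => ν ω A) ((Measure.measurable_coe hA).comp hm)
        hφ.measurePreserving.measurable]
    rfl
  indep m A hA hd := iIndepFun.comp_measurePreserving
    (fun i => (Measure.measurable_coe (hA i)).comp hm) (hν.indep m A hA hd) hφ.measurePreserving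
  future_indep t := by
    have := hφ.indep t _ ((measurable_measure_restrict
      (MeasurableSet.univ.prod measurableSet_Ioi)).comp hm).comap_le (hν.future_indep t)
    rwa [MeasurableSpace.comap_comp] at this

/-! ### The product of a Gaussian and a Poisson space -/

/-- A probability space carrying a `d`-dimensional Brownian motion and an independent Poisson random
measure. -/
abbrev DrivingSpace (d : ℕ) : Type := GaussianSeq d × PoissonSpace

/-- The law of the driving processes. -/
def drivingMeasure (d : ℕ) : Measure (DrivingSpace d) :=
  (gaussianSeqMeasure d).prod poissonSpaceMeasure

instance (d : ℕ) : IsProbabilityMeasure (drivingMeasure d) := by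
  unfold drivingMeasure; infer_instance

/-- The filtration generated by the driving processes. -/
def drivingFiltration (d : ℕ) :
    Filtration I (inferInstance : MeasurableSpace (DrivingSpace d)) :=
  prodFiltration (brownianFiltration d) poissonFiltration

/-! ### Gaussian observation noise -/

/-- The noise variable with index `i` is revealed at time `(i + 1) / n`. -/
def noiseFiltration (n : ℕ) : Filtration I (inferInstance : MeasurableSpace (Fin n → ℝ)) where
  seq t := ⨆ j ∈ {j : Fin n | gridTime n (j + 1) ≤ t},
    MeasurableSpace.comap (fun x : Fin n → ℝ => x j) inferInstance
  mono' _ _ hst := biSup_mono fun _ hj => le_trans hj hst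
  le' _ := iSup₂_le fun j _ => (measurable_pi_apply j).comap_le

/-- The law of the observation noise. -/
def noiseMeasure (n : ℕ) : Measure (Fin n → ℝ) := Measure.pi fun _ => gaussianReal 0 1

instance (n : ℕ) : IsProbabilityMeasure (noiseMeasure n) := by
  unfold noiseMeasure; infer_instance

lemma coe_gridTime {n i : ℕ} (hi : i ≤ n) : (gridTime n i : ℝ) = (i : ℝ) / n := by
  have h : (i : ℝ) / n ∈ Set.Icc (0 : ℝ) 1 :=
    ⟨by positivity, div_le_one_of_le₀ (by exact_mod_cast hi) (by positivity)⟩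
  rw [gridTime, Set.projIcc_of_mem _ h]

lemma measurable_noise {n : ℕ} (i : Fin n) :
    Measurable[noiseFiltration n (gridTime n (i + 1))] fun x : Fin n → ℝ => x i := by
  refine Measurable.of_comap_le ?_
  exact le_iSup₂_of_le (f := fun (j : Fin n) (_ : j ∈ {j : Fin n | gridTime n (j + 1) ≤
    gridTime n (i + 1)}) => MeasurableSpace.comap (fun x : Fin n → ℝ => x j) inferInstance)
    i (le_refl (gridTime n (i + 1))) le_rfl

/-- Noise variable `i` is revealed only at `(i + 1)/n`, so the σ-algebra at time `i/n` is generated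
by other coordinates. -/
lemma indep_noise {n : ℕ} (i : Fin n) :
    Indep (MeasurableSpace.comap (fun x : Fin n → ℝ => x i) inferInstance)
      (noiseFiltration n (gridTime n i)) (noiseMeasure n) := by
  have h : iIndepFun (fun (j : Fin n) (x : Fin n → ℝ) => x j) (noiseMeasure n) :=
    iIndepFun_pi (X := fun (_ : Fin n) (x : ℝ) => x) fun _ => aemeasurable_id
  have hd : Disjoint ({i} : Set (Fin n)) {j : Fin n | gridTime n (j + 1) ≤ gridTime n i} := by
    rw [Set.disjoint_singleton_left]
    intro hj
    have hj : gridTime n (i + 1) ≤ gridTime n i := hj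
    have hj' : (gridTime n (i + 1) : ℝ) ≤ gridTime n i := hj
    rw [coe_gridTime i.2, coe_gridTime i.2.le] at hj'
    have hn : (0 : ℝ) < n := by exact_mod_cast i.pos
    rw [div_le_div_iff_of_pos_right hn] at hj'
    push_cast at hj'
    linarith
  have := indep_iSup_of_disjoint (fun j => (measurable_pi_apply j).comap_le) h hd
  rwa [iSup_singleton] at this

end

section

/-! ### Stopped paths -/

/-- The path which is constant equal to `a` up to time `r` and follows the increments of `x` from
then on. -/
def excursion (a : ℝ) (r : I) (x : I → ℝ) (t : I) : ℝ := a + (x (max t r) - x r)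

/-- The exit time of the excursion from `(0, b)`. -/
def exitTime (a b : ℝ) (r : I) (x : I → ℝ) : I := sInf {t | excursion a r x t ∉ Set.Ioo 0 b}

/-- The excursion stopped at its exit time from `(0, b)`. -/
def stopPath (a b : ℝ) (r : I) (x : I → ℝ) (t : I) : ℝ := excursion a r x (min (exitTime a b r x) t)

variable {a b : ℝ} {r : I} {x : I → ℝ}

lemma continuous_excursion (hx : Continuous x) : Continuous (excursion a r x) := by
  unfold excursion
  fun_prop

lemma continuous_stopPath (hx : Continuous x) : Continuous (stopPath a b r x) :=
  (continuous_excursion hx).comp (by fun_prop)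

lemma excursion_of_le {t : I} (h : t ≤ r) : excursion a r x t = a := by
  simp [excursion, max_eq_right h]

lemma stopPath_of_le {t : I} (h : t ≤ r) : stopPath a b r x t = a :=
  excursion_of_le ((min_le_right _ _).trans h)

lemma excursion_mem_of_lt_exitTime {t : I} (h : t < exitTime a b r x) :
    excursion a r x t ∈ Set.Ioo 0 b := by
  have := notMem_of_lt_csInf (s := {t | excursion a r x t ∉ Set.Ioo 0 b}) h (OrderBot.bddBelow _)
  simpa using this

/-- The exit set is closed, so it contains its infimum when nonempty. A path that never exits has
exit time `sInf ∅ = 1`, which is why time `1` is excluded. -/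
lemma excursion_exitTime_notMem (hx : Continuous x) (h : exitTime a b r x < 1) :
    excursion a r x (exitTime a b r x) ∉ Set.Ioo 0 b := by
  have hc : IsClosed {t | excursion a r x t ∉ Set.Ioo 0 b} :=
    isOpen_Ioo.isClosed_compl.preimage (continuous_excursion hx)
  refine hc.sInf_mem ?_
  by_contra hne
  rw [Set.not_nonempty_iff_eq_empty] at hne
  rw [exitTime, hne, sInf_empty] at h
  exact lt_irrefl _ h

/-- Before the exit time the path is in the open interval, and continuity places it in the closed
one at the exit time. If the exit time is `0`, the stopped path is constant at `a`. -/
lemma stopPath_mem_Icc (hx : Continuous x) (ha : a ∈ Set.Icc 0 b) (t : I) :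
    stopPath a b r x t ∈ Set.Icc 0 b := by
  have hcl : IsClosed {s | excursion a r x s ∈ Set.Icc 0 b} :=
    isClosed_Icc.preimage (continuous_excursion hx)
  have hsub : Set.Iio (exitTime a b r x) ⊆ {s | excursion a r x s ∈ Set.Icc 0 b} :=
    fun s hs => Set.Ioo_subset_Icc_self (excursion_mem_of_lt_exitTime hs)
  rcases eq_or_ne (exitTime a b r x) 0 with h0 | h0
  · have : stopPath a b r x t = a := by
      rw [stopPath, h0, min_eq_left unitInterval.nonneg']
      exact excursion_of_le unitInterval.nonneg'
    rw [this]
    exact ha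
  · have h1 := closure_minimal hsub hcl
    have h2 : (Set.Iio (exitTime a b r x)).Nonempty := ⟨0, bot_lt_iff_ne_bot.2 h0⟩
    rw [closure_Iio' h2] at h1
    exact h1 (Set.mem_Iic.2 (min_le_left _ _))

/-- Starting at the boundary point `0` means stopping at once; the null experiment is thereby the
case `a = b = 0` of the same construction. -/
lemma stopPath_zero (t : I) : stopPath 0 b r x t = 0 := by
  have h0 : exitTime 0 b r x = 0 := by
    refine le_bot_iff.1 (sInf_le ?_)
    have : excursion 0 r x ⊥ = 0 := excursion_of_le bot_le
    simp [this]
  rw [stopPath, h0, min_eq_left unitInterval.nonneg']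
  exact excursion_of_le unitInterval.nonneg'

lemma stopPath_of_exitTime_le (hx : Continuous x) (ha : a ∈ Set.Icc 0 b) {t : I} (ht : t < 1)
    (h : exitTime a b r x ≤ t) : stopPath a b r x t = 0 ∨ stopPath a b r x t = b := by
  have h1 := stopPath_mem_Icc (r := r) hx ha t
  have h2 := excursion_exitTime_notMem hx (h.trans_lt ht)
  have h3 : stopPath a b r x t = excursion a r x (exitTime a b r x) := by
    rw [stopPath, min_eq_left h]
  rw [← h3] at h2
  simp only [Set.mem_Ioo, not_and, not_lt] at h2
  rcases h1.1.eq_or_lt with h | h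
  · exact Or.inl h.symm
  · exact Or.inr (le_antisymm h1.2 (h2 h))

lemma stopPath_eq_of_exitTime_le {s t : I} (h : exitTime a b r x ≤ s) (hst : s ≤ t) :
    stopPath a b r x t = stopPath a b r x s := by
  rw [stopPath, stopPath, min_eq_left h, min_eq_left (h.trans hst)]

/-- At a time `s`, the stopped path has been absorbed at `0` or at `b`, or else the increment of the
path since time `r` is at most `b`. -/
lemma stopPath_eq_or_mem (hx : Continuous x) (ha : a ∈ Set.Icc 0 b) {s : I} (hs : s < 1)
    (hr : r ≤ s) :
    (∀ t, s ≤ t → stopPath a b r x t = 0) ∨ stopPath a b r x s = b ∨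
      x s - x r ∈ Set.Icc (-b) b := by
  rcases le_or_gt (exitTime a b r x) s with h | h
  · rcases stopPath_of_exitTime_le hx ha hs h with h0 | hb
    · exact Or.inl fun t ht => (stopPath_eq_of_exitTime_le h ht).trans h0
    · exact Or.inr (Or.inl hb)
  · have h1 := excursion_mem_of_lt_exitTime h
    rw [excursion, max_eq_left hr] at h1
    refine Or.inr (Or.inr ⟨?_, ?_⟩)
    · linarith [h1.1, ha.2]
    · linarith [h1.2, ha.1]

/-! ### Telescoping sums up to a stopping time -/

open Classical in
/-- The increments of `g` along a grid `p`, up to the first grid point after `τ`. -/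
def stoppedSum (g : I → ℝ) (τ : I) (p : ℕ → I) (m : ℕ) : ℝ :=
  ∑ i ∈ Finset.range m, if p i < τ then g (p (i + 1)) - g (p i) else 0

/-- As long as `p k < τ` the sum telescopes, and it stops at the first grid point not before `τ`.
The overshoot lies within one cell, over which `g` deviates from its right endpoint value by at most
`ε`. The maximum with `p 0` covers the case `τ ≤ p 0`. -/
lemma abs_stoppedSum_sub_le {g : I → ℝ} {τ : I} {p : ℕ → I} (hp : Monotone p) {ε : ℝ}
    (hε : 0 ≤ ε) {m : ℕ}
    (h : ∀ k < m, ∀ u ∈ Set.Icc (p k) (p (k + 1)), |g (p (k + 1)) - g u| ≤ ε) :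
    |stoppedSum g τ p m - (g (max (min τ (p m)) (p 0)) - g (p 0))| ≤ ε := by
  suffices H : ∀ k ≤ m, |stoppedSum g τ p k - (g (max (min τ (p k)) (p 0)) - g (p 0))| ≤ ε ∧
      (p k < τ → stoppedSum g τ p k = g (p k) - g (p 0)) from (H m le_rfl).1
  intro k hk
  induction k with
  | zero => simp [stoppedSum, hε]
  | succ k ih =>
    obtain ⟨ih1, ih2⟩ := ih (by omega)
    have h0 : p 0 ≤ p k := hp (Nat.zero_le _)
    have h1 : p k ≤ p (k + 1) := hp (Nat.le_succ _)
    have hs : stoppedSum g τ p (k + 1) =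
        stoppedSum g τ p k + if p k < τ then g (p (k + 1)) - g (p k) else 0 := by
      rw [stoppedSum, Finset.sum_range_succ, ← stoppedSum]
    rcases lt_or_ge (p k) τ with hlt | hge
    · rw [if_pos hlt, ih2 hlt] at hs
      have hs' : stoppedSum g τ p (k + 1) = g (p (k + 1)) - g (p 0) := by rw [hs]; ring
      refine ⟨?_, fun _ => hs'⟩
      have h2 : max (min τ (p (k + 1))) (p 0) = min τ (p (k + 1)) :=
        max_eq_left (le_min (h0.trans hlt.le) (h0.trans h1))
      rw [hs', h2, sub_sub_sub_cancel_right]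
      exact h k (by omega) _ ⟨le_min hlt.le h1, min_le_right _ _⟩
    · rw [if_neg hge.not_gt, add_zero] at hs
      rw [hs]
      rw [min_eq_left hge] at ih1
      rw [min_eq_left (hge.trans h1)]
      exact ⟨ih1, fun hlt => absurd hlt (hge.trans h1).not_gt⟩

/-- The crude oscillation bound `2K` in `abs_stoppedSum_sub_le` gives a bound independent of the
grid, which serves as the dominating function in every limit of stopped sums. -/
lemma abs_stoppedSum_le {g : I → ℝ} {K : ℝ} (hg : ∀ t, |g t| ≤ K) (τ : I) {p : ℕ → I}
    (hp : Monotone p) (m : ℕ) : |stoppedSum g τ p m| ≤ 4 * K := by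
  have h2 : ∀ u v, |g u - g v| ≤ 2 * K := fun u v => by
    have := abs_sub (g u) (g v)
    linarith [hg u, hg v]
  have hK : 0 ≤ 2 * K := (abs_nonneg _).trans (h2 0 0)
  have h := abs_stoppedSum_sub_le (g := g) (τ := τ) hp hK (m := m) fun k _ u _ => h2 _ _
  have h' := h2 (max (min τ (p m)) (p 0)) (p 0)
  have := abs_add_le (stoppedSum g τ p m - (g (max (min τ (p m)) (p 0)) - g (p 0)))
    (g (max (min τ (p m)) (p 0)) - g (p 0))
  rw [sub_add_cancel] at this
  linarith

/-- The `i`-th point of the regular grid on `[s, t]` with mesh `(t - s) / m`. -/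
def grid (s t : I) (m i : ℕ) : I := Set.projIcc (0 : ℝ) 1 zero_le_one (s + (t - s) * min 1 ((i : ℝ) / m))

lemma coe_grid {s t : I} (hst : s ≤ t) (m i : ℕ) :
    (grid s t m i : ℝ) = s + (t - s) * min 1 ((i : ℝ) / m) := by
  have h0 : (0 : ℝ) ≤ t - s := sub_nonneg.2 hst
  have h1 : (0 : ℝ) ≤ min 1 ((i : ℝ) / m) := by positivity
  have h2 : min 1 ((i : ℝ) / m) ≤ 1 := min_le_left _ _
  have h : (s : ℝ) + (t - s) * min 1 ((i : ℝ) / m) ∈ Set.Icc (0 : ℝ) 1 := by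
    constructor
    · have := s.2.1
      positivity
    · have := t.2.2
      nlinarith
  rw [grid, Set.projIcc_of_mem _ h]

lemma grid_zero {s t : I} (hst : s ≤ t) (m : ℕ) : grid s t m 0 = s := by
  ext
  rw [coe_grid hst]
  simp

lemma grid_self {s t : I} (hst : s ≤ t) {m : ℕ} (hm : m ≠ 0) : grid s t m m = t := by
  ext
  have : (m : ℝ) ≠ 0 := by exact_mod_cast hm
  rw [coe_grid hst, div_self this]
  simp

lemma monotone_grid {s t : I} (hst : s ≤ t) (m : ℕ) : Monotone (grid s t m) := by
  intro i j hij
  have h0 : (0 : ℝ) ≤ t - s := sub_nonneg.2 hst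
  change (grid s t m i : ℝ) ≤ grid s t m j
  rw [coe_grid hst, coe_grid hst]
  gcongr

lemma grid_sub_le {s t : I} (hst : s ≤ t) (m i : ℕ) :
    (grid s t m (i + 1) : ℝ) - grid s t m i ≤ 1 / m := by
  have h0 : (0 : ℝ) ≤ t - s := sub_nonneg.2 hst
  have h1 : (t : ℝ) - s ≤ 1 := by linarith [t.2.2, s.2.1]
  have h2 : min (1 : ℝ) (((i + 1 : ℕ) : ℝ) / m) - min 1 ((i : ℝ) / m) ≤ 1 / m := by
    have h3 : ((i + 1 : ℕ) : ℝ) / m = (i : ℝ) / m + 1 / m := by push_cast; ring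
    have h4 : (0 : ℝ) ≤ 1 / m := by positivity
    rw [h3]
    rcases le_total (1 : ℝ) ((i : ℝ) / m) with h | h
    · rw [min_eq_left h, min_eq_left (by linarith)]; linarith
    · rw [min_eq_right h]; linarith [min_le_right (1 : ℝ) ((i : ℝ) / m + 1 / m)]
  rw [coe_grid hst, coe_grid hst]
  have h5 : (0 : ℝ) ≤ 1 / m := by positivity
  nlinarith

lemma tendsto_stoppedSum {g : I → ℝ} (hg : Continuous g) (τ : I) {s t : I} (hst : s ≤ t) :
    Tendsto (fun m : ℕ => stoppedSum g τ (grid s t (m + 1)) (m + 1)) atTop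
      (𝓝 (g (max (min τ t) s) - g s)) := by
  rw [Metric.tendsto_atTop]
  intro ε hε
  obtain ⟨δ, hδ, h⟩ := Metric.uniformContinuous_iff.1
    (CompactSpace.uniformContinuous_of_continuous hg) (ε / 2) (half_pos hε)
  obtain ⟨N, hN⟩ := exists_nat_one_div_lt hδ
  refine ⟨N, fun m hm => ?_⟩
  have hmono := monotone_grid hst (m + 1)
  have key := abs_stoppedSum_sub_le (g := g) (τ := τ) hmono (half_pos hε).le (m := m + 1) ?_
  · rw [grid_zero hst, grid_self hst (Nat.succ_ne_zero m)] at key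
    rw [Real.dist_eq]
    linarith
  · intro k _ u hu
    refine (Real.dist_eq _ _ ▸ (h ?_).le : _)
    rw [Subtype.dist_eq, Real.dist_eq, abs_of_nonneg (sub_nonneg.2 (show (u : ℝ) ≤ _ from hu.2))]
    have h1 := grid_sub_le hst (m + 1) k
    have h2 : (grid s t (m + 1) k : ℝ) ≤ u := hu.1
    have h3 : (1 : ℝ) / ((m + 1 : ℕ) : ℝ) ≤ 1 / (N + 1) := by
      have : (N : ℝ) ≤ m := by exact_mod_cast hm
      push_cast
      gcongr
    linarith

/-- This is the form in which an increment of the stopped path is recognised as a limit in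
`tendsto_stoppedSum`. -/
lemma stopPath_sub_eq {s t : I} (hr : r ≤ s) (hst : s ≤ t) :
    stopPath a b r x t - stopPath a b r x s =
      x (max (min (exitTime a b r x) t) s) - x s := by
  set τ := exitTime a b r x
  rw [stopPath, stopPath, excursion, excursion]
  rcases le_total τ s with h | h
  · rw [min_eq_left h, min_eq_left (h.trans hst), max_eq_right h]; ring
  · rw [min_eq_right h, max_eq_left hr, max_eq_left (le_min h hst),
      max_eq_left (hr.trans (le_min h hst))]; ring

end

section

/-! ### Stopped Brownian motion -/

variable {Ω : Type} {mΩ : MeasurableSpace Ω} {P : Measure Ω} {ℱ : Filtration I mΩ}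

/-- A real Brownian motion with respect to `ℱ`, with continuous paths bounded by a
square-integrable random variable `K`. -/
structure IsRealBrownian (P : Measure Ω) (ℱ : Filtration I mΩ) (w : I → Ω → ℝ) (K : Ω → ℝ) :
    Prop where
  adapted : ∀ t, Measurable[ℱ t] (w t)
  continuous : ∀ ω, Continuous fun t => w t ω
  bound : ∀ t ω, |w t ω| ≤ K ω
  memLp : MemLp K 2 P
  law : ∀ s t : I, s ≤ t →
    P.map (fun ω => w t ω - w s ω) = gaussianReal 0 (Real.toNNReal ((t : ℝ) - s))
  indep : ∀ s t : I, s ≤ t →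
    Indep (MeasurableSpace.comap (fun ω => w t ω - w s ω) inferInstance) (ℱ s) P

namespace IsRealBrownian

variable {w : I → Ω → ℝ} {K : Ω → ℝ} (hw : IsRealBrownian P ℱ w K)
include hw

lemma measurable (t : I) : Measurable (w t) := (hw.adapted t).mono (ℱ.le t) le_rfl

lemma integral_mul_sub {s t : I} (hst : s ≤ t) {h : Ω → ℝ} (hh : Measurable[ℱ s] h) :
    ∫ ω, h ω * (w t ω - w s ω) ∂P = 0 := by
  have hi : IndepFun (fun ω => w t ω - w s ω) h P := by
    rw [IndepFun_iff_Indep]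
    exact indep_of_indep_of_le_right (hw.indep s t hst) hh.comap_le
  have hm : Measurable fun ω => w t ω - w s ω := (hw.measurable t).sub (hw.measurable s)
  rw [hi.symm.integral_fun_mul_eq_mul_integral (hh.mono (ℱ.le s) le_rfl).aestronglyMeasurable
    hm.aestronglyMeasurable]
  have : ∫ ω, (w t ω - w s ω) ∂P = 0 := by
    have := integral_map (μ := P) (f := fun x : ℝ => x) hm.aemeasurable
      measurable_id.aestronglyMeasurable
    rw [← this, hw.law s t hst, integral_id_gaussianReal]
  rw [this, mul_zero]

lemma integral_mul_sub_sq {s t : I} (hst : s ≤ t) {h : Ω → ℝ} (hh : Measurable[ℱ s] h) :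
    ∫ ω, h ω * (w t ω - w s ω) ^ 2 ∂P = (∫ ω, h ω ∂P) * (t - s) := by
  have hm : Measurable fun ω => w t ω - w s ω := (hw.measurable t).sub (hw.measurable s)
  have hi : IndepFun (fun ω => (w t ω - w s ω) ^ 2) h P := by
    have : IndepFun (fun ω => w t ω - w s ω) h P := by
      rw [IndepFun_iff_Indep]
      exact indep_of_indep_of_le_right (hw.indep s t hst) hh.comap_le
    exact this.comp (measurable_id.pow_const 2) measurable_id
  rw [hi.symm.integral_fun_mul_eq_mul_integral (hh.mono (ℱ.le s) le_rfl).aestronglyMeasurable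
    (hm.pow_const 2).aestronglyMeasurable]
  have : ∫ ω, (w t ω - w s ω) ^ 2 ∂P = t - s := by
    have h1 := integral_map (μ := P) (f := fun x : ℝ => x ^ 2) hm.aemeasurable
      (measurable_id.pow_const 2).aestronglyMeasurable
    have h2 : (0 : ℝ) ≤ t - s := sub_nonneg.2 hst
    have h3 := variance_id_gaussianReal (μ := 0) (v := Real.toNNReal ((t : ℝ) - s))
    rw [variance_of_integral_eq_zero measurable_id.aemeasurable
      (by simp [integral_id_gaussianReal])] at h3
    rw [← h1, hw.law s t hst]
    simpa [h2] using h3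
  rw [this]

variable {a b : ℝ} {r : I}

lemma measurable_excursion (t : I) :
    Measurable[ℱ t] fun ω => excursion a r (fun s => w s ω) t := by
  rcases le_total t r with h | h
  · simp only [excursion_of_le h]
    exact measurable_const
  · simp only [excursion, max_eq_left h]
    exact measurable_const.add ((hw.adapted t).sub ((hw.adapted r).mono (ℱ.mono h) le_rfl))

/-- By compactness, a continuous path stays in the open interval throughout `[0, t]` exactly when it
stays in some closed interval `[1/(k+1), b - 1/(k+1)]`, and continuity reduces this to countably
many times. The excursion is frozen at `t` so that only information up to `t` is used. At `t = 1`
the event is empty. -/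
lemma measurableSet_lt_exitTime (t : I) :
    MeasurableSet[ℱ t] {ω | t < exitTime a b r fun s => w s ω} := by
  rcases eq_or_ne t 1 with rfl | ht
  · convert @MeasurableSet.empty _ (ℱ 1)
    ext ω
    simp [unitInterval.le_one']
  have ht1 : t < 1 := lt_of_le_of_ne unitInterval.le_one' ht
  let e (s : I) (ω : Ω) : ℝ := excursion a r (fun s => w s ω) (min s t)
  have he : ∀ s, Measurable[ℱ t] (e s) := fun s =>
    (hw.measurable_excursion (min s t)).mono (ℱ.mono (min_le_right _ _)) le_rfl
  have hc : ∀ ω, Continuous fun s => e s ω := fun ω =>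
    (continuous_excursion (hw.continuous ω)).comp (by fun_prop)
  have key : {ω | t < exitTime a b r fun s => w s ω} =
      ⋃ k : ℕ, ⋂ i : ℕ, e (TopologicalSpace.denseSeq I i) ⁻¹'
        Set.Icc (1 / ((k : ℝ) + 1)) (b - 1 / ((k : ℝ) + 1)) := by
    ext ω
    simp only [Set.mem_iUnion, Set.mem_iInter, Set.mem_preimage]
    constructor
    · intro h
      have h : t < exitTime a b r fun s => w s ω := h
      have hmem : ∀ s, e s ω ∈ Set.Ioo 0 b := fun s =>
        excursion_mem_of_lt_exitTime ((min_le_right _ _).trans_lt h)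
      obtain ⟨u, -, hu⟩ := isCompact_univ.exists_isMinOn Set.univ_nonempty (hc ω).continuousOn
      obtain ⟨v, -, hv⟩ := isCompact_univ.exists_isMaxOn Set.univ_nonempty (hc ω).continuousOn
      obtain ⟨k, hk⟩ := exists_nat_one_div_lt
        (lt_min (hmem u).1 (sub_pos.2 (hmem v).2) : 0 < min (e u ω) (b - e v ω))
      refine ⟨k, fun i => ⟨?_, ?_⟩⟩
      · exact (hk.le.trans (min_le_left _ _)).trans (hu (Set.mem_univ _))
      · have h1 : e (TopologicalSpace.denseSeq I i) ω ≤ e v ω := hv (Set.mem_univ _)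
        have h2 := hk.le.trans (min_le_right _ _)
        linarith
    · rintro ⟨k, hk⟩
      have hcl : IsClosed {s | e s ω ∈ Set.Icc (1 / ((k : ℝ) + 1)) (b - 1 / ((k : ℝ) + 1))} :=
        isClosed_Icc.preimage (hc ω)
      have hall : ∀ s, e s ω ∈ Set.Icc (1 / ((k : ℝ) + 1)) (b - 1 / ((k : ℝ) + 1)) := by
        intro s
        have : closure (Set.range (TopologicalSpace.denseSeq I)) ⊆
            {s | e s ω ∈ Set.Icc (1 / ((k : ℝ) + 1)) (b - 1 / ((k : ℝ) + 1))} :=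
          closure_minimal (Set.range_subset_iff.2 hk) hcl
        rw [(TopologicalSpace.denseRange_denseSeq I).closure_range] at this
        exact this (Set.mem_univ s)
      by_contra hlt
      have hlt : exitTime a b r (fun s => w s ω) ≤ t := not_lt.1 hlt
      refine excursion_exitTime_notMem (hw.continuous ω) (hlt.trans_lt ht1) ?_
      have h1 := hall (exitTime a b r fun s => w s ω)
      have hpos : (0 : ℝ) < 1 / ((k : ℝ) + 1) := by positivity
      simp only [e, min_eq_left hlt] at h1
      exact ⟨hpos.trans_le h1.1, by linarith [h1.2]⟩
  rw [key]
  exact MeasurableSet.iUnion fun k => MeasurableSet.iInter fun i => he _ measurableSet_Icc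

lemma measurable_stoppedSum {p : ℕ → I} (hp : Monotone p) (m : ℕ) :
    Measurable[ℱ (p m)] fun ω =>
      stoppedSum (fun s => w s ω) (exitTime a b r fun s => w s ω) p m := by
  unfold stoppedSum
  refine Finset.measurable_sum _ fun i hi => ?_
  have hi : i < m := Finset.mem_range.1 hi
  refine Measurable.ite (ℱ.mono (hp hi.le) _ (hw.measurableSet_lt_exitTime (p i))) ?_
    measurable_const
  exact ((hw.adapted _).mono (ℱ.mono (hp hi)) le_rfl).sub
    ((hw.adapted _).mono (ℱ.mono (hp hi.le)) le_rfl)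

/-- After time `r` the path is the pointwise limit of stopped sums over grids on `[r, t]`, each of
which is measurable at time `t`. -/
lemma measurable_stopPath (t : I) :
    Measurable[ℱ t] fun ω => stopPath a b r (fun s => w s ω) t := by
  rcases le_total t r with h | h
  · simp only [stopPath_of_le h]
    exact measurable_const
  · have h1 : ∀ ω, stopPath a b r (fun s => w s ω) t =
        a + (w (max (min (exitTime a b r fun s => w s ω) t) r) ω - w r ω) := fun ω => by
      have := stopPath_sub_eq (a := a) (b := b) (x := fun s => w s ω) le_rfl h
      rw [stopPath_of_le le_rfl] at this
      rw [← this]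
      ring
    simp only [h1]
    refine measurable_const.add ?_
    refine @measurable_of_tendsto_metrizable _ _ (ℱ t) _ _ _ _
      (fun m ω => stoppedSum (fun s => w s ω) (exitTime a b r fun s => w s ω) (grid r t (m + 1))
        (m + 1)) _ (fun m => ?_)
      (tendsto_pi_nhds.2 fun ω => tendsto_stoppedSum (hw.continuous ω) _ h)
    have := hw.measurable_stoppedSum (a := a) (b := b) (r := r) (monotone_grid h (m + 1)) (m + 1)
    rwa [grid_self h (Nat.succ_ne_zero m)] at this

lemma measurable_uncurry_stopPath :
    Measurable (Function.uncurry fun (t : I) ω => stopPath a b r (fun s => w s ω) t) :=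
  measurable_uncurry_of_continuous_of_measurable
    (fun ω => continuous_stopPath (hw.continuous ω))
    fun t => (hw.measurable_stopPath t).mono (ℱ.le t) le_rfl

lemma memLp_stoppedSum {p : ℕ → I} (hp : Monotone p) (m : ℕ) :
    MemLp (fun ω => stoppedSum (fun s => w s ω) (exitTime a b r fun s => w s ω) p m) 2 P := by
  refine (hw.memLp.const_mul 4).of_le
    ((hw.measurable_stoppedSum hp m).mono (ℱ.le _) le_rfl).aestronglyMeasurable
    (ae_of_all _ fun ω => ?_)
  rw [Real.norm_eq_abs, Real.norm_eq_abs]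
  exact (abs_stoppedSum_le (fun t => hw.bound t ω) _ hp m).trans (le_abs_self _)

lemma memLp_sub (s t : I) : MemLp (fun ω => w t ω - w s ω) 2 P := by
  have : ∀ t, MemLp (w t) 2 P := fun t =>
    hw.memLp.of_le (hw.measurable t).aestronglyMeasurable (ae_of_all _ fun ω => by
      rw [Real.norm_eq_abs, Real.norm_eq_abs]
      exact (hw.bound t ω).trans (le_abs_self _))
  exact (this t).sub (this s)

variable [IsProbabilityMeasure P]

/-- Optional stopping on a grid: whether `p k` precedes the exit time is known at time `p k`, so
each new increment is centred given the weight and the sum so far. The cross terms vanish, and each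
cell adds at most its length to the variance. The weight `h` is later the indicator of an event in
the past. -/
lemma integral_mul_stoppedSum {p : ℕ → I} (hp : Monotone p) {h : Ω → ℝ}
    (hh : Measurable[ℱ (p 0)] h) (h01 : ∀ ω, h ω ∈ Set.Icc (0 : ℝ) 1) (m : ℕ) :
    ∫ ω, h ω * stoppedSum (fun s => w s ω) (exitTime a b r fun s => w s ω) p m ∂P = 0 ∧
    ∫ ω, h ω * stoppedSum (fun s => w s ω) (exitTime a b r fun s => w s ω) p m ^ 2 ∂P ≤
      (∫ ω, h ω ∂P) * (p m - p 0) := by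
  classical
  induction m with
  | zero => simp [stoppedSum]
  | succ k ih =>
    set S : Ω → ℝ := fun ω => stoppedSum (fun s => w s ω) (exitTime a b r fun s => w s ω) p k
      with hS
    set j : Ω → ℝ := fun ω => if p k < exitTime a b r (fun s => w s ω) then 1 else 0 with hj
    set Δ : Ω → ℝ := fun ω => w (p (k + 1)) ω - w (p k) ω with hΔ
    have hsucc : ∀ ω, stoppedSum (fun s => w s ω) (exitTime a b r fun s => w s ω) p (k + 1) =
        S ω + j ω * Δ ω := fun ω => by
      simp only [hS, hj, hΔ, stoppedSum, Finset.sum_range_succ, ite_mul, one_mul, zero_mul]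
    have hk : p k ≤ p (k + 1) := hp (Nat.le_succ _)
    have hk' : (p k : ℝ) ≤ p (k + 1) := hk
    have hj01 : ∀ ω, j ω ∈ Set.Icc (0 : ℝ) 1 := fun ω => by
      simp only [hj]; split_ifs <;> simp
    have hjsq : ∀ ω, j ω * j ω = j ω := fun ω => by
      simp only [hj]; split_ifs <;> simp
    have hSm : Measurable[ℱ (p k)] S := hw.measurable_stoppedSum hp k
    have hjm : Measurable[ℱ (p k)] j :=
      Measurable.ite (hw.measurableSet_lt_exitTime (p k)) measurable_const measurable_const
    have hhm : Measurable[ℱ (p k)] h := hh.mono (ℱ.mono (hp (Nat.zero_le k))) le_rfl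
    have hS2 : MemLp S 2 P := hw.memLp_stoppedSum hp k
    have hΔ2 : MemLp Δ 2 P := hw.memLp_sub _ _
    have bdd : ∀ {f g : Ω → ℝ}, Measurable f → (∀ ω, f ω ∈ Set.Icc (0 : ℝ) 1) → Integrable g P →
        Integrable (fun ω => f ω * g ω) P := fun hf hf1 hg =>
      hg.bdd_mul hf.aestronglyMeasurable (c := 1) (ae_of_all _ fun ω => by
        rw [Real.norm_eq_abs, abs_le]
        exact ⟨by linarith [(hf1 ω).1], (hf1 ω).2⟩)
    have hhΩ : Measurable h := hhm.mono (ℱ.le _) le_rfl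
    have hjΩ : Measurable j := hjm.mono (ℱ.le _) le_rfl
    have hhj01 : ∀ ω, h ω * j ω ∈ Set.Icc (0 : ℝ) 1 := fun ω =>
      ⟨mul_nonneg (h01 ω).1 (hj01 ω).1, mul_le_one₀ (h01 ω).2 (hj01 ω).1 (hj01 ω).2⟩
    have i1 : Integrable (fun ω => h ω * S ω) P :=
      bdd hhΩ h01 (hS2.integrable one_le_two)
    have i2 : Integrable (fun ω => h ω * j ω * Δ ω) P :=
      bdd (hhΩ.mul hjΩ) hhj01 (hΔ2.integrable one_le_two)
    have i3 : Integrable (fun ω => h ω * S ω ^ 2) P := bdd hhΩ h01 hS2.integrable_sq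
    have i4 : Integrable (fun ω => h ω * j ω * Δ ω ^ 2) P :=
      bdd (hhΩ.mul hjΩ) hhj01 hΔ2.integrable_sq
    have i5 : Integrable (fun ω => 2 * (h ω * j ω * S ω * Δ ω)) P := by
      refine Integrable.const_mul ?_ 2
      have := bdd (hhΩ.mul hjΩ) hhj01 (hS2.integrable_mul hΔ2)
      simpa [mul_assoc] using this
    have e2 : ∫ ω, h ω * j ω * Δ ω ∂P = 0 := hw.integral_mul_sub hk (hhm.mul hjm)
    have e4 : ∫ ω, h ω * j ω * Δ ω ^ 2 ∂P = (∫ ω, h ω * j ω ∂P) * (p (k + 1) - p k) :=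
      hw.integral_mul_sub_sq hk (hhm.mul hjm)
    have e5 : ∫ ω, 2 * (h ω * j ω * S ω * Δ ω) ∂P = 0 := by
      have : ∫ ω, h ω * j ω * S ω * Δ ω ∂P = 0 :=
        hw.integral_mul_sub hk ((hhm.mul hjm).mul hSm)
      rw [integral_const_mul, this, mul_zero]
    simp only [hsucc]
    constructor
    · have : ∀ ω, h ω * (S ω + j ω * Δ ω) = h ω * S ω + h ω * j ω * Δ ω := fun ω => by ring
      simp only [this]
      rw [integral_add i1 i2, ih.1, e2, add_zero]
    · have : ∀ ω, h ω * (S ω + j ω * Δ ω) ^ 2 =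
          h ω * S ω ^ 2 + 2 * (h ω * j ω * S ω * Δ ω) + h ω * j ω * Δ ω ^ 2 := fun ω => by
        linear_combination (h ω * Δ ω ^ 2) * hjsq ω
      simp only [this]
      have i35 : Integrable (fun ω => h ω * S ω ^ 2 + 2 * (h ω * j ω * S ω * Δ ω)) P := i3.add i5
      rw [integral_add i35 i4, integral_add i3 i5, e4, e5, add_zero]
      have hle : ∫ ω, h ω * j ω ∂P ≤ ∫ ω, h ω ∂P := by
        have ih1 : Integrable h P := by
          simpa using bdd hhΩ h01 (integrable_const (1 : ℝ))
        refine integral_mono (bdd hhΩ h01 ?_) ih1 fun ω => ?_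
        · simpa using bdd hjΩ hj01 (integrable_const (1 : ℝ))
        · exact mul_le_of_le_one_right (h01 ω).1 (hj01 ω).2
      have := mul_le_mul_of_nonneg_right hle (sub_nonneg.2 hk')
      linarith [ih.2]

/-- Increments of the stopped path are centred, with conditional variance at most the elapsed
time. -/
lemma setIntegral_stopPath_sub {s t : I} (hst : s ≤ t) {A : Set Ω} (hA : MeasurableSet[ℱ s] A) :
    ∫ ω in A, (stopPath a b r (fun u => w u ω) t - stopPath a b r (fun u => w u ω) s) ∂P = 0 ∧
    ∫ ω in A, (stopPath a b r (fun u => w u ω) t - stopPath a b r (fun u => w u ω) s) ^ 2 ∂P ≤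
      (t - s) * P.real A := by
  -- The path is constant before `r`, so an increment started earlier equals the one started at `r`,
  -- and an event known at `s` is still known at `r`.
  wlog hr : r ≤ s generalizing s t
  · have hsr : s ≤ r := (not_le.1 hr).le
    rcases le_total t r with htr | hrt
    · have : (s : ℝ) ≤ t := hst
      simp only [stopPath_of_le htr, stopPath_of_le hsr, sub_self]
      simp only [integral_zero, ne_eq, OfNat.ofNat_ne_zero, not_false_eq_true, zero_pow, true_and]
      exact mul_nonneg (sub_nonneg.2 this) measureReal_nonneg
    · have := this hrt (ℱ.mono hsr _ hA) le_rfl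
      simp only [stopPath_of_le hsr]
      simp only [stopPath_of_le le_rfl] at this
      refine ⟨this.1, this.2.trans ?_⟩
      have h1 : (s : ℝ) ≤ r := hsr
      gcongr
  have hAΩ : MeasurableSet A := ℱ.le s _ hA
  set h : Ω → ℝ := A.indicator fun _ => 1 with hh
  have hhm : Measurable[ℱ s] h := (measurable_const (β := Ω)).indicator hA
  have h01 : ∀ ω, h ω ∈ Set.Icc (0 : ℝ) 1 := fun ω => by
    by_cases hω : ω ∈ A <;> simp [hh, hω]
  have hint : ∀ f : Ω → ℝ, ∫ ω in A, f ω ∂P = ∫ ω, h ω * f ω ∂P := fun f => by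
    rw [← integral_indicator hAΩ]
    congr 1 with ω
    by_cases hω : ω ∈ A <;> simp [hh, hω]
  have hhint : ∫ ω, h ω ∂P = P.real A := by
    rw [hh, integral_indicator hAΩ]; simp
  set S : ℕ → Ω → ℝ := fun m ω => stoppedSum (fun s => w s ω) (exitTime a b r fun s => w s ω)
    (grid s t (m + 1)) (m + 1) with hS
  have hSm : ∀ m, Measurable (S m) := fun m =>
    (hw.measurable_stoppedSum (monotone_grid hst _) _).mono (ℱ.le _) le_rfl
  have hSb : ∀ m ω, |S m ω| ≤ 4 * K ω := fun m ω =>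
    abs_stoppedSum_le (fun t => hw.bound t ω) _ (monotone_grid hst _) _
  have hlim : ∀ ω, Tendsto (fun m => S m ω) atTop
      (𝓝 (stopPath a b r (fun u => w u ω) t - stopPath a b r (fun u => w u ω) s)) := fun ω => by
    rw [stopPath_sub_eq hr hst]
    exact tendsto_stoppedSum (hw.continuous ω) _ hst
  have hhΩ : Measurable h := hhm.mono (ℱ.le _) le_rfl
  have hkey : ∀ m, _ := fun m => hw.integral_mul_stoppedSum (a := a) (b := b) (r := r)
    (p := grid s t (m + 1)) (monotone_grid hst _) (h := h) (by rwa [grid_zero hst]) h01 (m + 1)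
  simp only [grid_zero hst, grid_self hst (Nat.succ_ne_zero _)] at hkey
  have hhle : ∀ ω, |h ω| ≤ 1 := fun ω => abs_le.2 ⟨by linarith [(h01 ω).1], (h01 ω).2⟩
  rw [hint, hint]
  constructor
  · refine tendsto_nhds_unique (tendsto_integral_of_dominated_convergence (fun ω => 4 * K ω)
      (F := fun m ω => h ω * S m ω) (fun m => (hhΩ.mul (hSm m)).aestronglyMeasurable)
      ((hw.memLp.integrable one_le_two).const_mul 4) (fun m => ae_of_all _ fun ω => ?_)
      (ae_of_all _ fun ω => (hlim ω).const_mul _)) ?_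
    · rw [Real.norm_eq_abs, abs_mul]
      exact (mul_le_of_le_one_left (abs_nonneg _) (hhle ω)).trans (hSb m ω)
    · simp only [hS, (hkey _).1]
      exact tendsto_const_nhds
  · refine le_of_tendsto' (tendsto_integral_of_dominated_convergence (fun ω => 16 * K ω ^ 2)
      (F := fun m ω => h ω * S m ω ^ 2) (fun m => (hhΩ.mul ((hSm m).pow_const 2)).aestronglyMeasurable)
      (hw.memLp.integrable_sq.const_mul 16) (fun m => ae_of_all _ fun ω => ?_)
      (ae_of_all _ fun ω => ((hlim ω).pow 2).const_mul _)) fun m => ?_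
    · rw [Real.norm_eq_abs, abs_mul, abs_of_nonneg (sq_nonneg (S m ω))]
      refine (mul_le_of_le_one_left (sq_nonneg _) (hhle ω)).trans ?_
      have := pow_le_pow_left₀ (abs_nonneg _) (hSb m ω) 2
      rw [sq_abs] at this
      linarith
    · have := (hkey m).2
      rw [hhint, mul_comm] at this
      exact this

end IsRealBrownian

end

section

/-! ### Conditional increments -/

variable {Ω : Type} {mΩ : MeasurableSpace Ω} {P : Measure Ω} {ℱ : Filtration I mΩ}

lemma condExp_le_of_setIntegral_le [IsFiniteMeasure P] {m : MeasurableSpace Ω} (hm : m ≤ mΩ)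
    {f : Ω → ℝ} (hf : Integrable f P) {c : ℝ}
    (h : ∀ A, MeasurableSet[m] A → ∫ ω in A, f ω ∂P ≤ c * P.real A) :
    ∀ᵐ ω ∂P, (P[f | m]) ω ≤ c := by
  have hsm : StronglyMeasurable[m] (P[f | m]) := stronglyMeasurable_condExp
  refine ae_le_of_ae_le_trim (hm := hm) (f₂ := fun _ => c) ?_
  refine ae_le_of_forall_setIntegral_le (integrable_condExp.trim hm hsm) (integrable_const c) ?_
  intro A hA _
  rw [← setIntegral_trim hm hsm hA, setIntegral_condExp hm hf hA, setIntegral_const, smul_eq_mul,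
    measureReal_def, trim_measurableSet_eq hm hA, ← measureReal_def, mul_comm]
  exact h A hA

lemma hasBoundedIncrements_zero {F : Type} [NormedAddCommGroup F] [NormedSpace ℝ F]
    [CompleteSpace F] {C : ℝ} (hC : 0 ≤ C) :
    HasBoundedIncrements C P ℱ (fun _ _ => (0 : F)) where
  bound t := ae_of_all _ fun ω => by simpa using hC
  increment_mean s t hst := ae_of_all _ fun ω => by
    have h : (0 : ℝ) ≤ t - s := sub_nonneg.2 hst
    have : (fun _ : Ω => (0 : F) - 0) = 0 := by ext; simp
    rw [this, condExp_zero]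
    simpa using mul_nonneg hC h
  increment_sq s t hst := ae_of_all _ fun ω => by
    have h : (0 : ℝ) ≤ t - s := sub_nonneg.2 hst
    have : (fun _ : Ω => ‖(0 : F) - 0‖ ^ 2) = (0 : Ω → ℝ) := by ext; simp
    rw [this, condExp_zero]
    simpa using mul_nonneg hC h

namespace IsRealBrownian

variable {w : I → Ω → ℝ} {K : Ω → ℝ} [IsProbabilityMeasure P] (hw : IsRealBrownian P ℱ w K)
  {a b : ℝ} {r : I}
include hw

lemma memLp_stopPath (ha : a ∈ Set.Icc 0 b) (t : I) (q : ℝ≥0∞) :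
    MemLp (fun ω => stopPath a b r (fun u => w u ω) t) q P :=
  MemLp.of_bound ((hw.measurable_stopPath t).mono (ℱ.le t) le_rfl).aestronglyMeasurable b
    (ae_of_all _ fun ω => by
      have := stopPath_mem_Icc (r := r) (hw.continuous ω) ha t
      rw [Real.norm_eq_abs, abs_of_nonneg this.1]
      exact this.2)

/-- The stopped path is a martingale, so the conditional mean increment comes from `g` alone,
however small `b` is. For the squares, `(u + v)² ≤ 2u² + 2v²` and `(t - s)² ≤ t - s` on the unit
interval give the constant `2L² + 2`. -/
lemma hasBoundedIncrements (ha : a ∈ Set.Icc 0 b) {g : I → ℝ} {M L C : ℝ} (hM : ∀ t, |g t| ≤ M)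
    (hL : ∀ s t : I, s ≤ t → |g t - g s| ≤ L * ((t : ℝ) - s)) (hCb : M + b ≤ C) (hCL : L ≤ C)
    (hC2 : 2 * L ^ 2 + 2 ≤ C) :
    HasBoundedIncrements C P ℱ (fun t ω => g t + stopPath a b r (fun u => w u ω) t) := by
  set D : I → Ω → ℝ := fun t ω => stopPath a b r (fun u => w u ω) t with hD
  have hDint : ∀ t, Integrable (D t) P := fun t =>
    memLp_one_iff_integrable.1 (hw.memLp_stopPath ha t 1)
  have hD2 : ∀ s t, Integrable (fun ω => (D t ω - D s ω) ^ 2) P := fun s t =>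
    ((hw.memLp_stopPath ha t 2).sub (hw.memLp_stopPath ha s 2)).integrable_sq
  have hDm : ∀ t, Measurable (D t) := fun t => (hw.measurable_stopPath t).mono (ℱ.le t) le_rfl
  have hinc : ∀ s t, Integrable (fun ω => g t + D t ω - (g s + D s ω)) P := fun s t =>
    ((integrable_const (g t)).add (hDint t)).sub ((integrable_const (g s)).add (hDint s))
  refine ⟨fun t => ae_of_all _ fun ω => ?_, fun s t hst => ?_, fun s t hst => ?_⟩
  · have := stopPath_mem_Icc (r := r) (hw.continuous ω) ha t
    rw [Real.norm_eq_abs]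
    refine (abs_add_le _ _).trans ?_
    rw [abs_of_nonneg this.1]
    linarith [hM t, this.2]
  · have h0 : (0 : ℝ) ≤ t - s := sub_nonneg.2 hst
    have hset : ∀ A, MeasurableSet[ℱ s] A →
        ∫ ω in A, (g t + D t ω - (g s + D s ω)) ∂P = (g t - g s) * P.real A := fun A hA => by
      have e : ∀ ω, g t + D t ω - (g s + D s ω) = (g t - g s) + (D t ω - D s ω) := fun ω => by ring
      simp only [e]
      have h1 : Integrable (fun ω => D t ω - D s ω) P := (hDint t).sub (hDint s)
      rw [integral_add (integrable_const _) h1.integrableOn,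
        (hw.setIntegral_stopPath_sub hst hA).1, setIntegral_const, smul_eq_mul]
      ring
    have hgl := abs_le.1 (hL s t hst)
    have hLC : L * ((t : ℝ) - s) ≤ C * ((t : ℝ) - s) := mul_le_mul_of_nonneg_right hCL h0
    have h1 := condExp_le_of_setIntegral_le (ℱ.le s) (hinc s t) (c := C * ((t : ℝ) - s))
      fun A hA => by
        rw [hset A hA]
        exact mul_le_mul_of_nonneg_right (hgl.2.trans hLC) measureReal_nonneg
    have h2 := condExp_le_of_setIntegral_le (ℱ.le s) (hinc s t).neg (c := C * ((t : ℝ) - s))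
      fun A hA => by
        simp only [Pi.neg_apply]
        rw [integral_neg, hset A hA, ← neg_mul]
        exact mul_le_mul_of_nonneg_right (by linarith) measureReal_nonneg
    have h3 := condExp_neg (μ := P) (fun ω => g t + D t ω - (g s + D s ω)) (ℱ s)
    filter_upwards [h1, h2, h3] with ω h1 h2 h3
    rw [h3, Pi.neg_apply] at h2
    rw [Real.norm_eq_abs, abs_le]
    exact ⟨by linarith, h1⟩
  · have h0 : (0 : ℝ) ≤ t - s := sub_nonneg.2 hst
    have h1 : (t : ℝ) - s ≤ 1 := by linarith [t.2.2, s.2.1]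
    have hbd : ∀ ω, ‖g t + D t ω - (g s + D s ω)‖ ^ 2 ≤
        2 * L ^ 2 * (t - s) + 2 * (D t ω - D s ω) ^ 2 := fun ω => by
      have e1 : (g t - g s) ^ 2 ≤ L ^ 2 * (t - s) := by
        have h2 := pow_le_pow_left₀ (abs_nonneg _) (hL s t hst) 2
        rw [sq_abs] at h2
        have h3 : ((t : ℝ) - s) ^ 2 ≤ t - s := by nlinarith
        calc (g t - g s) ^ 2 ≤ (L * (t - s)) ^ 2 := h2
          _ = L ^ 2 * (t - s) ^ 2 := by ring
          _ ≤ _ := mul_le_mul_of_nonneg_left h3 (sq_nonneg _)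
      rw [Real.norm_eq_abs, sq_abs]
      nlinarith [sq_nonneg ((g t - g s) - (D t ω - D s ω))]
    have hint : Integrable (fun ω => ‖g t + D t ω - (g s + D s ω)‖ ^ 2) P := by
      refine Integrable.mono' ((integrable_const (2 * L ^ 2 * ((t : ℝ) - s))).add
        ((hD2 s t).const_mul 2)) (by fun_prop) (ae_of_all _ fun ω => ?_)
      rw [Real.norm_eq_abs, abs_of_nonneg (by positivity)]
      exact hbd ω
    refine condExp_le_of_setIntegral_le (ℱ.le s) hint fun A hA => ?_
    calc ∫ ω in A, ‖g t + D t ω - (g s + D s ω)‖ ^ 2 ∂P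
        ≤ ∫ ω in A, (2 * L ^ 2 * (t - s) + 2 * (D t ω - D s ω) ^ 2) ∂P :=
          integral_mono hint.integrableOn
            ((integrable_const _).add ((hD2 s t).const_mul 2).integrableOn) hbd
      _ = 2 * L ^ 2 * (t - s) * P.real A + 2 * ∫ ω in A, (D t ω - D s ω) ^ 2 ∂P := by
          have e := integral_const_mul (μ := P.restrict A) 2 fun ω => (D t ω - D s ω) ^ 2
          rw [integral_add (integrable_const _) ((hD2 s t).const_mul 2).integrableOn, e,
            setIntegral_const, smul_eq_mul, mul_comm (P.real A)]
      _ ≤ 2 * L ^ 2 * (t - s) * P.real A + 2 * ((t - s) * P.real A) := by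
          gcongr
          exact (hw.setIntegral_stopPath_sub hst hA).2
      _ = (2 * L ^ 2 + 2) * (t - s) * P.real A := by ring
      _ ≤ C * (t - s) * P.real A := by gcongr

end IsRealBrownian

end

section

/-! ### Itô representations -/

variable {Ω : Type} {mΩ : MeasurableSpace Ω} {P : Measure Ω} {ℱ : Filtration I mΩ}

lemma measurable_fst_predictable : Measurable[ℱ.predictable] (Prod.fst : I × Ω → I) := by
  refine @measurable_of_Ioi _ _ _ _ _ ℱ.predictable _ _ _ _ fun t => ?_
  have : (Prod.fst : I × Ω → I) ⁻¹' Set.Ioi t = Set.Ioi t ×ˢ Set.univ := by ext; simp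
  rw [this]
  exact measurableSet_predictable_Ioi_prod MeasurableSet.univ

lemma isStronglyPredictable_of_continuous {g : I → ℝ} (hg : Continuous g) :
    IsStronglyPredictable ℱ (fun t (_ : Ω) => g t) := by
  have h : StronglyMeasurable[ℱ.predictable] (fun z : I × Ω => g z.1) :=
    hg.stronglyMeasurable.comp_measurable measurable_fst_predictable
  exact h

/-- The complement `{t > τ}` is a countable union over dense times `s` of the predictable rectangles
`(s, 1] × {τ ≤ s}`. -/
lemma measurableSet_predictable_le {τ : Ω → I} (hτ : ∀ t, MeasurableSet[ℱ t] {ω | t < τ ω}) :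
    MeasurableSet[ℱ.predictable] {z : I × Ω | z.1 ≤ τ z.2} := by
  have : {z : I × Ω | z.1 ≤ τ z.2} = (⋃ i : ℕ, Set.Ioi (TopologicalSpace.denseSeq I i) ×ˢ
      {ω | TopologicalSpace.denseSeq I i < τ ω}ᶜ)ᶜ := by
    ext ⟨t, ω⟩
    simp only [Set.mem_compl_iff, Set.mem_iUnion, Set.mem_prod, Set.mem_Ioi, not_exists, not_and,
      not_not]
    constructor
    · intro h i hi
      exact hi.trans_le h
    · intro h
      by_contra hlt
      obtain ⟨_, ⟨i, rfl⟩, h1, h2⟩ :=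
        (TopologicalSpace.denseRange_denseSeq I).exists_between (not_le.1 hlt)
      exact absurd (h i h2) (not_lt.2 h1.le)
  rw [this]
  exact (MeasurableSet.iUnion fun i => measurableSet_predictable_Ioi_prod (hτ _).compl).compl

/-- A simple process with left-continuous paths approximates the indicator of `(p 0, τ]`. -/
lemma abs_sum_indicator_sub_le {p : ℕ → I} (hp : Monotone p) {δ : ℝ}
    (hδ : ∀ k, (p (k + 1) : ℝ) - p k ≤ δ) {m : ℕ} {t : I} (ht : t ≤ p m) (τ : I) :
    |(∑ i : Fin m, (Set.Ioc (p i) (p (i + 1))).indicator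
        (fun _ => (Set.Iio τ).indicator (fun _ => (1 : ℝ)) (p i)) t) -
      (Set.Ioc (p 0) τ).indicator (fun _ => (1 : ℝ)) t| ≤
    (Set.Ioc (τ : ℝ) (τ + δ)).indicator (fun _ => (1 : ℝ)) (t : ℝ) := by
  rw [Fin.sum_univ_eq_sum_range fun i => (Set.Ioc (p i) (p (i + 1))).indicator
        (fun _ => (Set.Iio τ).indicator (fun _ => (1 : ℝ)) (p i)) t]
  rcases le_or_gt t (p 0) with h0 | h0
  · rw [Finset.sum_eq_zero, Set.indicator_of_notMem (by simp [h0.not_gt])]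
    · simp only [sub_self, abs_zero]
      exact Set.indicator_nonneg (fun _ _ => zero_le_one) _
    · intro i _
      exact Set.indicator_of_notMem (fun h => (h0.trans (hp (Nat.zero_le i))).not_gt h.1) _
  · have hex : ∃ i < m, t ∈ Set.Ioc (p i) (p (i + 1)) := by
      clear hδ
      induction m with
      | zero => exact absurd h0 ht.not_gt
      | succ k ih =>
        rcases le_or_gt t (p k) with h | h
        · obtain ⟨i, hi, hit⟩ := ih h
          exact ⟨i, by omega, hit⟩
        · exact ⟨k, by omega, h, ht⟩
    obtain ⟨i, hi, hit⟩ := hex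
    rw [Finset.sum_eq_single i, Set.indicator_of_mem hit]
    · have h1 : (p i : ℝ) < t := hit.1
      have h2 : (t : ℝ) ≤ p (i + 1) := hit.2
      rcases le_or_gt τ (p i) with h | h
      · rw [Set.indicator_of_notMem (by simp [h]), Set.indicator_of_notMem]
        · simp only [sub_self, abs_zero]
          exact Set.indicator_nonneg (fun _ _ => zero_le_one) _
        · exact fun h3 => (h.trans_lt hit.1).not_ge h3.2
      · have h' : (p i : ℝ) < τ := h
        rw [Set.indicator_of_mem (show p i ∈ Set.Iio τ from h)]
        rcases le_or_gt t τ with h3 | h3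
        · rw [Set.indicator_of_mem (show t ∈ Set.Ioc (p 0) τ from ⟨h0, h3⟩)]
          simp only [sub_self, abs_zero]
          exact Set.indicator_nonneg (fun _ _ => zero_le_one) _
        · have h3' : (τ : ℝ) < t := h3
          rw [Set.indicator_of_notMem (fun h4 => h3.not_ge h4.2), Set.indicator_of_mem]
          · simp
          · exact ⟨h3', by linarith [hδ i]⟩
    · intro j _ hji
      refine Set.indicator_of_notMem (fun hjt => ?_) _
      rcases lt_or_gt_of_ne hji with h | h
      · exact (hjt.2.trans (hp (Nat.succ_le_of_lt h))).not_gt hit.1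
      · exact (hit.2.trans (hp (Nat.succ_le_of_lt h))).not_gt hjt.1
    · intro h
      exact absurd (Finset.mem_range.2 hi) h

lemma lintegral_indicator_coe_le (u δ : ℝ) :
    ∫⁻ t : I, (Set.Ioc u (u + δ)).indicator (fun _ => (1 : ℝ≥0∞)) (t : ℝ) ≤ ENNReal.ofReal δ := by
  have h := unitInterval.measurePreserving_coe.lintegral_comp
    (f := (Set.Ioc u (u + δ)).indicator fun _ => (1 : ℝ≥0∞))
    (measurable_const.indicator measurableSet_Ioc)
  rw [h, lintegral_indicator measurableSet_Ioc, setLIntegral_one]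
  refine (Measure.restrict_apply_le _ _).trans ?_
  simp

lemma tendsto_eLpNorm_two_of_dominated {X : ℕ → Ω → ℝ} {S : Ω → ℝ}
    (hX : ∀ n, AEStronglyMeasurable (X n) P) (hS : MemLp S 2 P)
    (hb : ∀ n, ∀ᵐ ω ∂P, |X n ω| ≤ S ω)
    (hlim : ∀ᵐ ω ∂P, Tendsto (fun n => X n ω) atTop (𝓝 0)) :
    Tendsto (fun n => eLpNorm (X n) 2 P) atTop (𝓝 0) := by
  have h := tendsto_integral_sq_of_dominated (Y := fun _ => 0) hX hS hb hlim
  have hmem : ∀ n, MemLp (X n) 2 P := fun n => hS.of_le (hX n) ((hb n).mono fun ω hω =>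
    hω.trans (le_abs_self _))
  have e : ∀ n, eLpNorm (X n) 2 P = ENNReal.ofReal ((∫ ω, X n ω ^ 2 ∂P) ^ (2⁻¹ : ℝ)) := fun n => by
    rw [(hmem n).eLpNorm_eq_integral_rpow_norm two_ne_zero ENNReal.ofNat_ne_top]
    simp
  simp only [e]
  rw [show (0 : ℝ≥0∞) = ENNReal.ofReal ((∫ ω, (0 : ℝ) ^ 2 ∂P) ^ (2⁻¹ : ℝ)) by simp]
  exact ENNReal.tendsto_ofReal (h.rpow_const (Or.inr (by norm_num)))

lemma setIntegral_Iic_derivWithin {g : ℝ → ℝ} (hg : ContDiffOn ℝ 1 g (Set.Icc 0 1)) (t : I) :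
    ∫ s in Set.Iic t, derivWithin g (Set.Icc 0 1) (s : ℝ) = g t - g 0 := by
  have hd : ContinuousOn (derivWithin g (Set.Icc 0 1)) (Set.Icc 0 1) :=
    hg.continuousOn_derivWithin (uniqueDiffOn_Icc zero_lt_one) le_rfl
  have hsub : Set.Icc (0 : ℝ) t ⊆ Set.Icc 0 1 := Set.Icc_subset_Icc_right t.2.2
  have h1 := unitInterval.measurePreserving_coe.setIntegral_preimage_emb
    (MeasurableEmbedding.subtype_coe measurableSet_Icc) (derivWithin g (Set.Icc 0 1))
    (Set.Iic (t : ℝ))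
  have h2 : ((↑) : I → ℝ) ⁻¹' Set.Iic (t : ℝ) = Set.Iic t := rfl
  rw [h2, Measure.restrict_restrict measurableSet_Iic] at h1
  have h3 : Set.Iic (t : ℝ) ∩ I = Set.Icc 0 (t : ℝ) := by
    ext x
    simp only [Set.mem_inter_iff, Set.mem_Iic, Set.mem_Icc]
    have := t.2.2
    constructor
    · rintro ⟨h, h', -⟩; exact ⟨h', h⟩
    · rintro ⟨h, h'⟩; exact ⟨h', h, h'.trans this⟩
  rw [h1, h3, integral_Icc_eq_integral_Ioc, ← intervalIntegral.integral_of_le t.2.1]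
  refine intervalIntegral.integral_eq_sub_of_hasDerivAt_of_le t.2.1 (hg.continuousOn.mono hsub)
    (fun x hx => ?_) ?_
  · have hx1 : x ∈ Set.Ioo (0 : ℝ) 1 := ⟨hx.1, hx.2.trans_le t.2.2⟩
    exact ((hg.differentiableOn one_ne_zero x (Set.Ioo_subset_Icc_self hx1)).hasDerivWithinAt).hasDerivAt
      (Icc_mem_nhds hx1.1 hx1.2)
  · refine ContinuousOn.intervalIntegrable ?_
    rw [Set.uIcc_of_le t.2.1]
    exact hd.mono hsub

variable {d : ℕ} {B : I → Ω → EuclideanSpace ℝ (Fin d)}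

lemma isItoIntegral_zero : IsItoIntegral P ℱ B (fun _ _ => 0) (fun _ _ => 0) := by
  refine ⟨ae_of_all _ fun _ => continuous_const, fun _ => aestronglyMeasurable_const,
    fun _ => ⟨0, Fin.elim0, Fin.elim0, fun i => i.elim0, Fin.elim0, fun i => i.elim0,
      fun i => i.elim0⟩, ?_, fun t => ?_⟩
  · simp [SimpleProcess.eval]
  · simp [SimpleProcess.integral]

lemma isItoSemimartingale_zero {C : ℝ} (hC : 0 ≤ C) (ν : Ω → Measure (ℝ × I)) :
    IsItoSemimartingale C P ℱ B ν (fun _ _ => 0) :=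
  ⟨fun _ _ => 0, fun _ _ => 0, fun _ _ _ => 0, fun _ _ => 0, stronglyMeasurable_const,
    stronglyMeasurable_const, measurable_const, ae_of_all _ fun _ _ => by simpa using hC,
    isItoIntegral_zero, ae_of_all _ fun _ _ => by simp⟩

namespace IsRealBrownian

variable [IsProbabilityMeasure P] {w : I → Ω → ℝ} {K : Ω → ℝ} (hw : IsRealBrownian P ℱ w K) {a b : ℝ} {r : I}
include hw

/-- The integrand is the indicator of `(r, τ]` in direction `i₀`. The simple processes test `p i <
τ` at the left end of each cell, hence differ from it only within one mesh length after `τ`. Their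
integrals are the stopped sums of the path frozen at `t`, which converge to the stopped path. -/
lemma isItoIntegral_stopPath {i₀ : Fin d} (hB : ∀ t ω, B t ω i₀ = w t ω) :
    IsItoIntegral P ℱ B
      (fun t ω => (Set.Ioc r (exitTime a b r fun u => w u ω)).indicator
        (fun _ => EuclideanSpace.single i₀ (1 : ℝ)) t)
      (fun t ω => stopPath a b r (fun u => w u ω) t - a) := by
  set τ : Ω → I := fun ω => exitTime a b r fun u => w u ω with hτ
  refine ⟨ae_of_all _ fun ω => (continuous_stopPath (hw.continuous ω)).sub continuous_const,
    fun t => (((hw.measurable_stopPath t).mono (ℱ.le t) le_rfl).sub_const a).aestronglyMeasurable,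
    ?_⟩
  have hr1 : r ≤ 1 := unitInterval.le_one'
  let p (k : ℕ) : ℕ → I := grid r 1 (k + 1)
  have hp : ∀ k, Monotone (p k) := fun k => monotone_grid hr1 _
  have hp0 : ∀ k, p k 0 = r := fun k => grid_zero hr1 _
  have hp1 : ∀ k, p k (k + 1) = 1 := fun k => grid_self hr1 (Nat.succ_ne_zero k)
  let H (k : ℕ) : SimpleProcess ℱ d :=
    { N := k + 1
      s := fun i => p k i
      u := fun i => p k (i + 1)
      s_le_u := fun i => hp k (Nat.le_succ _)
      ξ := fun i ω => (Set.Iio (τ ω)).indicator (fun _ => EuclideanSpace.single i₀ (1 : ℝ)) (p k i)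
      ξ_measurable := fun i => by
        classical
        have : (fun ω => (Set.Iio (τ ω)).indicator
            (fun _ => EuclideanSpace.single i₀ (1 : ℝ)) (p k i)) =
            fun ω => if p k i < τ ω then EuclideanSpace.single i₀ (1 : ℝ) else 0 := by
          ext ω : 1
          simp [Set.indicator_apply]
        rw [this]
        exact Measurable.ite (hw.measurableSet_lt_exitTime _) measurable_const measurable_const
      ξ_bounded := fun i => ⟨1, fun ω => by
        refine (norm_indicator_le_norm_self _ _).trans ?_
        simp⟩ }
  refine ⟨H, ?_, fun t => ?_⟩
  · have hbd : ∀ k ω t, ‖(H k).eval t ω - (Set.Ioc r (τ ω)).indicator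
        (fun _ => EuclideanSpace.single i₀ (1 : ℝ)) t‖ₑ ^ 2 ≤
        (Set.Ioc (τ ω : ℝ) (τ ω + 1 / ((k + 1 : ℕ) : ℝ))).indicator (fun _ => (1 : ℝ≥0∞)) (t : ℝ) := by
      intro k ω t
      have h1 := abs_sum_indicator_sub_le (hp k) (δ := 1 / ((k + 1 : ℕ) : ℝ))
        (fun i => grid_sub_le hr1 (k + 1) i) (m := k + 1) (t := t)
        (by rw [hp1]; exact unitInterval.le_one') (τ ω)
      rw [hp0] at h1
      have h2 : (H k).eval t ω - (Set.Ioc r (τ ω)).indicator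
          (fun _ => EuclideanSpace.single i₀ (1 : ℝ)) t =
          ((∑ i : Fin (k + 1), (Set.Ioc (p k i) (p k (i + 1))).indicator
            (fun _ => (Set.Iio (τ ω)).indicator (fun _ => (1 : ℝ)) (p k i)) t) -
          (Set.Ioc r (τ ω)).indicator (fun _ => (1 : ℝ)) t) • EuclideanSpace.single i₀ (1 : ℝ) := by
        rw [sub_smul, Finset.sum_smul, SimpleProcess.eval]
        congr 1
        · refine Finset.sum_congr rfl fun i _ => ?_
          simp only [H, Set.indicator_apply, ite_smul, one_smul, zero_smul]
        · simp only [Set.indicator_apply, ite_smul, one_smul, zero_smul]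
      rw [h2, enorm_smul]
      have h3 : ‖EuclideanSpace.single i₀ (1 : ℝ)‖ₑ = 1 := by
        rw [← ofReal_norm]; simp
      rw [h3, mul_one]
      by_cases ht : (t : ℝ) ∈ Set.Ioc (τ ω : ℝ) (τ ω + 1 / ((k + 1 : ℕ) : ℝ))
      · rw [Set.indicator_of_mem ht] at h1 ⊢
        refine pow_le_one₀ zero_le ?_
        rw [← ofReal_norm, Real.norm_eq_abs]
        exact ENNReal.ofReal_le_one.2 h1
      · rw [Set.indicator_of_notMem ht] at h1 ⊢
        rw [abs_nonpos_iff.1 h1]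
        simp
    have hle : ∀ k, ∫⁻ ω, ∫⁻ t : I, ‖(H k).eval t ω - (Set.Ioc r (τ ω)).indicator
        (fun _ => EuclideanSpace.single i₀ (1 : ℝ)) t‖ₑ ^ 2 ∂volume ∂P ≤
        ENNReal.ofReal (1 / ((k + 1 : ℕ) : ℝ)) * P Set.univ := fun k => by
      rw [← lintegral_const]
      exact lintegral_mono fun ω => (lintegral_mono (hbd k ω)).trans (lintegral_indicator_coe_le _ _)
    have hlim : Tendsto (fun k : ℕ => ENNReal.ofReal (1 / ((k + 1 : ℕ) : ℝ)) * P Set.univ) atTop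
        (𝓝 0) := by
      have h := ENNReal.tendsto_ofReal (tendsto_one_div_add_atTop_nhds_zero_nat (𝕜 := ℝ))
      simpa using h
    exact tendsto_of_tendsto_of_tendsto_of_le_of_le tendsto_const_nhds hlim (fun _ => zero_le) hle
  · have hint : ∀ k ω, (H k).integral B t ω =
        stoppedSum (fun s => w (min s t) ω) (τ ω) (p k) (k + 1) := fun k ω => by
      rw [SimpleProcess.integral, stoppedSum, Finset.sum_range]
      refine Finset.sum_congr rfl fun i _ => ?_
      simp only [H, Set.indicator_apply, Set.mem_Iio]
      split_ifs
      · rw [EuclideanSpace.inner_single_left]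
        simp [hB]
      · simp
    have hg : ∀ ω, Continuous fun s => w (min s t) ω := fun ω =>
      (hw.continuous ω).comp (by fun_prop)
    have hZ : ∀ ω, stopPath a b r (fun u => w u ω) t - a =
        w (min (max (min (τ ω) 1) r) t) ω - w (min r t) ω := fun ω => by
      have h1 : min (τ ω) 1 = τ ω := min_eq_left unitInterval.le_one'
      rw [h1]
      rcases le_total t r with h | h
      · rw [stopPath_of_le h, min_eq_right h, min_eq_right (h.trans (le_max_right _ _))]
        ring
      · have := stopPath_sub_eq (a := a) (b := b) (x := fun s => w s ω) le_rfl h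
        rw [stopPath_of_le le_rfl] at this
        rw [this, min_eq_left h, min_max_distrib_right, min_eq_left h]
    have hZb : ∀ ω, |stopPath a b r (fun u => w u ω) t - a| ≤ 2 * K ω := fun ω => by
      rw [hZ]
      refine (abs_sub _ _).trans ?_
      linarith [hw.bound (min (max (min (τ ω) 1) r) t) ω, hw.bound (min r t) ω]
    have hmeas : ∀ k, Measurable fun ω => (H k).integral B t ω := fun k => by
      classical
      simp only [hint, stoppedSum]
      refine Finset.measurable_sum _ fun i _ => ?_
      exact Measurable.ite (ℱ.le _ _ (hw.measurableSet_lt_exitTime _))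
        ((hw.measurable _).sub (hw.measurable _)) measurable_const
    refine tendsto_eLpNorm_two_of_dominated (S := fun ω => 6 * K ω)
      (fun k => ((hmeas k).sub (((hw.measurable_stopPath t).mono (ℱ.le t) le_rfl).sub_const
        a)).aestronglyMeasurable) (hw.memLp.const_mul 6) (fun k => ae_of_all _ fun ω => ?_)
      (ae_of_all _ fun ω => ?_)
    · refine (abs_sub _ _).trans ?_
      have h1 := abs_stoppedSum_le (g := fun s => w (min s t) ω) (fun s => hw.bound (min s t) ω)
        (τ ω) (hp k) (k + 1)
      rw [hint]
      linarith [hZb ω]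
    · have h1 := tendsto_stoppedSum (hg ω) (τ ω) hr1
      have h2 := h1.sub_const (stopPath a b r (fun u => w u ω) t - a)
      rw [hZ ω, sub_self] at h2
      simp only [hint, hZ ω]
      exact h2

/-- Drift `g'`, diffusion coefficient the indicator of `(r, τ]`, and no jumps: all characteristics
are bounded independently of `a`, `b` and `r`. -/
lemma isItoSemimartingale {i₀ : Fin d} (hB : ∀ t ω, B t ω i₀ = w t ω) {g : ℝ → ℝ}
    (hg : ContDiffOn ℝ 1 g (Set.Icc 0 1)) {C : ℝ}
    (hgC : ∀ t ∈ Set.Icc (0 : ℝ) 1, |derivWithin g (Set.Icc 0 1) t| ≤ C) (hC : 1 ≤ C)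
    (ν : Ω → Measure (ℝ × I)) :
    IsItoSemimartingale C P ℱ B ν (fun t ω => g t + stopPath a b r (fun u => w u ω) t) := by
  refine ⟨fun t _ => derivWithin g (Set.Icc 0 1) t, _, fun _ _ _ => 0, _, ?_, ?_, measurable_const,
    ae_of_all _ fun ω t => ⟨hgC t t.2, ?_, ?_⟩, hw.isItoIntegral_stopPath (a := a) (b := b) (r := r) hB,
    ae_of_all _ fun ω t => ?_⟩
  · exact isStronglyPredictable_of_continuous (continuousOn_iff_continuous_domRestrict.1
      (hg.continuousOn_derivWithin (uniqueDiffOn_Icc zero_lt_one) le_rfl))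
  · have h1 : MeasurableSet[ℱ.predictable]
        {z : I × Ω | z.1 ∈ Set.Ioc r (exitTime a b r fun u => w u z.2)} := by
      have h2 : MeasurableSet[ℱ.predictable] ((Prod.fst : I × Ω → I) ⁻¹' Set.Ioi r) :=
        measurable_fst_predictable measurableSet_Ioi
      exact h2.inter (measurableSet_predictable_le hw.measurableSet_lt_exitTime)
    exact (@stronglyMeasurable_const _ _ ℱ.predictable _
      (EuclideanSpace.single i₀ (1 : ℝ))).indicator h1
  · refine (norm_indicator_le_norm_self _ _).trans ?_
    simpa using hC
  · simp
  · rw [setIntegral_Iic_derivWithin hg]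
    simp only [stopPath_of_le (show (0 : I) ≤ r from unitInterval.nonneg'), integral_zero,
      Set.Icc.coe_zero]
    ring

end IsRealBrownian

end

section

/-! ### Gaussian shifts -/

/-- The likelihood ratio of a shift by `x` of standard Gaussian noise. -/
def shiftDensity {n : ℕ} (x g : Fin n → ℝ) : ℝ := ∏ i, Real.exp (x i * g i - x i ^ 2 / 2)

lemma gaussianReal_eq_withDensity (x : ℝ) :
    gaussianReal x 1 =
      (gaussianReal 0 1).withDensity fun g => ENNReal.ofReal (Real.exp (x * g - x ^ 2 / 2)) := by
  rw [gaussianReal_of_var_ne_zero _ one_ne_zero, gaussianReal_of_var_ne_zero _ one_ne_zero,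
    ← withDensity_mul _ (measurable_gaussianPDF _ _) (by fun_prop)]
  congr 1 with g
  rw [Pi.mul_apply, gaussianPDF, gaussianPDF, ← ENNReal.ofReal_mul (gaussianPDFReal_nonneg _ _ _),
    gaussianPDFReal, gaussianPDFReal, mul_assoc _ (Real.exp _), ← Real.exp_add]
  congr 3
  simp only [NNReal.coe_one]
  ring

variable {n : ℕ}

lemma measurable_shiftDensity (x : Fin n → ℝ) : Measurable (shiftDensity x) := by
  unfold shiftDensity
  fun_prop

lemma pi_gaussianReal_eq_withDensity (x : Fin n → ℝ) :
    (Measure.pi fun i => gaussianReal (x i) 1) =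
      (noiseMeasure n).withDensity fun g => ENNReal.ofReal (shiftDensity x g) := by
  refine Measure.pi_eq fun s hs => ?_
  let f (i : Fin n) (y : ℝ) : ℝ≥0∞ :=
    (s i).indicator (fun y => ENNReal.ofReal (Real.exp (x i * y - x i ^ 2 / 2))) y
  have hf : ∀ i, Measurable (f i) := fun i => Measurable.indicator (by fun_prop) (hs i)
  have h : iIndepFun (fun i (g : Fin n → ℝ) => f i (g i)) (noiseMeasure n) :=
    iIndepFun_pi fun i => (hf i).aemeasurable
  have e := lintegral_prod_eq_prod_lintegral_of_indepFun Finset.univ _ h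
    fun i => (hf i).comp (measurable_pi_apply i)
  rw [withDensity_apply _ (MeasurableSet.univ_pi hs),
    ← lintegral_indicator (MeasurableSet.univ_pi hs)]
  have e1 : ∀ g : Fin n → ℝ, (Set.univ.pi s).indicator
      (fun g => ENNReal.ofReal (shiftDensity x g)) g = ∏ i, f i (g i) := fun g => by
    by_cases hg : g ∈ Set.univ.pi s
    · rw [Set.indicator_of_mem hg, shiftDensity,
        ENNReal.ofReal_prod_of_nonneg fun _ _ => (Real.exp_pos _).le]
      refine Finset.prod_congr rfl fun i _ => ?_
      simp only [f]
      rw [Set.indicator_of_mem (hg i (Set.mem_univ i))]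
    · rw [Set.indicator_of_notMem hg]
      obtain ⟨i, hi⟩ : ∃ i, g i ∉ s i := by simpa using hg
      exact (Finset.prod_eq_zero (Finset.mem_univ i) (Set.indicator_of_notMem hi _)).symm
  simp only [e1]
  rw [e]
  refine Finset.prod_congr rfl fun i _ => ?_
  have e2 := (measurePreserving_eval (fun _ : Fin n => gaussianReal 0 1) i).lintegral_comp (hf i)
  rw [gaussianReal_eq_withDensity, withDensity_apply _ (hs i), ← lintegral_indicator (hs i)]
  exact e2

lemma map_add_noiseMeasure (x : Fin n → ℝ) :
    (noiseMeasure n).map (fun g => g + x) =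
      (noiseMeasure n).withDensity fun g => ENNReal.ofReal (shiftDensity x g) := by
  rw [← pi_gaussianReal_eq_withDensity]
  have hp : ∀ i, IsProbabilityMeasure ((gaussianReal 0 1).map fun y => y + x i) := fun i =>
    Measure.isProbabilityMeasure_map (by fun_prop)
  have := Measure.pi_map_pi (μ := fun _ : Fin n => gaussianReal 0 1) (f := fun i y => y + x i)
    fun i => by fun_prop
  simp only [gaussianReal_map_add_const, zero_add] at this
  exact this

lemma integral_exp_gaussianReal (t c : ℝ) :
    ∫ y, Real.exp (t * y - c) ∂gaussianReal 0 1 = Real.exp (t ^ 2 / 2 - c) := by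
  have h := congrFun (mgf_id_gaussianReal (μ := 0) (v := 1)) t
  simp only [mgf, id, zero_mul, zero_add, NNReal.coe_one, one_mul] at h
  simp only [Real.exp_sub]
  rw [integral_div, h]

lemma integrable_exp_gaussianReal (t c : ℝ) :
    Integrable (fun y => Real.exp (t * y - c)) (gaussianReal 0 1) := by
  simp only [Real.exp_sub]
  exact (integrable_exp_mul_gaussianReal t).div_const _

lemma integral_shiftDensity (x : Fin n → ℝ) : ∫ g, shiftDensity x g ∂noiseMeasure n = 1 := by
  unfold shiftDensity noiseMeasure
  rw [integral_fintype_prod_eq_prod fun i y => Real.exp (x i * y - x i ^ 2 / 2)]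
  simp [integral_exp_gaussianReal]

lemma shiftDensity_sq (x g : Fin n → ℝ) :
    shiftDensity x g ^ 2 = ∏ i, Real.exp ((2 * x i) * g i - x i ^ 2) := by
  rw [shiftDensity, ← Finset.prod_pow]
  refine Finset.prod_congr rfl fun i _ => ?_
  rw [← Real.exp_nat_mul]
  congr 1
  push_cast
  ring

lemma integral_shiftDensity_sq (x : Fin n → ℝ) :
    ∫ g, shiftDensity x g ^ 2 ∂noiseMeasure n = Real.exp (∑ i, x i ^ 2) := by
  simp only [shiftDensity_sq]
  unfold noiseMeasure
  rw [integral_fintype_prod_eq_prod fun i y => Real.exp ((2 * x i) * y - x i ^ 2), Real.exp_sum]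
  refine Finset.prod_congr rfl fun i _ => ?_
  rw [integral_exp_gaussianReal]
  congr 1
  ring

lemma memLp_shiftDensity (x : Fin n → ℝ) : MemLp (shiftDensity x) 2 (noiseMeasure n) := by
  rw [memLp_two_iff_integrable_sq (measurable_shiftDensity x).aestronglyMeasurable]
  simp only [shiftDensity_sq]
  exact Integrable.fintype_prod fun i => integrable_exp_gaussianReal _ _

/-- The total variation cost of a shift of Gaussian noise. -/
lemma noiseMeasure_preimage_add_le (x : Fin n → ℝ) {S : Set (Fin n → ℝ)} (hS : MeasurableSet S) :
    noiseMeasure n ((fun g => g + x) ⁻¹' S) ≤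
      noiseMeasure n S + ENNReal.ofReal √(Real.exp (∑ i, x i ^ 2) - 1) := by
  set L := shiftDensity x
  have hL2 := memLp_shiftDensity x
  have hL1 : Integrable L (noiseMeasure n) := hL2.integrable one_le_two
  -- Nonnegativity of the variance of `|L - 1|` is the Cauchy–Schwarz bound of the `L¹` distance by
  -- the `L²` distance, and the latter is explicit because `E L = 1` and `E L² = exp(∑ x_i²)`.
  have hu2 : MemLp (fun g => |L g - 1|) 2 (noiseMeasure n) := (hL2.sub (memLp_const 1)).abs
  have hv := variance_nonneg (fun g => |L g - 1|) (noiseMeasure n)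
  rw [variance_eq_sub hu2] at hv
  have hsq : ∫ g, ((fun g => |L g - 1|) ^ 2) g ∂noiseMeasure n = Real.exp (∑ i, x i ^ 2) - 1 := by
    have e : ∀ g, ((fun g => |L g - 1|) ^ 2) g = L g ^ 2 - 2 * L g + 1 := fun g => by
      rw [Pi.pow_apply, sq_abs]; ring
    simp only [e]
    have i1 : Integrable (fun g => L g ^ 2 - 2 * L g) (noiseMeasure n) :=
      hL2.integrable_sq.sub (hL1.const_mul 2)
    rw [integral_add i1 (integrable_const 1), integral_sub hL2.integrable_sq (hL1.const_mul 2),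
      integral_const_mul, integral_shiftDensity, integral_shiftDensity_sq]
    simp
    ring
  rw [hsq] at hv
  have hle : ∫ g, |L g - 1| ∂noiseMeasure n ≤ √(Real.exp (∑ i, x i ^ 2) - 1) :=
    Real.le_sqrt_of_sq_le (by linarith)
  have hmap : noiseMeasure n ((fun g => g + x) ⁻¹' S) =
      ∫⁻ g in S, ENNReal.ofReal (L g) ∂noiseMeasure n := by
    rw [← withDensity_apply _ hS, ← map_add_noiseMeasure, Measure.map_apply (by fun_prop) hS]
  have hpt : ∀ g, ENNReal.ofReal (L g) ≤ 1 + ENNReal.ofReal |L g - 1| := fun g => by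
    rw [← ENNReal.ofReal_one, ← ENNReal.ofReal_add zero_le_one (abs_nonneg _)]
    exact ENNReal.ofReal_le_ofReal (by linarith [le_abs_self (L g - 1)])
  calc noiseMeasure n ((fun g => g + x) ⁻¹' S)
      ≤ ∫⁻ g in S, (1 + ENNReal.ofReal |L g - 1|) ∂noiseMeasure n := by
        rw [hmap]; exact lintegral_mono hpt
    _ = noiseMeasure n S + ∫⁻ g in S, ENNReal.ofReal |L g - 1| ∂noiseMeasure n := by
        rw [lintegral_add_left measurable_const, setLIntegral_one]
    _ ≤ noiseMeasure n S + ∫⁻ g, ENNReal.ofReal |L g - 1| ∂noiseMeasure n := by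
        gcongr; exact Measure.restrict_le_self
    _ ≤ _ := by
        rw [← ofReal_integral_eq_lintegral_ofReal (hu2.integrable one_le_two)
          (ae_of_all _ fun _ => abs_nonneg _)]
        gcongr

/-- The total variation cost of a random shift of Gaussian noise. -/
lemma prod_noiseMeasure_add_le {Ω : Type} {mΩ : MeasurableSpace Ω} {P : Measure Ω}
    [IsProbabilityMeasure P] {x : Ω → Fin n → ℝ} (hx : Measurable x) {S : Set (Fin n → ℝ)}
    (hS : MeasurableSet S) (η : ℝ) :
    (P.prod (noiseMeasure n)) {z | z.2 + x z.1 ∈ S} ≤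
      noiseMeasure n S + P {ω | η < ∑ i, x ω i ^ 2} + ENNReal.ofReal √(Real.exp η - 1) := by
  have hbad : MeasurableSet {ω | η < ∑ i, x ω i ^ 2} :=
    measurableSet_lt measurable_const
      (Finset.measurable_sum _ fun i _ => ((measurable_pi_apply i).comp hx).pow_const 2)
  have hm : MeasurableSet {z : Ω × (Fin n → ℝ) | z.2 + x z.1 ∈ S} :=
    (measurable_snd.add (hx.comp measurable_fst)) hS
  rw [Measure.prod_apply hm]
  -- By Fubini the shift may be frozen: the deterministic bound applies where it is small, and the
  -- trivial bound `1` on the exceptional event.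
  have hpt : ∀ ω, noiseMeasure n (Prod.mk ω ⁻¹' {z : Ω × (Fin n → ℝ) | z.2 + x z.1 ∈ S}) ≤
      (noiseMeasure n S + ENNReal.ofReal √(Real.exp η - 1)) +
        {ω | η < ∑ i, x ω i ^ 2}.indicator (fun _ => 1) ω := fun ω => by
    by_cases h : ω ∈ {ω | η < ∑ i, x ω i ^ 2}
    · rw [Set.indicator_of_mem h]
      exact prob_le_one.trans le_add_self
    · rw [Set.indicator_of_notMem h, add_zero]
      refine (noiseMeasure_preimage_add_le (x ω) hS).trans ?_
      gcongr
      exact not_lt.1 h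
  refine (lintegral_mono hpt).trans (le_of_eq ?_)
  rw [lintegral_add_left measurable_const, lintegral_const, measure_univ, mul_one,
    lintegral_indicator hbad, setLIntegral_one]
  ring

end

section

/-! ### The stopped path is negligible -/

/-- The density is at most `1/(2√v)`, since `2π ≥ 4`, and the interval has length `2b`. -/
lemma gaussianReal_Icc_le {v : ℝ≥0} (hv : v ≠ 0) (b : ℝ) :
    gaussianReal 0 v (Set.Icc (-b) b) ≤ ENNReal.ofReal (b / √v) := by
  have hv' : (0 : ℝ) < v := by exact_mod_cast pos_iff_ne_zero.2 hv
  have hpdf : ∀ y, gaussianPDF 0 v y ≤ ENNReal.ofReal (1 / (2 * √v)) := fun y => by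
    refine ENNReal.ofReal_le_ofReal ?_
    have h1 : Real.exp (-(y - 0) ^ 2 / (2 * v)) ≤ 1 :=
      Real.exp_le_one_iff.2 (div_nonpos_of_nonpos_of_nonneg (by nlinarith [sq_nonneg y])
        (by positivity))
    have h2 : 2 * √v ≤ √(2 * Real.pi * v) := by
      rw [Real.sqrt_mul (by positivity)]
      gcongr
      refine Real.le_sqrt_of_sq_le ?_
      nlinarith [Real.pi_gt_three]
    have h3 : (√(2 * Real.pi * v))⁻¹ ≤ 1 / (2 * √v) := by
      rw [one_div]
      exact inv_anti₀ (by positivity) h2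
    rw [gaussianPDFReal]
    calc _ ≤ (√(2 * Real.pi * v))⁻¹ * 1 := by gcongr
      _ ≤ _ := by rwa [mul_one]
  rw [gaussianReal_apply _ hv]
  calc ∫⁻ y in Set.Icc (-b) b, gaussianPDF 0 v y
      ≤ ∫⁻ y in Set.Icc (-b) b, ENNReal.ofReal (1 / (2 * √v)) := lintegral_mono hpdf
    _ = ENNReal.ofReal (1 / (2 * √v)) * ENNReal.ofReal (b - -b) := by
        rw [setLIntegral_const, Real.volume_Icc]
    _ = ENNReal.ofReal (b / √v) := by
        rw [← ENNReal.ofReal_mul (by positivity)]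
        congr 1
        have : √(v : ℝ) ≠ 0 := (Real.sqrt_pos.2 hv').ne'
        field_simp
        ring

lemma card_filter_lt_le (n : ℕ) {s : ℝ} (hs : 0 ≤ s) :
    ((Finset.univ.filter fun i : Fin n => ((i : ℕ) : ℝ) < s).card : ℝ) ≤ s + 1 := by
  have h1 : (Finset.univ.filter fun i : Fin n => ((i : ℕ) : ℝ) < s).card ≤
      (Finset.range ⌈s⌉₊).card := by
    refine Finset.card_le_card_of_injOn (fun i => (i : ℕ)) (fun i hi => ?_)
      (Fin.val_injective.injOn)
    have hi : ((i : ℕ) : ℝ) < s := by simpa using hi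
    exact Finset.mem_coe.2 (Finset.mem_range.2 (Nat.lt_ceil.2 hi))
  rw [Finset.card_range] at h1
  calc _ ≤ ((⌈s⌉₊ : ℕ) : ℝ) := by exact_mod_cast h1
    _ ≤ s + 1 := (Nat.ceil_lt_add_one hs).le

/-- A function on the observation grid, bounded by `b` and vanishing after time `s`. -/
lemma sum_grid_sq_le {n : ℕ} {f : I → ℝ} {sd : Fin n → ℝ} {b c s : ℝ} (hc : 0 < c) (hs : 0 ≤ s)
    (h_sd : ∀ i, c ≤ sd i) (hf : ∀ t, f t ∈ Set.Icc 0 b) (h0 : ∀ t : I, t < 1 → s ≤ t → f t = 0) :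
    ∑ i : Fin n, (f (gridTime n i) / sd i) ^ 2 ≤ (n * s + 1) * (b / c) ^ 2 := by
  have hb : 0 ≤ b := (hf 0).1.trans (hf 0).2
  have hle : ∀ i : Fin n, (f (gridTime n i) / sd i) ^ 2 ≤
      if ((i : ℕ) : ℝ) < n * s then (b / c) ^ 2 else 0 := fun i => by
    have hn : (0 : ℝ) < n := by exact_mod_cast i.pos
    split_ifs with h
    · have h1 := hf (gridTime n i)
      have h2 : 0 ≤ f (gridTime n i) / sd i := div_nonneg h1.1 (hc.le.trans (h_sd i))
      exact pow_le_pow_left₀ h2 (div_le_div₀ hb h1.2 hc (h_sd i)) 2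
    · have h1 : (gridTime n i : ℝ) = (i : ℕ) / n := coe_gridTime i.2.le
      have h2 : gridTime n i < 1 := by
        change (gridTime n i : ℝ) < 1
        rw [h1, div_lt_one hn]
        exact_mod_cast i.2
      rw [h0 _ h2, zero_div, zero_pow two_ne_zero]
      rw [h1, le_div_iff₀ hn]
      linarith
  calc _ ≤ ∑ i : Fin n, if ((i : ℕ) : ℝ) < n * s then (b / c) ^ 2 else 0 :=
        Finset.sum_le_sum fun i _ => hle i
    _ = ((Finset.univ.filter fun i : Fin n => ((i : ℕ) : ℝ) < n * s).card : ℝ) * (b / c) ^ 2 := by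
        rw [← Finset.sum_filter, Finset.sum_const, nsmul_eq_mul]
    _ ≤ _ := by
        gcongr
        exact card_filter_lt_le n (by positivity)

namespace IsRealBrownian

variable {Ω : Type} {mΩ : MeasurableSpace Ω} {P : Measure Ω}
  {ℱ : Filtration I mΩ} {w : I → Ω → ℝ} {K : Ω → ℝ} (hw : IsRealBrownian P ℱ w K)
include hw

lemma measure_sub_mem_Icc_le (b : ℝ) {v : ℝ} (hv : 0 < v) {r s : I} (h : (s : ℝ) - r = v) :
    P {ω | w s ω - w r ω ∈ Set.Icc (-b) b} ≤ ENNReal.ofReal (b / √v) := by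
  have hrs : r ≤ s := by
    change (r : ℝ) ≤ s
    linarith
  have hm : Measurable fun ω => w s ω - w r ω := (hw.measurable s).sub (hw.measurable r)
  have h1 := gaussianReal_Icc_le (v := Real.toNNReal v) (by simpa using hv) b
  rw [← h, ← hw.law r s hrs, Measure.map_apply hm measurableSet_Icc, h,
    Real.coe_toNNReal _ hv.le] at h1
  exact h1

variable [IsProbabilityMeasure P]

/-- The stopped path is nonnegative with mean `a`; Markov's inequality at level `N a` gives `1/N`.
-/
lemma measure_stopPath_eq_le {a N : ℝ} (ha : 0 < a) (hN : 1 ≤ N) {r s : I} (hrs : r ≤ s) :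
    P {ω | stopPath a (N * a) r (fun u => w u ω) s = N * a} ≤ ENNReal.ofReal (1 / N) := by
  have hN0 : 0 < N := by linarith
  have hab : a ∈ Set.Icc 0 (N * a) := ⟨ha.le, le_mul_of_one_le_left ha.le hN⟩
  have hint : Integrable (fun ω => stopPath a (N * a) r (fun u => w u ω) s) P :=
    memLp_one_iff_integrable.1 (hw.memLp_stopPath hab s 1)
  have h1 := mul_meas_ge_le_integral_of_nonneg
    (ae_of_all P fun ω => (stopPath_mem_Icc (r := r) (hw.continuous ω) hab s).1) hint (N * a)
  have h2 := (hw.setIntegral_stopPath_sub (a := a) (b := N * a) (r := r) hrs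
    (A := Set.univ) MeasurableSet.univ).1
  rw [setIntegral_univ] at h2
  simp only [stopPath_of_le le_rfl] at h2
  rw [integral_sub hint (integrable_const a)] at h2
  simp only [integral_const, probReal_univ, smul_eq_mul, one_mul] at h2
  have h3 : P.real {ω | N * a ≤ stopPath a (N * a) r (fun u => w u ω) s} ≤ 1 / N := by
    rw [le_div_iff₀ hN0]
    have h4 : a * (P.real {ω | N * a ≤ stopPath a (N * a) r (fun u => w u ω) s} * N) ≤ a * 1 := by
      linarith
    exact le_of_mul_le_mul_left h4 ha
  refine (measure_mono fun ω hω => ?_).trans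
    ((ENNReal.le_ofReal_iff_toReal_le (measure_ne_top _ _) (by positivity)).2 h3)
  exact (show _ = _ from hω).ge

/-- Except on an event of small probability, the stopped path contributes little to the
likelihood. -/
lemma measure_sum_sq_stopPath_le {n : ℕ} {a N c : ℝ} (ha : 0 < a) (hN : 1 ≤ N) (hc : 0 < c)
    {sd : Fin n → ℝ} (h_sd : ∀ i, c ≤ sd i) (r : I) :
    P {ω | ((n : ℝ) * (r + N ^ 4 * a ^ 2) + 1) * (N * a / c) ^ 2 <
      ∑ i : Fin n, (stopPath a (N * a) r (fun u => w u ω) (gridTime n i) / sd i) ^ 2} ≤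
      ENNReal.ofReal (2 / N) := by
  have hN0 : 0 < N := by linarith
  have hab : a ∈ Set.Icc 0 (N * a) := ⟨ha.le, le_mul_of_one_le_left ha.le hN⟩
  -- Over a time `N⁴a²` the Brownian increment has standard deviation `N²a`, larger by the factor
  -- `N` than the barrier `N a`; the chance of not having exited is therefore at most `1/N`.
  have hT : 0 < N ^ 4 * a ^ 2 := by positivity
  have hs0 : 0 ≤ (r : ℝ) + N ^ 4 * a ^ 2 := add_nonneg r.2.1 hT.le
  have hgood : ∀ ω, (∀ t : I, t < 1 → (r : ℝ) + N ^ 4 * a ^ 2 ≤ t →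
      stopPath a (N * a) r (fun u => w u ω) t = 0) →
      ∑ i : Fin n, (stopPath a (N * a) r (fun u => w u ω) (gridTime n i) / sd i) ^ 2 ≤
      ((n : ℝ) * (r + N ^ 4 * a ^ 2) + 1) * (N * a / c) ^ 2 := fun ω h =>
    sum_grid_sq_le hc hs0 h_sd (fun t => stopPath_mem_Icc (hw.continuous ω) hab t) h
  rcases lt_or_ge ((r : ℝ) + N ^ 4 * a ^ 2) 1 with hlt | hge
  · set s : I := ⟨r + N ^ 4 * a ^ 2, hs0, hlt.le⟩ with hs
    have hrs : r ≤ s := by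
      change (r : ℝ) ≤ r + N ^ 4 * a ^ 2
      linarith
    have hsub : {ω | ((n : ℝ) * (r + N ^ 4 * a ^ 2) + 1) * (N * a / c) ^ 2 <
        ∑ i : Fin n, (stopPath a (N * a) r (fun u => w u ω) (gridTime n i) / sd i) ^ 2} ⊆
        {ω | stopPath a (N * a) r (fun u => w u ω) s = N * a} ∪
        {ω | w s ω - w r ω ∈ Set.Icc (-(N * a)) (N * a)} := fun ω hω => by
      rcases stopPath_eq_or_mem (hw.continuous ω) hab (s := s) hlt hrs with h | h | h
      · exact absurd (hgood ω fun t _ ht => h t ht) (not_le.2 hω)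
      · exact Or.inl h
      · exact Or.inr h
    have h2 := hw.measure_sub_mem_Icc_le (N * a) hT
      (show (s : ℝ) - r = N ^ 4 * a ^ 2 by simp [hs])
    have h3 : N * a / √(N ^ 4 * a ^ 2) = 1 / N := by
      rw [show N ^ 4 * a ^ 2 = (N ^ 2 * a) ^ 2 by ring, Real.sqrt_sq (by positivity)]
      field_simp
    rw [h3] at h2
    refine ((measure_mono hsub).trans (measure_union_le _ _)).trans
      ((add_le_add (hw.measure_stopPath_eq_le ha hN hrs) h2).trans (le_of_eq ?_))
    rw [← ENNReal.ofReal_add (by positivity) (by positivity)]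
    congr 1
    ring
  -- Here the allotted time exceeds the horizon, so no time `t < 1` remains at which the path would
  -- have to vanish, and the bound holds for every outcome.
  · have h : {ω | ((n : ℝ) * (r + N ^ 4 * a ^ 2) + 1) * (N * a / c) ^ 2 <
        ∑ i : Fin n, (stopPath a (N * a) r (fun u => w u ω) (gridTime n i) / sd i) ^ 2} = ∅ := by
      refine Set.eq_empty_of_forall_notMem fun ω hω => absurd (hgood ω fun t ht h => ?_) (not_le.2 hω)
      have ht' : (t : ℝ) < 1 := ht
      linarith
    rw [h, measure_empty]
    exact zero_le

end IsRealBrownian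

end

section

/-! ### The driving processes on the observation space -/

section Driving

variable {Ω Ω' : Type} {mΩ : MeasurableSpace Ω} {mΩ' : MeasurableSpace Ω'} {P : Measure Ω}
  {P' : Measure Ω'} {ℱ : Filtration I mΩ} {d : ℕ}

lemma IsBrownianMotion.isRealBrownian {B : I → Ω → EuclideanSpace ℝ (Fin d)}
    (hB : IsBrownianMotion P ℱ B) (i : Fin d) (hc : ∀ ω, Continuous fun t => B t ω i) {K : Ω → ℝ}
    (hK : ∀ t ω, |B t ω i| ≤ K ω) (hK2 : MemLp K 2 P) :
    IsRealBrownian P ℱ (fun t ω => B t ω i) K where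
  adapted t := by
    have h : Measurable fun x : EuclideanSpace ℝ (Fin d) => x i := by fun_prop
    exact h.comp (hB.adapted t).measurable
  continuous := hc
  bound := hK
  memLp := hK2
  law s t hst := by
    have hm : ∀ t, Measurable (B t) := fun t => ((hB.adapted t).mono (ℱ.le t)).measurable
    have h := hB.increment_law s t hst
    have h1 := (measurePreserving_eval
      (fun _ : Fin d => gaussianReal 0 (Real.toNNReal ((t : ℝ) - s))) i).map_eq
    rw [← h, Measure.map_map (measurable_pi_apply i) (by fun_prop)] at h1
    exact h1
  indep s t hst := by
    refine indep_of_indep_of_le_left (hB.increment_indep s t hst) ?_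
    have h : Measurable fun x : EuclideanSpace ℝ (Fin d) => x i := by fun_prop
    have : (fun ω => B t ω i - B s ω i) =
        (fun x : EuclideanSpace ℝ (Fin d) => x i) ∘ fun ω => B t ω - B s ω := rfl
    rw [this, ← MeasurableSpace.comap_comp]
    exact MeasurableSpace.comap_mono h.comap_le

lemma IndepFun.comp_measurePreserving {β γ : Type*} [MeasurableSpace β] [MeasurableSpace γ]
    {φ : Ω' → Ω} {f : Ω → β} {g : Ω → γ} (hf : Measurable f) (hg : Measurable g)
    (h : IndepFun f g P) (hφ : MeasurePreserving φ P' P) :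
    IndepFun (fun ω => f (φ ω)) (fun ω => g (φ ω)) P' := by
  rw [indepFun_iff_measure_inter_preimage_eq_mul] at h ⊢
  intro s t hs ht
  have := h s t hs ht
  rw [← hφ.measure_preimage ((hf hs).inter (hg ht)).nullMeasurableSet,
    ← hφ.measure_preimage (hf hs).nullMeasurableSet,
    ← hφ.measure_preimage (hg ht).nullMeasurableSet] at this
  exact this

end Driving

lemma isRealBrownian_driving (d : ℕ) (i : Fin d) :
    IsRealBrownian (drivingMeasure d) (drivingFiltration d) (fun t ω => brownian i t ω.1)
      (fun ω => brownianBound ω.1) :=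
  (isBrownianMotion_brownianVec.extend isExtension_fst).isRealBrownian i
    (fun ω => continuous_brownian i ω.1) (fun t ω => abs_brownian_le i t ω.1)
    (memLp_brownianBound.comp_measurePreserving measurePreserving_fst)

/-- A probability space carrying driving processes and observation noise. -/
abbrev ObservationSpace (d n : ℕ) : Type := DrivingSpace d × (Fin n → ℝ)

/-- The joint law of driving processes and noise. -/
def observationMeasure (d n : ℕ) : Measure (ObservationSpace d n) :=
  (drivingMeasure d).prod (noiseMeasure n)

instance (d n : ℕ) : IsProbabilityMeasure (observationMeasure d n) := by
  unfold observationMeasure; infer_instance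

/-- The filtration generated by the driving processes and the noise. -/
def observationFiltration (d n : ℕ) :
    Filtration I (inferInstance : MeasurableSpace (ObservationSpace d n)) :=
  prodFiltration (drivingFiltration d) (noiseFiltration n)

lemma isExtension_observation (d n : ℕ) :
    IsExtension Prod.fst (observationMeasure d n) (drivingMeasure d) (observationFiltration d n)
      (drivingFiltration d) := isExtension_fst

lemma isBrownianMotion_observation (d n : ℕ) :
    IsBrownianMotion (observationMeasure d n) (observationFiltration d n)
      (fun t ω => (brownianVec t ω.1.1 : EuclideanSpace ℝ (Fin d))) :=
  (isBrownianMotion_brownianVec.extend isExtension_fst).extend (isExtension_observation d n)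

lemma isRealBrownian_observation (d n : ℕ) (i : Fin d) :
    IsRealBrownian (observationMeasure d n) (observationFiltration d n)
      (fun t ω => brownian i t ω.1.1) (fun ω => brownianBound ω.1.1) :=
  (isBrownianMotion_observation d n).isRealBrownian i
    (fun ω => continuous_brownian i ω.1.1) (fun t ω => abs_brownian_le i t ω.1.1)
    ((memLp_brownianBound.comp_measurePreserving measurePreserving_fst).comp_measurePreserving
      (isExtension_observation d n).measurePreserving)

lemma isPoissonRandomMeasure_observation (d n : ℕ) :
    IsPoissonRandomMeasure (observationMeasure d n) (observationFiltration d n)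
      (fun ω => poissonRM ω.1.2) :=
  IsPoissonRandomMeasure.extend (ν := fun ω : DrivingSpace d => poissonRM ω.2)
    (measurable_poissonRM.comp measurable_snd)
    (isPoissonRandomMeasure_poissonRM.extend measurable_poissonRM
      (isExtension_snd (P := gaussianSeqMeasure d) (ℱ := brownianFiltration d)))
    (isExtension_observation d n)

lemma measurable_brownianVec {d : ℕ} (t : I) :
    Measurable (brownianVec t : GaussianSeq d → EuclideanSpace ℝ (Fin d)) :=
  (isBrownianMotion_brownianVec.adapted t).measurable.mono ((brownianFiltration d).le t) le_rfl

lemma indepFun_observation (d n : ℕ) :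
    IndepFun (fun (ω : ObservationSpace d n) t => (brownianVec t ω.1.1 : EuclideanSpace ℝ (Fin d)))
      (fun ω => poissonRM ω.1.2) (observationMeasure d n) := by
  have hB : Measurable fun (ω : GaussianSeq d) (t : I) => brownianVec t ω :=
    measurable_pi_lambda _ fun t => measurable_brownianVec t
  exact IndepFun.comp_measurePreserving (f := fun (ω : DrivingSpace d) t => brownianVec t ω.1)
    (hB.comp measurable_fst) (measurable_poissonRM.comp measurable_snd)
    (indepFun_prod hB measurable_poissonRM) (isExtension_observation d n).measurePreserving

lemma indep_noise_observation (d : ℕ) {n : ℕ} (i : Fin n) :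
    Indep (MeasurableSpace.comap (fun ω : ObservationSpace d n => ω.2 i) inferInstance)
      (observationFiltration d n (gridTime n i)) (observationMeasure d n) := by
  have h := (isExtension_snd (P := drivingMeasure d) (ℱ := drivingFiltration d)
    (P' := noiseMeasure n) (ℱ' := noiseFiltration n)).indep (gridTime n i) _
    (measurable_pi_apply i).comap_le (indep_noise i)
  rwa [MeasurableSpace.comap_comp] at h

lemma map_noise_observation (d : ℕ) {n : ℕ} (i : Fin n) :
    (observationMeasure d n).map (fun ω => ω.2 i) = gaussianReal 0 1 := by
  have h1 : MeasurePreserving Prod.snd (observationMeasure d n) (noiseMeasure n) :=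
    measurePreserving_snd
  exact ((measurePreserving_eval (fun _ : Fin n => gaussianReal 0 1) i).comp h1).map_eq

/-! ### Conditional moments of observations with independent Gaussian noise -/

section Noise

variable {Ω : Type*} {m mΩ : MeasurableSpace Ω} {P : Measure Ω}
  {U G : Ω → ℝ} {A s : ℝ}

lemma integrable_comp_noise (hG : Measurable G) (hlaw : P.map G = gaussianReal 0 1)
    {φ : ℝ → ℝ} (hφ : Integrable φ (gaussianReal 0 1)) : Integrable (fun ω => φ (G ω)) P := by
  rw [← hlaw] at hφ
  exact hφ.comp_measurable hG

lemma integrable_rpow_gaussianReal (A S : ℝ) (hA : 0 ≤ A) (hS : 0 ≤ S) {κ : ℝ} (hκ : 0 < κ) :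
    Integrable (fun y => (A + S * |y|) ^ κ) (gaussianReal 0 1) := by
  have h1 : MemLp (fun y : ℝ => A + S * |y|) (ENNReal.ofReal κ) (gaussianReal 0 1) :=
    (memLp_const A).add (((memLp_id_gaussianReal' _ ENNReal.ofReal_ne_top).abs).const_mul S)
  have h2 := h1.integrable_norm_rpow (by simpa using hκ) ENNReal.ofReal_ne_top
  rw [ENNReal.toReal_ofReal hκ.le] at h2
  refine h2.congr (ae_of_all _ fun y => ?_)
  simp only
  rw [Real.norm_eq_abs, abs_of_nonneg (by positivity)]

lemma rpow_abs_add_noise_le {κ S u y : ℝ} (hκ : 0 < κ) (hs : 0 ≤ s) (hS : s ≤ S) (hu : |u| ≤ A) :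
    |u + s * y| ^ κ ≤ (A + S * |y|) ^ κ := by
  refine Real.rpow_le_rpow (abs_nonneg _) ?_ hκ.le
  refine (abs_add_le _ _).trans (add_le_add hu ?_)
  rw [abs_mul, abs_of_nonneg hs]
  gcongr

lemma integrable_rpow_add_noise (hU : Measurable U) (hA0 : 0 ≤ A) (hA : ∀ ω, |U ω| ≤ A)
    (hG : Measurable G) (hlaw : P.map G = gaussianReal 0 1) {κ S : ℝ} (hκ : 0 < κ) (hs : 0 ≤ s)
    (hS : s ≤ S) : Integrable (fun ω => |U ω + s * G ω| ^ κ) P := by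
  refine (integrable_comp_noise hG hlaw
    (integrable_rpow_gaussianReal A S hA0 (hs.trans hS) hκ)).mono'
    ((hU.add (hG.const_mul s)).abs.pow_const κ).aestronglyMeasurable
    (ae_of_all _ fun ω => ?_)
  rw [Real.norm_eq_abs, abs_of_nonneg (by positivity)]
  exact rpow_abs_add_noise_le hκ hs hS (hA ω)

variable [IsProbabilityMeasure P]

lemma condExp_comp_noise (hm : m ≤ mΩ) (hG : Measurable G)
    (hGm : Indep (MeasurableSpace.comap G inferInstance) m P) (hlaw : P.map G = gaussianReal 0 1)
    {φ : ℝ → ℝ} (hφ : Measurable φ) :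
    P[fun ω => φ (G ω) | m] =ᵐ[P] fun _ => ∫ y, φ y ∂gaussianReal 0 1 := by
  have h := condExp_indep_eq (m₁ := MeasurableSpace.comap G inferInstance) (f := fun ω => φ (G ω))
    hG.comap_le hm (hφ.comp (comap_measurable G)).stronglyMeasurable hGm
  rw [← hlaw, integral_map hG.aemeasurable hφ.aestronglyMeasurable]
  exact h

lemma condExp_add_noise (hm : m ≤ mΩ) (hU : Measurable[m] U) (hA : ∀ ω, |U ω| ≤ A)
    (hG : Measurable G) (hGm : Indep (MeasurableSpace.comap G inferInstance) m P)
    (hlaw : P.map G = gaussianReal 0 1) : P[fun ω => U ω + s * G ω | m] =ᵐ[P] U := by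
  have hUi : Integrable U P := Integrable.of_bound (hU.mono hm le_rfl).aestronglyMeasurable A
    (ae_of_all _ hA)
  have hid : Integrable (fun y : ℝ => s * y) (gaussianReal 0 1) :=
    ((memLp_id_gaussianReal' 1 ENNReal.one_ne_top).integrable le_rfl).const_mul s
  have h1 := condExp_add hUi (integrable_comp_noise hG hlaw hid) m
  have h2 := condExp_comp_noise hm hG hGm hlaw (φ := fun y => s * y) (by fun_prop)
  rw [condExp_of_stronglyMeasurable hm hU.stronglyMeasurable hUi] at h1
  filter_upwards [h1, h2] with ω h1 h2
  refine h1.trans ?_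
  rw [Pi.add_apply, h2, integral_const_mul, integral_id_gaussianReal, mul_zero, add_zero]

lemma condVar_add_noise (hm : m ≤ mΩ) (hU : Measurable[m] U) (hA : ∀ ω, |U ω| ≤ A)
    (hG : Measurable G) (hGm : Indep (MeasurableSpace.comap G inferInstance) m P)
    (hlaw : P.map G = gaussianReal 0 1) :
    condVar m (fun ω => U ω + s * G ω) P =ᵐ[P] fun _ => s ^ 2 := by
  have h1 := condExp_add_noise (s := s) hm hU hA hG hGm hlaw
  have h2 : ((fun ω => U ω + s * G ω) - P[fun ω => U ω + s * G ω | m]) ^ 2 =ᵐ[P]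
      fun ω => (s * G ω) ^ 2 := by
    filter_upwards [h1] with ω h1
    rw [Pi.pow_apply, Pi.sub_apply, h1, add_sub_cancel_left]
  refine (condExp_congr_ae h2).trans ?_
  refine (condExp_comp_noise hm hG hGm hlaw (φ := fun y => (s * y) ^ 2) (by fun_prop)).trans ?_
  have h3 := variance_id_gaussianReal (μ := 0) (v := 1)
  rw [variance_of_integral_eq_zero measurable_id.aemeasurable
    (by simp [integral_id_gaussianReal])] at h3
  have h4 : ∫ y, (s * y) ^ 2 ∂gaussianReal 0 1 = s ^ 2 := by
    simp only [mul_pow]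
    rw [integral_const_mul]
    simp only [id, NNReal.coe_one] at h3
    rw [h3, mul_one]
  rw [h4]

/-- Replacing `U` and `s` by their bounds leaves a function of the independent noise alone, whose
conditional moment is a constant that does not depend on the observation time. -/
lemma condExp_rpow_add_noise_le (hm : m ≤ mΩ) (hU : Measurable[m] U) (hA0 : 0 ≤ A)
    (hA : ∀ ω, |U ω| ≤ A) (hG : Measurable G)
    (hGm : Indep (MeasurableSpace.comap G inferInstance) m P) (hlaw : P.map G = gaussianReal 0 1)
    {κ S : ℝ} (hκ : 0 < κ) (hs : 0 ≤ s) (hS : s ≤ S) :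
    ∀ᵐ ω ∂P, (P[fun ω => |U ω + s * G ω| ^ κ | m]) ω ≤
      ∫ y, (A + S * |y|) ^ κ ∂gaussianReal 0 1 := by
  have h1 := condExp_mono (m := m) (integrable_rpow_add_noise (hU.mono hm le_rfl) hA0 hA hG hlaw
    hκ hs hS) (integrable_comp_noise hG hlaw (integrable_rpow_gaussianReal A S hA0 (hs.trans hS) hκ))
    (ae_of_all _ fun ω => rpow_abs_add_noise_le hκ hs hS (hA ω))
  have h2 := condExp_comp_noise hm hG hGm hlaw (φ := fun y => (A + S * |y|) ^ κ) (by fun_prop)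
  filter_upwards [h1, h2] with ω h1 h2
  exact h1.trans h2.le

end Noise

end

section

/-! ### Experiments with a stopped Brownian signal -/

variable {p q : ℕ}

lemma ParametricModel.continuous_mean (M : ParametricModel p q) {θ : EuclideanSpace ℝ (Fin p)}
    (hθ : θ ∈ M.Θ) : Continuous fun t : I => M.mean θ t 0 :=
  continuousOn_iff_continuous_domRestrict.1 (M.mean_time θ hθ 0).continuousOn

lemma ParametricModel.continuous_var (M : ParametricModel p q) {θ : EuclideanSpace ℝ (Fin p)}
    (hθ : θ ∈ M.Θ) : Continuous fun t : I => M.var θ t 0 :=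
  continuousOn_iff_continuous_domRestrict.1 (M.var_time θ hθ 0).continuousOn

/-- Constants controlling the model along the path `X = 0`. -/
structure ParametricModel.Bounds (M : ParametricModel p q) (θ : EuclideanSpace ℝ (Fin p))
    (m L c S : ℝ) : Prop where
  mean_le : ∀ t : I, |M.mean θ t 0| ≤ m
  deriv_le : ∀ t ∈ Set.Icc (0 : ℝ) 1, |derivWithin (fun t => M.mean θ t 0) (Set.Icc 0 1) t| ≤ L
  le_sd : ∀ t : I, c ≤ √(M.var θ t 0)
  sd_le : ∀ t : I, √(M.var θ t 0) ≤ S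
  pos : 0 < c

lemma ParametricModel.exists_bounds (M : ParametricModel p q) {θ : EuclideanSpace ℝ (Fin p)}
    (hθ : θ ∈ M.Θ) : ∃ m L c S, M.Bounds θ m L c S := by
  obtain ⟨m, hm⟩ := isCompact_univ.exists_bound_of_continuousOn
    (M.continuous_mean hθ).continuousOn
  obtain ⟨L, hL⟩ := isCompact_Icc.exists_bound_of_continuousOn
    ((M.mean_time θ hθ 0).continuousOn_derivWithin (uniqueDiffOn_Icc zero_lt_one) le_rfl)
  have hs : Continuous fun t : I => √(M.var θ t 0) := (M.continuous_var hθ).sqrt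
  obtain ⟨u, -, hu⟩ := isCompact_univ.exists_isMinOn Set.univ_nonempty hs.continuousOn
  obtain ⟨v, -, hv⟩ := isCompact_univ.exists_isMaxOn Set.univ_nonempty hs.continuousOn
  exact ⟨m, L, √(M.var θ u 0), √(M.var θ v 0), fun t => hm t (Set.mem_univ t),
    fun t ht => hL t ht, fun t => hu (Set.mem_univ t), fun t => hv (Set.mem_univ t),
    Real.sqrt_pos.2 (M.var_pos θ hθ u u.2 0)⟩

namespace ParametricModel.Bounds

variable {M : ParametricModel p q} {θ : EuclideanSpace ℝ (Fin p)} {m L c S : ℝ}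
  (h : M.Bounds θ m L c S)
include h

lemma mean_nonneg : 0 ≤ m := (abs_nonneg _).trans (h.mean_le 0)

lemma deriv_nonneg : 0 ≤ L := (abs_nonneg _).trans (h.deriv_le 0 (by simp))

lemma sd_nonneg : 0 ≤ S := (Real.sqrt_nonneg _).trans (h.sd_le 0)

lemma abs_mean_sub_le (hθ : θ ∈ M.Θ) {s t : I} (hst : s ≤ t) :
    |M.mean θ t 0 - M.mean θ s 0| ≤ L * ((t : ℝ) - s) := by
  have h1 := (convex_Icc (0 : ℝ) 1).norm_image_sub_le_of_norm_derivWithin_le (𝕜 := ℝ)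
    (f := fun t => M.mean θ t 0) ((M.mean_time θ hθ 0).differentiableOn one_ne_zero)
    (fun x hx => h.deriv_le x hx) s.2 t.2
  have h2 : (0 : ℝ) ≤ t - s := sub_nonneg.2 hst
  rwa [Real.norm_eq_abs, Real.norm_eq_abs, abs_of_nonneg h2] at h1

end ParametricModel.Bounds

lemma brownianPath_isRealBrownian (q n : ℕ) :
    IsRealBrownian (observationMeasure (q + 1) n) (observationFiltration (q + 1) n)
      (fun t ω => brownian 0 t ω.1.1) (fun ω => brownianBound ω.1.1) :=
  isRealBrownian_observation (q + 1) n 0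

/-- The experiment in which the mean exceeds its null value by a stopped Brownian motion, which is
constant equal to `a` until time `r`, and is stopped on leaving `(0, b)`. -/
def stoppedExperiment (M : ParametricModel p q) {θ : EuclideanSpace ℝ (Fin p)} (hθ : θ ∈ M.Θ)
    (n : ℕ) (a b : ℝ) (r : I) : Experiment p q n where
  Ω := ObservationSpace (q + 1) n
  mΩ := inferInstance
  P := observationMeasure (q + 1) n
  isProb := inferInstance
  ℱ := observationFiltration (q + 1) n
  μ t ω := M.mean θ t 0 + stopPath a b r (fun u => brownian 0 u ω.1.1) t
  σsq t _ := M.var θ t 0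
  X _ _ := 0
  Xhat _ _ := 0
  Y i ω := (M.mean θ (gridTime n i) 0 +
    stopPath a b r (fun u => brownian 0 u ω.1.1) (gridTime n i)) +
      √(M.var θ (gridTime n i) 0) * ω.2 i
  θhat _ := θ
  μ_adapted t := (measurable_const.add
    ((brownianPath_isRealBrownian q n).measurable_stopPath t)).stronglyMeasurable
  σsq_adapted _ := stronglyMeasurable_const
  X_adapted _ := stronglyMeasurable_const
  μ_measurable := ((M.continuous_mean hθ).measurable.comp measurable_fst).add
    (brownianPath_isRealBrownian q n).measurable_uncurry_stopPath
  σsq_measurable := (M.continuous_var hθ).measurable.comp measurable_fst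
  X_measurable := measurable_const
  σsq_nonneg t _ := (M.var_pos θ hθ t t.2 0).le
  Xhat_measurable _ := measurable_const
  Y_measurable i := by
    have hle : gridTime n i ≤ gridTime n (i + 1) := by
      refine Set.monotone_projIcc _ ?_
      gcongr
      simp
    refine Measurable.add (measurable_const.add
      (((brownianPath_isRealBrownian q n).measurable_stopPath _).mono
        ((observationFiltration (q + 1) n).mono hle) le_rfl)) (measurable_const.mul ?_)
    exact (measurable_noise i).comp
      ((isExtension_snd (P := drivingMeasure (q + 1)) (P' := noiseMeasure n)
        (ℱ := drivingFiltration (q + 1)) (ℱ' := noiseFiltration n)).measurable _)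
  θhat_measurable := measurable_const

/-- A constant for which all the experiments with a stopped Brownian signal satisfy the regularity
conditions. -/
def regularityConst (m L S ε : ℝ) : ℝ :=
  (m + 1) + L + (2 * L ^ 2 + 2) + ∫ y, ((m + 1) + S * |y|) ^ (4 + ε) ∂gaussianReal 0 1

section Regularity

variable {M : ParametricModel p q} {θ : EuclideanSpace ℝ (Fin p)} (hθ : θ ∈ M.Θ) {m L c S : ℝ}
  (hM : M.Bounds θ m L c S) {n : ℕ} {a b : ℝ} (ha : a ∈ Set.Icc 0 b) (hb : b ≤ 1) (r : I)
  {ε C : ℝ} (hε : 0 < ε) (hC : regularityConst m L S ε ≤ C)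

include hM hC in
lemma ParametricModel.Bounds.le_of_regularityConst_le :
    m + 1 ≤ C ∧ L ≤ C ∧ 2 * L ^ 2 + 2 ≤ C ∧
      ∫ y, ((m + 1) + S * |y|) ^ (4 + ε) ∂gaussianReal 0 1 ≤ C := by
  have h1 := hM.mean_nonneg
  have h2 := hM.deriv_nonneg
  have h3 := hM.sd_nonneg
  have h4 : 0 ≤ ∫ y, ((m + 1) + S * |y|) ^ (4 + ε) ∂gaussianReal 0 1 :=
    integral_nonneg fun y => by positivity
  have h5 := sq_nonneg L
  unfold regularityConst at hC
  refine ⟨?_, ?_, ?_, ?_⟩ <;> linarith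

-- The covariate is zero and known exactly, and the noise is centred with the prescribed variance,
-- so all error terms vanish. Only the increments of `μ` and the `4 + ε` moment use the size of `C`;
-- `b ≤ 1` makes both bounds uniform.
include hM ha hb hε hC in
lemma isRegular_stoppedExperiment : (stoppedExperiment M hθ n a b r).IsRegular M ε C := by
  obtain ⟨hC1, hC2, hC3, hC4⟩ := hM.le_of_regularityConst_le hC
  have hC0 : 0 ≤ C := by linarith [hM.mean_nonneg]
  have hw := brownianPath_isRealBrownian q n
  have hA : ∀ (i : Fin n) (ω : ObservationSpace (q + 1) n), |M.mean θ (gridTime n i) 0 +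
      stopPath a b r (fun u => brownian 0 u ω.1.1) (gridTime n i)| ≤ m + 1 := fun i ω => by
    have h1 := stopPath_mem_Icc (r := r) (hw.continuous ω) ha (gridTime n i)
    refine (abs_add_le _ _).trans (add_le_add (hM.mean_le _) ?_)
    rw [abs_of_nonneg h1.1]
    exact h1.2.trans hb
  have hU : ∀ i : Fin n, Measurable[observationFiltration (q + 1) n (gridTime n i)]
      fun ω : ObservationSpace (q + 1) n => M.mean θ (gridTime n i) 0 +
        stopPath a b r (fun u => brownian 0 u ω.1.1) (gridTime n i) := fun i =>
    measurable_const.add (hw.measurable_stopPath _)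
  have hG : ∀ i : Fin n, Measurable fun ω : ObservationSpace (q + 1) n => ω.2 i := fun i => by
    fun_prop
  have hle : ∀ i : Fin n, observationFiltration (q + 1) n (gridTime n i) ≤
      (inferInstance : MeasurableSpace (ObservationSpace (q + 1) n)) :=
    fun i => (observationFiltration (q + 1) n).le _
  have hm0 : 0 ≤ m + 1 := by linarith [hM.mean_nonneg]
  refine
    { μ_incr := hw.hasBoundedIncrements ha hM.mean_le (fun s t => hM.abs_mean_sub_le hθ)
        (by linarith) hC2 hC3
      X_incr := hasBoundedIncrements_zero hC0
      Xhat_integrable := fun i => ?_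
      Xhat_sq := fun i => ?_
      Xhat_fourth := fun i => ?_
      Y_integrable := fun i => ?_
      Y_mean := fun i => ?_
      Y_var := fun i => ?_
      Y_moment := fun i => ?_
      θhat_mem := fun _ => hθ }
  · refine (integrable_zero _ ℝ _).congr (ae_of_all _ fun ω => ?_)
    simp [stoppedExperiment]
  · refine ae_of_all _ fun ω => ?_
    have : (fun ω' => ‖(stoppedExperiment M hθ n a b r).Xhat i ω' -
        (stoppedExperiment M hθ n a b r).X (gridTime n i) ω'‖ ^ 2) = 0 := by
      ext; simp [stoppedExperiment]
    rw [this, condExp_zero]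
    simp only [Pi.zero_apply]
    positivity
  · refine ae_of_all _ fun ω => ?_
    have : (fun ω' => ‖(stoppedExperiment M hθ n a b r).Xhat i ω' -
        (stoppedExperiment M hθ n a b r).X (gridTime n i) ω'‖ ^ 4) = 0 := by
      ext; simp [stoppedExperiment]
    rw [this, condExp_zero]
    simp only [Pi.zero_apply]
    positivity
  · exact integrable_rpow_add_noise ((hU i).mono (hle i) le_rfl) hm0 (hA i) (hG i)
      (map_noise_observation _ i) (by linarith) (Real.sqrt_nonneg _) (hM.sd_le _)
  · filter_upwards [condExp_add_noise (s := √(M.var θ (gridTime n i) 0)) (hle i) (hU i) (hA i) (hG i)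
      (indep_noise_observation _ i) (map_noise_observation _ i)] with ω hω
    have : |(observationMeasure (q + 1) n)[(stoppedExperiment M hθ n a b r).Y i |
        observationFiltration (q + 1) n (gridTime n i)] ω -
        (stoppedExperiment M hθ n a b r).μ (gridTime n i) ω| = 0 := by
      rw [abs_eq_zero, sub_eq_zero]
      exact hω
    refine (le_of_eq this).trans ?_
    positivity
  · filter_upwards [condVar_add_noise (s := √(M.var θ (gridTime n i) 0)) (hle i) (hU i) (hA i) (hG i)
      (indep_noise_observation _ i) (map_noise_observation _ i)] with ω hω
    rw [Real.sq_sqrt (M.var_pos θ hθ _ (gridTime n i).2 0).le] at hω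
    have : |condVar (observationFiltration (q + 1) n (gridTime n i))
        ((stoppedExperiment M hθ n a b r).Y i) (observationMeasure (q + 1) n) ω -
        (stoppedExperiment M hθ n a b r).σsq (gridTime n i) ω| = 0 := by
      rw [abs_eq_zero, sub_eq_zero]
      exact hω
    refine (le_of_eq this).trans ?_
    positivity
  · filter_upwards [condExp_rpow_add_noise_le (κ := 4 + ε) (hle i) (hU i) hm0 (hA i) (hG i)
      (indep_noise_observation _ i) (map_noise_observation _ i) (by linarith) (Real.sqrt_nonneg _)
      (hM.sd_le (gridTime n i))] with ω hω
    exact hω.trans hC4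

include hM ha hb hε hC in
lemma isAlternative_stoppedExperiment {K : ℝ → ℝ} (hK : ∀ η, 0 < η → ‖θ‖ ≤ K η) :
    (stoppedExperiment M hθ n a b r).IsAlternative M ε C K := by
  refine ⟨isRegular_stoppedExperiment hθ hM ha hb r hε hC, fun η hη => ?_⟩
  have : {ω | K η < ‖(stoppedExperiment M hθ n a b r).θhat ω‖} = ∅ :=
    Set.eq_empty_of_forall_notMem fun ω hω => absurd (hK η hη) (not_le.2 hω)
  rw [this, measure_empty]
  exact zero_le

include hM hε hC in
lemma isNull_stoppedExperiment {K : ℝ → ℝ} (hK : ∀ η, 0 < η → 0 ≤ K η) :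
    (stoppedExperiment M hθ n 0 0 r).IsNull M ε C K := by
  refine ⟨isRegular_stoppedExperiment hθ hM ⟨le_rfl, le_rfl⟩ zero_le_one r hε hC, θ, hθ,
    ae_of_all _ fun ω t => ⟨?_, rfl⟩, fun η hη => ?_⟩
  · simp only [stoppedExperiment, stopPath_zero, add_zero]
  · have : {ω | K η * (n : ℝ) ^ (-(1 / 2) : ℝ) <
        ‖(stoppedExperiment M hθ n 0 0 r).θhat ω - θ‖} = ∅ := by
      refine Set.eq_empty_of_forall_notMem fun ω hω => ?_
      have h1 : K η * (n : ℝ) ^ (-(1 / 2) : ℝ) < ‖θ - θ‖ := hω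
      rw [sub_self, norm_zero] at h1
      have h2 : 0 ≤ K η * (n : ℝ) ^ (-(1 / 2) : ℝ) := mul_nonneg (hK η hη) (by positivity)
      linarith
    rw [this, measure_empty]
    exact zero_le

include hM hC in
lemma isIto_stoppedExperiment : (stoppedExperiment M hθ n a b r).IsIto C := by
  obtain ⟨hC1, hC2, hC3, hC4⟩ := hM.le_of_regularityConst_le hC
  have hC0 : 0 ≤ C := by linarith [hM.mean_nonneg]
  have h1C : 1 ≤ C := by linarith [hM.mean_nonneg]
  exact ⟨_, _, isBrownianMotion_observation (q + 1) n, isPoissonRandomMeasure_observation (q + 1) n,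
    indepFun_observation (q + 1) n,
    (brownianPath_isRealBrownian q n).isItoSemimartingale (i₀ := 0) (fun _ _ => rfl)
      (g := fun t => M.mean θ t 0) (M.mean_time θ hθ 0)
      (fun t ht => (hM.deriv_le t ht).trans hC2) h1C _,
    fun i => isItoSemimartingale_zero hC0 _⟩

end Regularity

end

section

/-! ### Indistinguishable hypotheses -/

variable {p q : ℕ} {M : ParametricModel p q} {θ : EuclideanSpace ℝ (Fin p)} (hθ : θ ∈ M.Θ)
  {m L c S : ℝ} (hM : M.Bounds θ m L c S)

-- Both data sets are the same map `T` applied to noise: pure noise under the null, and noise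
-- shifted by the stopped path divided by `σ` under the alternative. The cost of a random shift then
-- combines with the smallness of the stopped path.
include hM in
lemma measure_data_stoppedExperiment_le {n : ℕ} {a N η : ℝ} (ha : 0 < a) (hN : 1 ≤ N) (r : I)
    (hη : ((n : ℝ) * (r + N ^ 4 * a ^ 2) + 1) * (N * a / c) ^ 2 ≤ η) {R : Set (Data p q n)}
    (hR : MeasurableSet R) :
    (stoppedExperiment M hθ n a (N * a) r).P ((stoppedExperiment M hθ n a (N * a) r).data ⁻¹' R) ≤
      (stoppedExperiment M hθ n 0 0 r).P ((stoppedExperiment M hθ n 0 0 r).data ⁻¹' R) +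
        ENNReal.ofReal (2 / N) + ENNReal.ofReal √(Real.exp η - 1) := by
  set sd : Fin n → ℝ := fun i => √(M.var θ (gridTime n i) 0) with hsd
  have hsd0 : ∀ i, sd i ≠ 0 := fun i => (hM.pos.trans_le (hM.le_sd _)).ne'
  set T : (Fin n → ℝ) → Data p q n := fun g =>
    (fun i => M.mean θ (gridTime n i) 0 + sd i * g i, fun _ => 0, θ) with hT
  have hTm : Measurable T := by
    refine Measurable.prodMk (measurable_pi_lambda _ fun i => ?_) measurable_const
    exact measurable_const.add (measurable_const.mul (measurable_pi_apply i))
  have hw := isRealBrownian_driving (q + 1) 0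
  set x : DrivingSpace (q + 1) → Fin n → ℝ := fun ω i =>
    stopPath a (N * a) r (fun u => brownian 0 u ω.1) (gridTime n i) / sd i with hx
  have hxm : Measurable x := measurable_pi_lambda _ fun i =>
    ((hw.measurable_stopPath _).mono ((drivingFiltration (q + 1)).le _) le_rfl).div_const _
  have h1 : (stoppedExperiment M hθ n a (N * a) r).data ⁻¹' R =
      {z : ObservationSpace (q + 1) n | z.2 + x z.1 ∈ T ⁻¹' R} := by
    ext z
    have : (stoppedExperiment M hθ n a (N * a) r).data z = T (z.2 + x z.1) := by
      simp only [Experiment.data, stoppedExperiment, hT, hx, Pi.add_apply]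
      congr 1
      ext i
      rw [mul_add, mul_div_cancel₀ _ (hsd0 i)]
      ring
    simp only [Set.mem_preimage, this]
    rfl
  have h0 : (stoppedExperiment M hθ n 0 0 r).data ⁻¹' R = Prod.snd ⁻¹' (T ⁻¹' R) := by
    ext z
    have : (stoppedExperiment M hθ n 0 0 r).data z = T z.2 := by
      simp only [Experiment.data, stoppedExperiment, hT, stopPath_zero, add_zero, hsd]
    simp only [Set.mem_preimage, this]
    rfl
  have hmp : MeasurePreserving Prod.snd (observationMeasure (q + 1) n) (noiseMeasure n) :=
    measurePreserving_snd
  have h0' : (stoppedExperiment M hθ n 0 0 r).P ((stoppedExperiment M hθ n 0 0 r).data ⁻¹' R) =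
      noiseMeasure n (T ⁻¹' R) := by
    rw [h0]
    exact hmp.measure_preimage (hTm hR).nullMeasurableSet
  rw [h0', h1]
  refine (prod_noiseMeasure_add_le hxm (hTm hR) η).trans ?_
  gcongr
  refine le_trans (measure_mono fun ω hω => ?_)
    (hw.measure_sum_sq_stopPath_le (n := n) ha hN hM.pos (fun i => hM.le_sd (gridTime n i)) r)
  exact hη.trans_lt hω

include hM in
/-- No test detects a stopped Brownian signal which is small in the appropriate sense. -/
lemma not_detects_of_stoppedExperiment {H₀ H₁ : ∀ n : ℕ, Experiment p q n → Prop}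
    {D : ∀ (n : ℕ) (E : Experiment p q n), Set E.Ω} {R : ∀ n : ℕ, Set (Data p q n)}
    (hR : ∀ n, MeasurableSet (R n)) {a : ℕ → ℝ} {r : ℕ → I} (ha : ∀ᶠ n in atTop, 0 < a n)
    (hlim1 : Tendsto (fun n : ℕ => (n : ℝ) * r n * a n ^ 2) atTop (𝓝 0))
    (hlim2 : Tendsto (fun n : ℕ => (n : ℝ) * a n ^ 4) atTop (𝓝 0))
    (h₀ : ∀ n, H₀ n (stoppedExperiment M hθ n 0 0 (r n)))
    (h₁ : ∀ n b, a n ∈ Set.Icc 0 b → b ≤ 1 → H₁ n (stoppedExperiment M hθ n (a n) b (r n)))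
    (hD : ∀ᶠ n in atTop, ∀ b, D n (stoppedExperiment M hθ n (a n) b (r n)) = Set.univ) :
    ¬ Detects H₀ H₁ D R := by
  rintro ⟨hsize, hpower⟩
  obtain ⟨c₀, hc₀, hc₁⟩ := ENNReal.lt_iff_exists_nnreal_btwn.1 hsize
  have hc₁' : (c₀ : ℝ) < 1 := by exact_mod_cast hc₁
  -- Three errors of size `κ` occur: missed detection, exceptional paths and the Gaussian shift. As
  -- `c₀ + 3κ < 1`, they cannot add up to the full probability of the event.
  set κ : ℝ := (1 - c₀) / 4 with hκ
  have hκ0 : 0 < κ := by linarith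
  -- This handles the extra `+ 1` from counting grid points and ensures that the barrier `N * a n`
  -- is eventually at most `1`.
  have hasq : Tendsto (fun n => a n ^ 2) atTop (𝓝 0) := by
    have h4 : Tendsto (fun n => a n ^ 4) atTop (𝓝 0) := by
      refine tendsto_of_tendsto_of_tendsto_of_le_of_le' tendsto_const_nhds hlim2
        (Eventually.of_forall fun n => by positivity) ?_
      filter_upwards [eventually_ge_atTop 1] with n hn
      have : (1 : ℝ) ≤ n := by exact_mod_cast hn
      exact le_mul_of_one_le_left (by positivity) this
    have := h4.sqrt
    rw [Real.sqrt_zero] at this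
    refine this.congr fun n => ?_
    rw [show a n ^ 4 = (a n ^ 2) ^ 2 by ring, Real.sqrt_sq (sq_nonneg _)]
  set N : ℝ := max 1 (2 / κ) with hN
  have hN1 : 1 ≤ N := le_max_left _ _
  have hN0 : 0 < N := by linarith
  have hNκ : 2 / N ≤ κ := by
    rw [div_le_iff₀ hN0, ← div_le_iff₀' hκ0]
    exact le_max_right _ _
  -- Chosen so that the shift cost `√(exp η - 1)` equals `κ` exactly.
  set η : ℝ := Real.log (1 + κ ^ 2) with hη
  have hη0 : 0 < η := Real.log_pos (by nlinarith)
  have hηκ : √(Real.exp η - 1) = κ := by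
    rw [hη, Real.exp_log (by positivity), add_sub_cancel_left, Real.sqrt_sq hκ0.le]
  have e1 : ∀ᶠ n : ℕ in atTop,
      ((n : ℝ) * (r n + N ^ 4 * a n ^ 2) + 1) * (N * a n / c) ^ 2 ≤ η := by
    have h : Tendsto (fun n : ℕ => ((n : ℝ) * r n * a n ^ 2 + N ^ 4 * (n * a n ^ 4) + a n ^ 2) *
        (N / c) ^ 2) atTop (𝓝 ((0 + N ^ 4 * 0 + 0) * (N / c) ^ 2)) :=
      ((hlim1.add (hlim2.const_mul _)).add hasq).mul_const _
    rw [mul_zero, add_zero, add_zero, zero_mul] at h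
    filter_upwards [h.eventually_le_const hη0] with n hn
    refine le_trans (le_of_eq ?_) hn
    ring
  have e2 : ∀ᶠ n : ℕ in atTop, N * a n ≤ 1 := by
    have h := (hasq.const_mul (N ^ 2)).eventually_le_const (u := 1) (by simp)
    filter_upwards [h] with n hn
    rw [← mul_pow] at hn
    exact (le_abs_self _).trans ((sq_le_one_iff_abs_le_one _).1 hn)
  have e3 := eventually_lt_of_limsup_lt hc₀
  have e4 := hpower.eventually_le_const (u := ENNReal.ofReal κ) (by simpa using hκ0)
  obtain ⟨n, hn1, hn2, hn3, hn4, hn5, hn6⟩ := (e1.and (e2.and (e3.and (e4.and (ha.and hD))))).exists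
  set E₀ := stoppedExperiment M hθ n 0 0 (r n)
  set E₁ := stoppedExperiment M hθ n (a n) (N * a n) (r n)
  have hE₀ : E₀.P (E₀.data ⁻¹' R n) ≤ c₀ :=
    (le_iSup₂_of_le (f := fun (E : Experiment p q n) (_ : H₀ n E) => E.P (E.data ⁻¹' R n))
      E₀ (h₀ n) le_rfl).trans hn3.le
  have hE₁ : E₁.P (D n E₁ \ E₁.data ⁻¹' R n) ≤ ENNReal.ofReal κ :=
    (le_iSup₂_of_le (f := fun (E : Experiment p q n) (_ : H₁ n E) =>
      E.P (D n E \ E.data ⁻¹' R n)) E₁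
      (h₁ n _ ⟨hn5.le, le_mul_of_one_le_left hn5.le hN1⟩ hn2) le_rfl).trans hn4
  have hcmp := measure_data_stoppedExperiment_le hθ hM hn5 hN1 (r n) hn1 (hR n)
  rw [hηκ] at hcmp
  have htot : (1 : ℝ≥0∞) ≤ ENNReal.ofReal κ + (c₀ + ENNReal.ofReal κ + ENNReal.ofReal κ) := by
    calc (1 : ℝ≥0∞) = E₁.P (D n E₁) := by rw [hn6, measure_univ]
      _ ≤ E₁.P (D n E₁ \ E₁.data ⁻¹' R n) + E₁.P (E₁.data ⁻¹' R n) := by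
          refine le_trans (measure_mono ?_) (measure_union_le _ _)
          exact Set.subset_sdiff_union _ _
      _ ≤ _ := by
          refine add_le_add hE₁ (hcmp.trans ?_)
          gcongr
  rw [← ENNReal.ofReal_coe_nnreal, ← ENNReal.ofReal_add (by positivity) (by positivity),
    ← ENNReal.ofReal_add (by positivity) (by positivity),
    ← ENNReal.ofReal_add (by positivity) (by positivity), ENNReal.one_le_ofReal] at htot
  linarith

lemma signal_stoppedExperiment {n : ℕ} {a b : ℝ} {r : I} (t : I) (ω : ObservationSpace (q + 1) n) :
    (stoppedExperiment M hθ n a b r).signal M ((stoppedExperiment M hθ n a b r).θhat ω) t ω =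
      stopPath a b r (fun u => brownian 0 u ω.1.1) t / √(M.var θ t 0) := by
  simp only [Experiment.signal, stoppedExperiment, add_sub_cancel_left]

-- At time `0` the stopped path still equals `a`, so the signal attains the threshold there for
-- every outcome, whatever the barrier.
include hM in
lemma supEvent_stoppedExperiment {n : ℕ} {a b ρ : ℝ} (h : ρ * √(M.var θ (0 : I) 0) ≤ a) :
    (stoppedExperiment M hθ n a b 0).supEvent M ρ = Set.univ := by
  refine Set.eq_univ_of_forall fun ω => ?_
  change ENNReal.ofReal ρ ≤ ⨆ t : I, ‖(stoppedExperiment M hθ n a b 0).signal M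
    ((stoppedExperiment M hθ n a b 0).θhat ω) t ω‖ₑ
  refine le_iSup_of_le 0 ?_
  have hs : (stoppedExperiment M hθ n a b 0).signal M
      ((stoppedExperiment M hθ n a b 0).θhat ω) 0 ω =
      stopPath a b 0 (fun u => brownian 0 u ω.1.1) 0 / √(M.var θ (0 : I) 0) :=
    signal_stoppedExperiment hθ 0 ω
  rw [hs, stopPath_of_le le_rfl, ← ofReal_norm]
  refine ENNReal.ofReal_le_ofReal (le_trans ?_ (le_abs_self _))
  rwa [le_div_iff₀ (hM.pos.trans_le (hM.le_sd 0))]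

-- The first dyadic interval is `(0, r]`, on which the path equals `a`, so the signal is at least `a
-- / S` there; the term `k = 0` of the maximum suffices.
include hM in
lemma dyadicEvent_stoppedExperiment {n j : ℕ} {a b ρ : ℝ} (ha : 0 ≤ a) {r : I}
    (hr : (r : ℝ) = 1 / 2 ^ j) (h : ρ ≤ (2 : ℝ) ^ ((j : ℝ) / 2) * (a / S * r)) :
    (stoppedExperiment M hθ n a b r).dyadicEvent M j ρ = Set.univ := by
  refine Set.eq_univ_of_forall fun ω => h.trans ?_
  have hpos : 0 < 2 ^ j := by positivity
  refine le_trans ?_ (le_ciSup (Set.finite_range _).bddAbove (⟨0, hpos⟩ : Fin (2 ^ j)))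
  have hset : {t : I | (t : ℝ) ∈ Set.Ioc ((((⟨0, hpos⟩ : Fin (2 ^ j)) : ℕ) : ℝ) / 2 ^ j)
      (((((⟨0, hpos⟩ : Fin (2 ^ j)) : ℕ) : ℝ) + 1) / 2 ^ j)} = Set.Ioc 0 r := by
    ext t
    simp only [Nat.cast_zero, zero_div, zero_add, ← hr]
    rfl
  rw [hset]
  have hs : ∀ t : I, (stoppedExperiment M hθ n a b r).signal M
      ((stoppedExperiment M hθ n a b r).θhat ω) t ω =
      stopPath a b r (fun u => brownian 0 u ω.1.1) t / √(M.var θ t 0) := fun t =>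
    signal_stoppedExperiment hθ t ω
  simp only [hs]
  have hc : Continuous fun t : I => stopPath a b r (fun u => brownian 0 u ω.1.1) t /
      √(M.var θ t 0) :=
    (continuous_stopPath (continuous_brownian 0 ω.1.1)).div (M.continuous_var hθ).sqrt
      fun t => (hM.pos.trans_le (hM.le_sd t)).ne'
  have hi : Integrable (fun t : I => stopPath a b r (fun u => brownian 0 u ω.1.1) t /
      √(M.var θ t 0)) volume := by
    rw [← integrableOn_univ]
    exact hc.continuousOn.integrableOn_compact isCompact_univ
  have hle : a / S * r ≤ ∫ t in Set.Ioc (0 : I) r,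
      stopPath a b r (fun u => brownian 0 u ω.1.1) t / √(M.var θ t 0) := by
    have hconst : ∫ t in Set.Ioc (0 : I) r, a / S = a / S * r := by
      rw [setIntegral_const, smul_eq_mul, measureReal_def, unitInterval.volume_Ioc]
      simp [r.2.1, mul_comm]
    rw [← hconst]
    refine setIntegral_mono_on (integrable_const _).integrableOn hi.integrableOn measurableSet_Ioc
      fun t ht => ?_
    rw [stopPath_of_le ht.2]
    exact div_le_div_of_nonneg_left ha (hM.pos.trans_le (hM.le_sd t)) (hM.sd_le t)
  gcongr
  exact hle.trans (le_abs_self _)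

end

section

/-! ### Rates of the signals -/

lemma tendsto_mul_pow_four_of_rate {δ : ℕ → ℝ} (hδ : Tendsto δ atTop (𝓝 0)) (v : ℝ) :
    Tendsto (fun n : ℕ => (n : ℝ) * (δ n * (n : ℝ) ^ (-(1 / 4) : ℝ) * v) ^ 4) atTop (𝓝 0) := by
  have h := (hδ.pow 4).mul_const (v ^ 4)
  simp only [ne_eq, OfNat.ofNat_ne_zero, not_false_eq_true, zero_pow, zero_mul] at h
  refine h.congr' ?_
  filter_upwards [eventually_gt_atTop 0] with n hn
  have hn' : (0 : ℝ) < n := by exact_mod_cast hn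
  have e : ((n : ℝ) ^ (-(1 / 4) : ℝ)) ^ 4 = (n : ℝ)⁻¹ := by
    rw [← Real.rpow_natCast, ← Real.rpow_mul hn'.le, ← Real.rpow_neg_one]
    norm_num
  rw [mul_pow, mul_pow, e]
  field_simp

/-- The size of the signal at the dyadic scale `2^{-j}`. -/
def dyadicSignal (S : ℝ) (δ : ℕ → ℝ) (j : ℕ → ℕ) (n : ℕ) : ℝ :=
  S * (δ n * (n : ℝ) ^ (-(1 / 2) : ℝ)) * (2 : ℝ) ^ ((j n : ℝ) / 2)

lemma dyadicSignal_sq (S : ℝ) (δ : ℕ → ℝ) (j : ℕ → ℕ) {n : ℕ} (hn : 0 < n) :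
    dyadicSignal S δ j n ^ 2 = S ^ 2 * δ n ^ 2 * (n : ℝ)⁻¹ * 2 ^ j n := by
  have hn' : (0 : ℝ) < n := by exact_mod_cast hn
  have e1 : ((n : ℝ) ^ (-(1 / 2) : ℝ)) ^ 2 = (n : ℝ)⁻¹ := by
    rw [← Real.rpow_natCast, ← Real.rpow_mul hn'.le, ← Real.rpow_neg_one]
    norm_num
  have e2 : ((2 : ℝ) ^ ((j n : ℝ) / 2)) ^ 2 = 2 ^ j n := by
    rw [← Real.rpow_natCast, ← Real.rpow_mul zero_le_two, ← Real.rpow_natCast]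
    congr 1
    push_cast
    ring
  rw [dyadicSignal, mul_pow, mul_pow, mul_pow, e1, e2]
  ring

lemma tendsto_mul_dyadicSignal_sq {δ : ℕ → ℝ} (hδ : Tendsto δ atTop (𝓝 0)) (S : ℝ) (j : ℕ → ℕ) :
    Tendsto (fun n : ℕ => (n : ℝ) * (1 / 2 ^ j n) * dyadicSignal S δ j n ^ 2) atTop (𝓝 0) := by
  have h := (hδ.pow 2).const_mul (S ^ 2)
  simp only [ne_eq, OfNat.ofNat_ne_zero, not_false_eq_true, zero_pow, mul_zero] at h
  refine h.congr' ?_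
  filter_upwards [eventually_gt_atTop 0] with n hn
  have hn' : (0 : ℝ) < n := by exact_mod_cast hn
  rw [dyadicSignal_sq S δ j hn]
  field_simp

/-- Up to constants the quantity is `δ⁴ 2^{2j}/n`, and the upper bound on `2^J` makes `2^{2j}/n`
bounded. This is where the restriction to scales no finer than `n^{-1/2}` enters. -/
lemma tendsto_mul_dyadicSignal_pow_four {δ : ℕ → ℝ} (hδ : Tendsto δ atTop (𝓝 0)) (S : ℝ)
    {j J : ℕ → ℕ} (hJ : (fun n => (2 : ℝ) ^ J n) =O[atTop] fun n : ℕ => (n : ℝ) ^ (1 / 2 : ℝ))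
    (hj : ∀ n, j n ≤ J n) :
    Tendsto (fun n : ℕ => (n : ℝ) * dyadicSignal S δ j n ^ 4) atTop (𝓝 0) := by
  obtain ⟨k, hk⟩ := hJ.bound
  have h := (hδ.pow 4).const_mul (S ^ 4 * k ^ 2)
  simp only [ne_eq, OfNat.ofNat_ne_zero, not_false_eq_true, zero_pow, mul_zero] at h
  refine tendsto_of_tendsto_of_tendsto_of_le_of_le' tendsto_const_nhds h
    (Eventually.of_forall fun n => by positivity) ?_
  filter_upwards [hk, eventually_gt_atTop 0] with n hk hn
  have hn' : (0 : ℝ) < n := by exact_mod_cast hn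
  have h1 : (2 : ℝ) ^ j n ≤ k * (n : ℝ) ^ (1 / 2 : ℝ) := by
    rw [Real.norm_of_nonneg (by positivity), Real.norm_of_nonneg (by positivity)] at hk
    exact (pow_le_pow_right₀ one_le_two (hj n)).trans hk
  have h2 : ((2 : ℝ) ^ j n) ^ 2 ≤ k ^ 2 * n := by
    have h3 := pow_le_pow_left₀ (by positivity) h1 2
    have h4 : ((n : ℝ) ^ (1 / 2 : ℝ)) ^ 2 = n := by
      rw [← Real.sqrt_eq_rpow, Real.sq_sqrt hn'.le]
    rwa [mul_pow, h4] at h3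
  calc (n : ℝ) * dyadicSignal S δ j n ^ 4
      = (n : ℝ) * (dyadicSignal S δ j n ^ 2) ^ 2 := by ring
    _ = S ^ 4 * δ n ^ 4 * (n : ℝ)⁻¹ * (2 ^ j n) ^ 2 := by
        rw [dyadicSignal_sq S δ j hn]
        field_simp
    _ ≤ S ^ 4 * δ n ^ 4 * (n : ℝ)⁻¹ * (k ^ 2 * n) := by gcongr
    _ = S ^ 4 * k ^ 2 * δ n ^ 4 := by field_simp

end

end SemimartingaleDetection

end

/-! ### The main theorem -/

open SemimartingaleDetection in
theorem theorem3 {p q : ℕ} (M : ParametricModel p q) (ε : ℝ) (hε : 0 < ε) :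
    ∃ C₀ : ℝ, ∀ (C : ℝ) (K₀ K₁ : ℝ → ℝ), C₀ ≤ C →
      (∀ η, 0 < η → C₀ ≤ K₀ η) → (∀ η, 0 < η → C₀ ≤ K₁ η) →
      ∀ δ : ℕ → ℝ, (∀ n, 0 < δ n) → Tendsto δ atTop (𝓝 0) →
        (¬ ∃ R : ∀ n : ℕ, Set (Data p q n), (∀ n, MeasurableSet (R n)) ∧
          Detects (fun _ E => E.IsNull M ε C K₀ ∧ E.IsIto C)
            (fun _ E => E.IsAlternative M ε C K₁ ∧ E.IsIto C)
            (fun n E => E.supEvent M (δ n * (n : ℝ) ^ (-(1 / 4) : ℝ))) R) ∧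
        (∀ J : ℕ → ℕ,
          (fun n => (2 : ℝ) ^ J n) =Θ[atTop] (fun n : ℕ => (n : ℝ) ^ (1 / 2 : ℝ)) →
          ∀ j : ℕ → ℕ, (∀ n, j n ≤ J n) →
            ¬ ∃ R : ∀ n : ℕ, Set (Data p q n), (∀ n, MeasurableSet (R n)) ∧
              Detects (fun _ E => E.IsNull M ε C K₀) (fun _ E => E.IsAlternative M ε C K₁)
                (fun n E => E.dyadicEvent M (j n) (δ n * (n : ℝ) ^ (-(1 / 2) : ℝ))) R) := by

  obtain ⟨θ, hθ⟩ := M.nonempty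
  obtain ⟨m, L, c, S, hM⟩ := M.exists_bounds hθ
  -- The first term covers both assumptions for all signals used. The second is needed because `θ̂ =
  -- θ` must obey the tail bound of the alternative; it also makes `K₀` nonnegative, which is enough
  -- for the null.
  refine ⟨max (regularityConst m L S ε) ‖θ‖, fun C K₀ K₁ hC hK₀ hK₁ δ hδ hδ0 => ?_⟩
  have hC' : regularityConst m L S ε ≤ C := (le_max_left _ _).trans hC
  have hK₀' : ∀ η, 0 < η → 0 ≤ K₀ η := fun η hη =>
    ((norm_nonneg θ).trans (le_max_right _ _)).trans (hK₀ η hη)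
  have hK₁' : ∀ η, 0 < η → ‖θ‖ ≤ K₁ η := fun η hη => (le_max_right _ _).trans (hK₁ η hη)
  constructor
  · rintro ⟨R, hR, hdet⟩
    have hv : 0 < √(M.var θ (0 : I) 0) := hM.pos.trans_le (hM.le_sd 0)
    -- With `r = 0` and this `a`, the signal at time `0` equals the threshold exactly, and the
    -- condition on `n r a²` is trivial.
    refine not_detects_of_stoppedExperiment hθ hM hR
      (a := fun n => δ n * (n : ℝ) ^ (-(1 / 4) : ℝ) * √(M.var θ (0 : I) 0)) (r := fun _ => 0)
      ?_ ?_ (tendsto_mul_pow_four_of_rate hδ0 _) (fun n => ⟨?_, ?_⟩) (fun n b ha hb => ⟨?_, ?_⟩)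
      ?_ hdet
    · filter_upwards [eventually_gt_atTop 0] with n hn
      have hn' : (0 : ℝ) < n := by exact_mod_cast hn
      have := hδ n
      positivity
    · simp
    · exact Eventually.of_forall fun n b => supEvent_stoppedExperiment hθ hM le_rfl
    · exact isNull_stoppedExperiment hθ hM 0 hε hC' hK₀'
    · exact isIto_stoppedExperiment hθ hM 0 hC'
    · exact isAlternative_stoppedExperiment hθ hM ha hb 0 hε hC' hK₁'
    · exact isIto_stoppedExperiment hθ hM 0 hC'
  · rintro J hJ j hj ⟨R, hR, hdet⟩
    have hS : 0 < S := hM.pos.trans_le ((hM.le_sd 0).trans (hM.sd_le 0))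
    have hr : ∀ n, (1 : ℝ) / 2 ^ j n ∈ Set.Icc (0 : ℝ) 1 := fun n =>
      ⟨by positivity, div_le_one_of_le₀ (one_le_pow₀ one_le_two) (by positivity)⟩
    have ha0 : ∀ n, 0 ≤ dyadicSignal S δ j n := fun n => by
      have := (hδ n).le
      unfold dyadicSignal
      positivity
    -- With `r = 2^{-j}` and `a = S δ n^{-1/2} 2^{j/2}`, the lower bound `2^{j/2} (a/S) r` for the
    -- dyadic statistic equals the threshold exactly.
    refine not_detects_of_stoppedExperiment hθ hM hR (a := dyadicSignal S δ j)
      (r := fun n => ⟨1 / 2 ^ j n, hr n⟩) ?_ (tendsto_mul_dyadicSignal_sq hδ0 S j)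
      (tendsto_mul_dyadicSignal_pow_four hδ0 S hJ.1 hj) (fun n => ?_) (fun n b ha hb => ?_) ?_ hdet
    · filter_upwards [eventually_gt_atTop 0] with n hn
      have hn' : (0 : ℝ) < n := by exact_mod_cast hn
      have := hδ n
      unfold dyadicSignal
      positivity
    · exact isNull_stoppedExperiment hθ hM _ hε hC' hK₀'
    · exact isAlternative_stoppedExperiment hθ hM ha hb _ hε hC' hK₁'
    · refine Eventually.of_forall fun n b =>
        dyadicEvent_stoppedExperiment hθ hM (ha0 n) rfl (le_of_eq ?_)
      have e : (2 : ℝ) ^ ((j n : ℝ) / 2) * (2 : ℝ) ^ ((j n : ℝ) / 2) = 2 ^ j n := by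
        rw [← Real.rpow_add two_pos, add_halves, Real.rpow_natCast]
      simp only [dyadicSignal]
      rw [← e]
      field_simp
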